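/- **Theorem 3 (Cut sets do not contribute).** Let $\Gamma$ be a connected amputated Feynman graph with finitely many vertices $v\in V$ and oriented internal lines $i\in\{1,\dots,I\}$ (multiple lines and lines from a vertex to itself are allowed), $L=I-|V|+1$, and let $\omega=(\omega_v)_{v\in V}$ be real external Euclidean energies with $\sum_v\omega_v=0$. Each internal line is either scalar, with propagator $\Delta_i(k,E)=\frac{1}{k^2+E^2}$, or fermionic with mass $m_i$ and spatial momentum $\mathbf k_i\in\mathbb R^3$, with propagator the $4\times4$ matrix $$\Delta_i(k,E)=\frac{m_i+ik\gamma^0-\mathbf k_i\cdot\boldsymbol\gamma}{k^2+E^2},\qquad \{\gamma^\mu,\gamma^\nu\}=2\eta^{\mu\nu},\quad \eta=\mathrm{diag}(1,-1,-1,-1),$$ where $m_i$ and $\mathbf k_i$ are kept fixed when $E$ varies, and the spin indices of the propagators are contracted with an arbitrary constant tensor that comes from the vertices. For line energies $E=(E_1,\dots,E_I)$ with all $E_i>0$, the zero-temperature $D$-function is $$D_0(\omega,E)=\prod_{i=1}^I 2E_i\ \int\prod_{l\notin\mathcal T}\frac{dk_l}{2\pi}\ \prod_{i=1}^I\Delta_i(k_i,E_i),$$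 where $\mathcal T$ is any spanning tree, the $L$ energies $k_l$, $l\notin\mathcal T$, are the independent ones, the others are determined by conservation of energy at each vertex, and the integral is understood as the limit $\Lambda\to\infty$ of the integrals over the region $|k_i|\le\Lambda$ for all $i$. Then this limit exists, and $E\mapsto D_0(\omega,E)$ is a rational function of $E_1,\dots,E_I$ whose denominator has no zero with all $E_i>0$; through it, $D_0(\omega,E)$ is extended to arbitrary signs of the $E_i$. Let $\hat S_i$ be the reflection operator that replaces $E_i$ by $-E_i$ in a function of $E_1,\dots,E_I$. A cut set is a set $C$ of internal lines such that the graph becomes disconnected when the lines in $C$ are snipped. For every cut set $C$, the operator $\hat A(C)=\prod_{i\in C}(1+\hat S_i)$ annihilates the zero-temperature $D$-function: $$\Big[\prod_{i\in C}(1+\hat S_i)\,D_0\Big](\omega,E)=0,$$ as an identity of rational functions of $E$, that is, at every real $E$ for which no denominator in the sum vanishes. -/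

import Mathlib

/-- The kind of an internal line: a scalar line, or a fermionic line with its mass `m` and its
spatial momentum `q` (for a scalar line both enter through the kinematic energy only). -/
inductive LineKind : Type
  | scalar : LineKind
  | fermion (m : ℝ) (q : Fin 3 → ℝ) : LineKind

/-- Number of values of a spin index of a line. -/
abbrev LineKind.spinDim : LineKind → ℕ
  | .scalar => 1
  | .fermion _ _ => 4

/-- The matrices `γ⁰, γ¹, γ², γ³` satisfy `{γ^μ, γ^ν} = 2 η^{μν}`, where `η = diag(1,-1,-1,-1)`. -/
def IsDiracGamma (γ : Fin 4 → Matrix (Fin 4) (Fin 4) ℂ) : Prop :=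
  ∀ μ ν, γ μ * γ ν + γ ν * γ μ =
    (if μ = ν then (if μ = 0 then (2 : ℂ) else -2) else 0) • (1 : Matrix (Fin 4) (Fin 4) ℂ)

/-- Numerator of the Euclidean propagator of a line that carries the energy `k`: it is `1` for a
scalar line and `m + i k γ⁰ - q · γ` for a fermionic one. -/
noncomputable def LineKind.numerator (γ : Fin 4 → Matrix (Fin 4) (Fin 4) ℂ) :
    (κ : LineKind) → ℝ → Matrix (Fin κ.spinDim) (Fin κ.spinDim) ℂ
  | .scalar, _ => (1 : Matrix (Fin 1) (Fin 1) ℂ)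
  | .fermion m q, k =>
      ((m : ℂ) • (1 : Matrix (Fin 4) (Fin 4) ℂ) + (Complex.I * (k : ℂ)) • γ 0
        - ∑ j : Fin 3, (q j : ℂ) • γ j.succ : Matrix (Fin 4) (Fin 4) ℂ)

/-- The propagator: numerator over `k² + E²`. -/
noncomputable def LineKind.propagator (γ : Fin 4 → Matrix (Fin 4) (Fin 4) ℂ) (κ : LineKind)
    (k E : ℝ) : Matrix (Fin κ.spinDim) (Fin κ.spinDim) ℂ :=
  (((k ^ 2 + E ^ 2 : ℝ) : ℂ)⁻¹) • κ.numerator γ k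

/-- An amputated Feynman graph with vertices `V` and internal lines `ι`. Each line is oriented from
`src` to `tgt`; the orientation fixes the sign of its energy. Multiple lines and lines from a vertex
to itself are allowed. -/
structure FeynmanGraph (V ι : Type*) where
  src : ι → V
  tgt : ι → V
  kind : ι → LineKind

namespace FeynmanGraph

variable {V ι : Type*}

/-- The simple graph on the vertices in which two distinct vertices are adjacent when a line in `A`
joins them. -/
def joinedBy (G : FeynmanGraph V ι) (A : Set ι) : SimpleGraph V :=
  SimpleGraph.fromRel fun u v => ∃ i ∈ A, G.src i = u ∧ G.tgt i = v

/-- The graph is connected. -/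
def IsConnected (G : FeynmanGraph V ι) : Prop :=
  (G.joinedBy Set.univ).Connected

/-- `C` is a cut set: the graph is disconnected once the lines in `C` are snipped. -/
def IsCutSet (G : FeynmanGraph V ι) (C : Finset ι) : Prop :=
  ¬ (G.joinedBy {i | i ∉ C}).Connected

/-- `T` is (the set of lines of) a spanning tree: it joins all vertices and has `|V| - 1` lines. -/
def IsSpanningTree [Fintype V] (G : FeynmanGraph V ι) (T : Finset ι) : Prop :=
  (G.joinedBy {i | i ∈ T}).Connected ∧ T.card + 1 = Fintype.card V

/-- Conservation of energy at each vertex, where `ω v` is the external energy entering at `v` and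
`k i` is the energy carried by the line `i`. -/
def Conserves [Fintype ι] [DecidableEq V] (G : FeynmanGraph V ι) (ω : V → ℝ) (k : ι → ℝ) : Prop :=
  ∀ v, ω v + ∑ i with G.tgt i = v, k i = ∑ i with G.src i = v, k i

/-- The line energies as functions of the independent energies `x`, those of the lines outside the
spanning tree `T`: the solution `k` of the conservation laws with `k l = x l` for `l ∉ T`. (It
exists and is unique when `T` is a spanning tree and the external energies add up to zero.) -/
noncomputable def lineEnergy [Fintype ι] [DecidableEq V] (G : FeynmanGraph V ι) (ω : V → ℝ)
    (T : Finset ι) (x : {l : ι // l ∉ T} → ℝ) : ι → ℝ :=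
  Classical.epsilon fun k : ι → ℝ => G.Conserves ω k ∧ ∀ l : {l : ι // l ∉ T}, k l = x l

/-- The product of all propagators and of the factor `∏ i, 2 E i`, at line energies `k`, with the
spin indices contracted with the tensor `Γ` that comes from the vertices. -/
noncomputable def integrand [Fintype ι] [DecidableEq ι] (G : FeynmanGraph V ι)
    (γ : Fin 4 → Matrix (Fin 4) (Fin 4) ℂ)
    (Γ : (∀ i, Fin (G.kind i).spinDim) → (∀ i, Fin (G.kind i).spinDim) → ℂ)
    (E k : ι → ℝ) : ℂ :=
  (∏ i, (2 * (E i : ℂ))) *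
    ∑ a : (∀ i, Fin (G.kind i).spinDim), ∑ b : (∀ i, Fin (G.kind i).spinDim),
      Γ a b * ∏ i, (G.kind i).propagator γ (k i) (E i) (a i) (b i)

/-- The zero-temperature energy integral over the independent energies `x l`, `l ∉ T`, with measure
`∏ l, dx l / (2π)`, restricted to the region where no line energy exceeds `Λ` in absolute value. -/
noncomputable def cutoffD0 [Fintype ι] [DecidableEq ι] [DecidableEq V] (G : FeynmanGraph V ι)
    (γ : Fin 4 → Matrix (Fin 4) (Fin 4) ℂ)
    (Γ : (∀ i, Fin (G.kind i).spinDim) → (∀ i, Fin (G.kind i).spinDim) → ℂ)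
    (ω : V → ℝ) (T : Finset ι) (E : ι → ℝ) (Λ : ℝ) : ℂ :=
  (((2 * Real.pi) ^ Fintype.card {l : ι // l ∉ T} : ℝ) : ℂ)⁻¹ *
    ∫ x in {x : {l : ι // l ∉ T} → ℝ | ∀ i, |G.lineEnergy ω T x i| ≤ Λ},
      G.integrand γ Γ E (G.lineEnergy ω T x)

/-- `z` is the value `D₀(ω, E)`: the limit of the energy integral as the cutoff is removed. -/
def IsD0Value [Fintype ι] [DecidableEq ι] [DecidableEq V] (G : FeynmanGraph V ι)
    (γ : Fin 4 → Matrix (Fin 4) (Fin 4) ℂ)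
    (Γ : (∀ i, Fin (G.kind i).spinDim) → (∀ i, Fin (G.kind i).spinDim) → ℂ)
    (ω : V → ℝ) (T : Finset ι) (E : ι → ℝ) (z : ℂ) : Prop :=
  Filter.Tendsto (fun Λ : ℝ => G.cutoffD0 γ Γ ω T E Λ) Filter.atTop (nhds z)

end FeynmanGraph

/-- The value at a real point `E` of a polynomial in the line energies. -/
noncomputable def evalAt {ι : Type*} (P : MvPolynomial ι ℂ) (E : ι → ℝ) : ℂ :=
  MvPolynomial.eval (fun i => (E i : ℂ)) P

/-- The rational function `P / Q` of the line energies. -/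
noncomputable def ratFun {ι : Type*} (P Q : MvPolynomial ι ℂ) : (ι → ℝ) → ℂ :=
  fun E => evalAt P E / evalAt Q E

/-- `P / Q` is the function `E ↦ D₀(ω, E)`: for all positive line energies its denominator is not
zero and its value is the zero-temperature energy integral. -/
def FeynmanGraph.RepresentsD0 {V ι : Type*} [Fintype ι] [DecidableEq ι] [DecidableEq V]
    (G : FeynmanGraph V ι) (γ : Fin 4 → Matrix (Fin 4) (Fin 4) ℂ)
    (Γ : (∀ i, Fin (G.kind i).spinDim) → (∀ i, Fin (G.kind i).spinDim) → ℂ)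
    (ω : V → ℝ) (T : Finset ι) (P Q : MvPolynomial ι ℂ) : Prop :=
  ∀ E : ι → ℝ, (∀ i, 0 < E i) → evalAt Q E ≠ 0 ∧ G.IsD0Value γ Γ ω T E (ratFun P Q E)

/-- Reversal of the signs of the energies `E i`, `i ∈ B`. -/
def reflectOn {ι : Type*} [DecidableEq ι] (B : Finset ι) (E : ι → ℝ) : ι → ℝ :=
  fun i => if i ∈ B then -E i else E i

/-- The reflection operator `S i`: it replaces the argument `E i` of a function by `-E i`. -/
def reflOp {ι : Type*} [DecidableEq ι] (i : ι) : Module.End ℂ ((ι → ℝ) → ℂ) where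
  toFun f := fun E => f (Function.update E i (-E i))
  map_add' _ _ := rfl
  map_smul' _ _ := rfl

theorem reflOp_commute {ι : Type*} [DecidableEq ι] (i j : ι) :
    Commute (reflOp i) (reflOp j) := by
  by_cases hij : i = j
  · subst hij
    exact Commute.refl _
  · refine LinearMap.ext fun f => funext fun E => ?_
    change f (Function.update (Function.update E i (-E i)) j
        (-(Function.update E i (-E i)) j)) =
      f (Function.update (Function.update E j (-E j)) i
        (-(Function.update E j (-E j)) i))
    rw [Function.update_of_ne hij, Function.update_of_ne (Ne.symm hij),
      Function.update_comm hij]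

theorem one_add_reflOp_commute {ι : Type*} [DecidableEq ι] (i j : ι) :
    Commute (1 + reflOp i) (1 + reflOp j) :=
  ((Commute.one_left _).add_left
    ((Commute.one_right _).add_right (reflOp_commute i j)))

theorem one_add_reflOp_pairwise {ι : Type*} [DecidableEq ι] (C : Finset ι) :
    (C : Set ι).Pairwise
      (Function.onFun Commute fun i => (1 + reflOp i : Module.End ℂ ((ι → ℝ) → ℂ))) :=
  fun i _ j _ _ => one_add_reflOp_commute i j

/-- The operator `∏ i ∈ C, (1 + S i)`; its factors commute. -/
noncomputable def annihilationOp {ι : Type*} [DecidableEq ι] (C : Finset ι) :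
    Module.End ℂ ((ι → ℝ) → ℂ) :=
  C.noncommProd (fun i => 1 + reflOp i) (one_add_reflOp_pairwise C)

/-! This is old-fashioned (time-ordered) perturbation theory. By partial fractions, `2E` times a
propagator is a sum over a sign `s` of a constant over `E + i s k`; the constant is the numerator at
the pole and depends on `s E` only (`LineKind.two_mul_propagator`). A choice of signs orients the
graph. The energy integral of the corresponding product of simple poles is, up to a factor 1/2 for
each line from a vertex to itself, a sum over the total orders of the vertices compatible with the
orientation, in which each nonempty proper initial segment `S` contributes `1 / d S`: here `d S`
adds the energies of the lines crossing the boundary of `S` and `i` times the external energy of `S`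
(`latestSum`, `FeynmanGraph.orderSum`). For a tree this follows by attaching leaves
(`TreeOn.prod_inv_eq_latestSum`); each further line is integrated by a residue
(`integral_latestSum_shiftDen`).

Now reflect the energies in `B ⊆ C` and relabel the signs on `B` at the same time. All products `s
E` stay fixed, hence so do the numerators and, in their signed form `flowDen`, the denominators;
only the order constraints of the lines in `B` are reversed. Since "a before b" plus "b before a" is
no constraint, the sum over `B` frees the lines in `C` (`FeynmanGraph.sum_latestSum_flipOn`). The
remaining constraints do not link a certain vertex set with its complement. The denominators are
additive, so the sum over the shuffles of the two parts factorizes (`chainSum_union`) and carries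
the prefactor `d V`, which is zero by conservation of energy (`latestSum_union_eq_zero`).

In a connected graph every `d S` has positive real part at positive energies, which gives
rationality and the absence of poles there. The cancellation is first proved at generic energies and
then extended as a polynomial identity (`sum_ratFun_reflectOn_eq_zero`). -/

/-! ### Sums over time orderings: recursion, constraints, factorization. -/

section TimeOrderings

variable {V : Type*} [DecidableEq V]

/-- The element `x` may be the latest one of `S`: the relation `r` (read "is earlier than") does not
put it before another element of `S`. -/
def IsLatest (r : V → V → Prop) (S : Finset V) (x : V) : Prop :=
  ∀ y ∈ S, y ≠ x → ¬ r x y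

open scoped Classical in
/-- The sum over the total orders of `S` compatible with `r` of the products of `(d S')⁻¹` over the
nonempty initial segments `S'` of the order. -/
noncomputable def chainSum (r : V → V → Prop) (d : Finset V → ℂ) (S : Finset V) : ℂ :=
  if S = ∅ then 1 else
    (d S)⁻¹ * ∑ x ∈ S.attach, if IsLatest r S x then chainSum r d (S.erase x) else 0
termination_by S.card
decreasing_by exact Finset.card_lt_card (Finset.erase_ssubset x.2)

open scoped Classical in
/-- The sum over the total orders of `S` compatible with `r` of the products of `(d S')⁻¹` over the
nonempty proper initial segments `S'` of the order. -/
noncomputable def latestSum (r : V → V → Prop) (d : Finset V → ℂ) (S : Finset V) : ℂ :=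
  ∑ x ∈ S, if IsLatest r S x then chainSum r d (S.erase x) else 0

theorem chainSum_empty (r : V → V → Prop) (d : Finset V → ℂ) : chainSum r d ∅ = 1 := by
  rw [chainSum]; simp

theorem chainSum_of_nonempty (r : V → V → Prop) (d : Finset V → ℂ) {S : Finset V}
    (hS : S.Nonempty) : chainSum r d S = (d S)⁻¹ * latestSum r d S := by
  classical
  rw [chainSum, if_neg hS.ne_empty, latestSum]
  congr 1
  exact Finset.sum_attach S fun x => if IsLatest r S x then chainSum r d (S.erase x) else 0

theorem latestSum_empty (r : V → V → Prop) (d : Finset V → ℂ) : latestSum r d ∅ = 0 := by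
  simp [latestSum]

/-- The recursion in a form that covers the empty set too, where `d ∅ = 0` makes both sides vanish.
-/
theorem mul_chainSum (r : V → V → Prop) (d : Finset V → ℂ) {S : Finset V}
    (h : S.Nonempty → d S ≠ 0) (h0 : d ∅ = 0) :
    d S * chainSum r d S = latestSum r d S := by
  rcases S.eq_empty_or_nonempty with rfl | hS
  · rw [h0, latestSum_empty, zero_mul]
  · rw [chainSum_of_nonempty r d hS, mul_inv_cancel_left₀ (h hS)]

/-- The recursion visits only sets obtained by removing latest elements, so the data need to agree
only on a class `D` closed under this. It is used for denominators that coincide on some vertex sets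
but not on all. -/
theorem chainSum_congr {r r' : V → V → Prop} {d d' : Finset V → ℂ} (D : Finset V → Prop)
    (hD : ∀ S x, D S → x ∈ S → IsLatest r S x → D (S.erase x))
    (hd : ∀ S, D S → S.Nonempty → d S = d' S)
    (hr : ∀ S x, D S → x ∈ S → (IsLatest r S x ↔ IsLatest r' S x)) (S : Finset V) (hS : D S) :
    chainSum r d S = chainSum r' d' S := by
  induction S using Finset.strongInduction with
  | H S ih =>
    rcases S.eq_empty_or_nonempty with rfl | hne
    · simp only [chainSum_empty]
    · rw [chainSum_of_nonempty _ _ hne, chainSum_of_nonempty _ _ hne, hd S hS hne]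
      congr 1
      refine Finset.sum_congr rfl fun x hx => ?_
      by_cases h : IsLatest r S x
      · rw [if_pos h, if_pos ((hr S x hS hx).1 h),
          ih _ (Finset.erase_ssubset hx) (hD S x hS hx h)]
      · rw [if_neg h, if_neg (mt (hr S x hS hx).2 h)]

theorem latestSum_congr {r r' : V → V → Prop} {d d' : Finset V → ℂ} (D : Finset V → Prop)
    (hD : ∀ S x, D S → x ∈ S → IsLatest r S x → D (S.erase x))
    (hd : ∀ S, D S → S.Nonempty → d S = d' S)
    (hr : ∀ S x, D S → x ∈ S → (IsLatest r S x ↔ IsLatest r' S x)) {A : Finset V}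
    (hA : ∀ x ∈ A, IsLatest r A x → D (A.erase x))
    (hrA : ∀ x ∈ A, (IsLatest r A x ↔ IsLatest r' A x)) :
    latestSum r d A = latestSum r' d' A := by
  refine Finset.sum_congr rfl fun x hx => ?_
  by_cases h : IsLatest r A x
  · rw [if_pos h, if_pos ((hrA x hx).1 h), chainSum_congr D hD hd hr _ (hA x hx h)]
  · rw [if_neg h, if_neg (mt (hrA x hx).2 h)]

/-- The relation `r` together with the constraint that `a` is earlier than `b`. -/
def addRel (r : V → V → Prop) (a b : V) : V → V → Prop := fun x y => r x y ∨ (x = a ∧ y = b)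

theorem isLatest_addRel {r : V → V → Prop} {a b : V} {S : Finset V} {x : V} :
    IsLatest (addRel r a b) S x ↔ IsLatest r S x ∧ (x = a → b ∈ S → b = a) := by
  unfold IsLatest addRel
  constructor
  · intro h
    refine ⟨fun y hy hyx hr => h y hy hyx (Or.inl hr), fun hxa hb => ?_⟩
    by_contra hba
    exact h b hb (by rwa [hxa]) (Or.inr ⟨hxa, rfl⟩)
  · rintro ⟨h1, h2⟩ y hy hyx (hr | ⟨rfl, rfl⟩)
    · exact h1 y hy hyx hr
    · exact hyx (h2 rfl hy)

/-- A constraint is void when one of its ends is absent or both coincide, and removing elements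
keeps it void. -/
theorem chainSum_addRel_of_notMem {r : V → V → Prop} (d : Finset V → ℂ) {a b : V} {S : Finset V}
    (h : a ∈ S → b ∈ S → b = a) : chainSum (addRel r a b) d S = chainSum r d S := by
  refine chainSum_congr (fun S => a ∈ S → b ∈ S → b = a) ?_ (fun _ _ _ => rfl) ?_ S h
  · intro S x hS _ _ ha hb
    exact hS (Finset.mem_of_mem_erase ha) (Finset.mem_of_mem_erase hb)
  · intro S x hS hx
    rw [isLatest_addRel]
    exact ⟨fun h => h.1, fun h => ⟨h, fun hxa hb => hS (hxa ▸ hx) hb⟩⟩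

theorem latestSum_addRel_self {r : V → V → Prop} (d : Finset V → ℂ) (a : V) (S : Finset V) :
    latestSum (addRel r a a) d S = latestSum r d S :=
  latestSum_congr (fun _ => True) (by simp) (by simp) (by simp [isLatest_addRel]) (by simp)
    (by simp [isLatest_addRel])

/-- Split by the last element `x`. For `x = a` only the order with `b` before `a` survives, and its
constraint is void once `a` is removed; `x = b` is symmetric. The other case is left as the
hypothesis `ih`, so that the argument serves both the induction for `chainSum` and the final step
for `latestSum`. -/
theorem latestSum_add_addRel_of_forall {r : V → V → Prop} (d : Finset V → ℂ) {a b : V}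
    (hab : a ≠ b) {S : Finset V} (ha : a ∈ S) (hb : b ∈ S)
    (ih : ∀ x ∈ S, x ≠ a → x ≠ b → chainSum (addRel r a b) d (S.erase x)
      + chainSum (addRel r b a) d (S.erase x) = chainSum r d (S.erase x)) :
    latestSum (addRel r a b) d S + latestSum (addRel r b a) d S = latestSum r d S := by
  classical
  unfold latestSum
  rw [← Finset.sum_add_distrib]
  refine Finset.sum_congr rfl fun x hx => ?_
  simp only [isLatest_addRel]
  by_cases h : IsLatest r S x
  · by_cases hxa : x = a
    · subst hxa
      rw [chainSum_addRel_of_notMem (a := b) (b := x) d (by simp)]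
      simp [h, hab, hab.symm, hb]
    · by_cases hxb : x = b
      · subst hxb
        rw [chainSum_addRel_of_notMem (a := a) (b := x) d (by simp)]
        simp [h, hab, hab.symm, ha]
      · simp [h, hxa, hxb, ih x hx]
  · simp [h]

theorem chainSum_add_addRel {r : V → V → Prop} (d : Finset V → ℂ) {a b : V}
    (hab : a ≠ b) (S : Finset V) (ha : a ∈ S) (hb : b ∈ S) :
    chainSum (addRel r a b) d S + chainSum (addRel r b a) d S = chainSum r d S := by
  induction S using Finset.strongInduction with
  | H S ih =>
    have hne : S.Nonempty := ⟨a, ha⟩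
    rw [chainSum_of_nonempty _ _ hne, chainSum_of_nonempty _ _ hne, chainSum_of_nonempty _ _ hne,
      ← mul_add, latestSum_add_addRel_of_forall d hab ha hb]
    intro x hx hxa hxb
    exact ih _ (Finset.erase_ssubset hx) (Finset.mem_erase.2 ⟨Ne.symm hxa, ha⟩)
      (Finset.mem_erase.2 ⟨Ne.symm hxb, hb⟩)

/-- Forgetting the order of `a` and `b` adds up the two possibilities. -/
theorem latestSum_add_addRel {r : V → V → Prop} (d : Finset V → ℂ) {a b : V}
    (hab : a ≠ b) (S : Finset V) (ha : a ∈ S) (hb : b ∈ S) :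
    latestSum (addRel r a b) d S + latestSum (addRel r b a) d S = latestSum r d S :=
  latestSum_add_addRel_of_forall d hab ha hb fun _ _ hxa hxb =>
    chainSum_add_addRel d hab _ (Finset.mem_erase.2 ⟨Ne.symm hxa, ha⟩)
      (Finset.mem_erase.2 ⟨Ne.symm hxb, hb⟩)

theorem isLatest_union_left {r : V → V → Prop} {A B S U : Finset V}
    (hr : ∀ a ∈ A, ∀ b ∈ B, ¬ r a b) (hS : S ⊆ A) (hU : U ⊆ B) {x : V}
    (hx : x ∈ S) : IsLatest r (S ∪ U) x ↔ IsLatest r S x := by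
  constructor
  · exact fun h y hy => h y (Finset.mem_union_left _ hy)
  · intro h y hy hyx
    rcases Finset.mem_union.1 hy with hy | hy
    · exact h y hy hyx
    · exact hr x (hS hx) y (hU hy)

/-- The last element lies in `S` or in `U`, which gives `latestSum S * chainSum U + chainSum S *
latestSum U`; by `mul_chainSum` each latest sum is a denominator times a chain sum. -/
theorem latestSum_union {r : V → V → Prop} {d : Finset V → ℂ} {A B S U : Finset V}
    (hAB : Disjoint A B) (hr : ∀ a ∈ A, ∀ b ∈ B, ¬ r a b ∧ ¬ r b a) (hS : S ⊆ A) (hU : U ⊆ B)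
    (h0 : d ∅ = 0) (hdS : S.Nonempty → d S ≠ 0) (hdU : U.Nonempty → d U ≠ 0)
    (hmulS : ∀ x ∈ S, chainSum r d (S.erase x ∪ U) = chainSum r d (S.erase x) * chainSum r d U)
    (hmulU : ∀ x ∈ U, chainSum r d (S ∪ U.erase x) = chainSum r d S * chainSum r d (U.erase x)) :
    latestSum r d (S ∪ U) = (d S + d U) * (chainSum r d S * chainSum r d U) := by
  classical
  have hSU : Disjoint S U := hAB.mono hS hU
  have e1 : ∑ x ∈ S, (if IsLatest r (S ∪ U) x then chainSum r d ((S ∪ U).erase x) else 0)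
      = latestSum r d S * chainSum r d U := by
    rw [latestSum, Finset.sum_mul]
    refine Finset.sum_congr rfl fun x hx => ?_
    rw [Finset.erase_union_distrib, Finset.erase_eq_of_notMem (Finset.disjoint_left.1 hSU hx),
      hmulS x hx, ite_mul, zero_mul]
    simp only [isLatest_union_left (fun a ha b hb => (hr a ha b hb).1) hS hU hx]
  have e2 : ∑ x ∈ U, (if IsLatest r (S ∪ U) x then chainSum r d ((S ∪ U).erase x) else 0)
      = chainSum r d S * latestSum r d U := by
    rw [latestSum, Finset.mul_sum]
    refine Finset.sum_congr rfl fun x hx => ?_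
    rw [Finset.erase_union_distrib, Finset.erase_eq_of_notMem (Finset.disjoint_right.1 hSU hx),
      hmulU x hx, mul_ite, mul_zero, Finset.union_comm S U]
    simp only [isLatest_union_left (fun b hb a ha => (hr a ha b hb).2) hU hS hx]
  rw [latestSum, Finset.sum_union hSU, e1, e2, ← mul_chainSum r d hdS h0,
    ← mul_chainSum r d hdU h0]
  ring

/-- The chain sum of a disjoint union without constraints between the two parts factorizes when the
denominators are additive. -/
theorem chainSum_union {r : V → V → Prop} {d : Finset V → ℂ} {A B : Finset V}
    (hAB : Disjoint A B) (hr : ∀ a ∈ A, ∀ b ∈ B, ¬ r a b ∧ ¬ r b a)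
    (hadd : ∀ S ⊆ A, ∀ U ⊆ B, d (S ∪ U) = d S + d U) (h0 : d ∅ = 0)
    (hne : ∀ S ⊆ A ∪ B, S.Nonempty → S ≠ A ∪ B → d S ≠ 0) (S U : Finset V) (hS : S ⊆ A)
    (hU : U ⊆ B) (hSU : S ∪ U ≠ A ∪ B) (hSA : S ≠ A ∪ B) (hUB : U ≠ A ∪ B) :
    chainSum r d (S ∪ U) = chainSum r d S * chainSum r d U := by
  induction hn : S.card + U.card using Nat.strong_induction_on generalizing S U with
  | _ n ih =>
    rcases S.eq_empty_or_nonempty with rfl | hSne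
    · simp [chainSum_empty]
    rcases U.eq_empty_or_nonempty with rfl | hUne
    · simp [chainSum_empty]
    have hSUne : (S ∪ U).Nonempty := hSne.mono Finset.subset_union_left
    have hsub : S ∪ U ⊆ A ∪ B := Finset.union_subset_union hS hU
    have hd := hne _ hsub hSUne hSU
    -- Only `A ∪ B` itself may have a zero denominator, and the induction stays below it.
    have proper : ∀ W ⊂ S ∪ U, W ≠ A ∪ B := fun W hW h =>
      (h ▸ hW).2 hsub
    rw [chainSum_of_nonempty _ _ hSUne, latestSum_union hAB hr hS hU h0
      (fun h => hne _ (hS.trans Finset.subset_union_left) h hSA)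
      (fun h => hne _ (hU.trans Finset.subset_union_right) h hUB), ← hadd S hS U hU,
      inv_mul_cancel_left₀ hd]
    · intro x hx
      have hlt := Finset.card_erase_lt_of_mem hx
      refine ih _ (by omega) _ _ ((Finset.erase_subset _ _).trans hS) hU ?_ ?_ hUB rfl
      · refine proper _ ?_
        have : S.erase x ∪ U = (S ∪ U).erase x := by
          rw [Finset.erase_union_distrib, Finset.erase_eq_of_notMem (a := x) (s := U)
            (Finset.disjoint_left.1 (hAB.mono hS hU) hx)]
        rw [this]
        exact Finset.erase_ssubset (Finset.mem_union_left _ hx)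
      · exact proper _ ((Finset.erase_ssubset hx).trans_subset Finset.subset_union_left)
    · intro x hx
      have hlt := Finset.card_erase_lt_of_mem hx
      refine ih _ (by omega) _ _ hS ((Finset.erase_subset _ _).trans hU) ?_ hSA ?_ rfl
      · refine proper _ ?_
        have : S ∪ U.erase x = (S ∪ U).erase x := by
          rw [Finset.erase_union_distrib, Finset.erase_eq_of_notMem (a := x) (s := S)
            (Finset.disjoint_right.1 (hAB.mono hS hU) hx)]
        rw [this]
        exact Finset.erase_ssubset (Finset.mem_union_right _ hx)
      · exact proper _ ((Finset.erase_ssubset hx).trans_subset Finset.subset_union_right)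

/-- Without constraints between two nonempty parts the sum over the time orderings vanishes. -/
theorem latestSum_union_eq_zero {r : V → V → Prop} {d : Finset V → ℂ} {A B : Finset V}
    (hAB : Disjoint A B) (hr : ∀ a ∈ A, ∀ b ∈ B, ¬ r a b ∧ ¬ r b a)
    (hadd : ∀ S ⊆ A, ∀ U ⊆ B, d (S ∪ U) = d S + d U) (h0 : d ∅ = 0)
    (hne : ∀ S ⊆ A ∪ B, S.Nonempty → S ≠ A ∪ B → d S ≠ 0)
    (hA : A.Nonempty) (hB : B.Nonempty) (htot : d (A ∪ B) = 0) :
    latestSum r d (A ∪ B) = 0 := by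
  have hA' : A ≠ A ∪ B := fun h => by
    obtain ⟨b, hb⟩ := hB
    exact Finset.disjoint_right.1 hAB hb (h ▸ Finset.mem_union_right _ hb)
  have hB' : B ≠ A ∪ B := fun h => by
    obtain ⟨a, ha⟩ := hA
    exact Finset.disjoint_left.1 hAB ha (h ▸ Finset.mem_union_left _ ha)
  rw [latestSum_union hAB hr subset_rfl subset_rfl h0
    (fun h => hne _ Finset.subset_union_left h hA')
    (fun h => hne _ Finset.subset_union_right h hB'), ← hadd A subset_rfl B subset_rfl, htot,
    zero_mul]
  · intro x hx
    refine chainSum_union hAB hr hadd h0 hne _ _ (Finset.erase_subset _ _) subset_rfl ?_ ?_ hB'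
    · intro h
      have : x ∈ A.erase x ∪ B := h ▸ Finset.mem_union_left _ hx
      simp [Finset.disjoint_left.1 hAB hx] at this
    · intro h
      have : x ∈ A.erase x := h ▸ Finset.mem_union_left _ hx
      simp at this
  · intro x hx
    refine chainSum_union hAB hr hadd h0 hne _ _ subset_rfl (Finset.erase_subset _ _) ?_ hA' ?_
    · intro h
      have : x ∈ A ∪ B.erase x := h ▸ Finset.mem_union_right _ hx
      simp [Finset.disjoint_right.1 hAB hx] at this
    · intro h
      have : x ∈ B.erase x := h ▸ Finset.mem_union_right _ hx
      simp at this

end TimeOrderings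

/-! ### Attaching a leaf to the vertex set. -/

section Leaf

variable {V : Type*} [DecidableEq V]

open scoped Classical in
theorem latestSum_insert (r : V → V → Prop) (d : Finset V → ℂ) {v : V} {S : Finset V}
    (hv : v ∉ S) :
    latestSum r d (insert v S) = (if IsLatest r (insert v S) v then chainSum r d S else 0) +
      ∑ x ∈ S, if IsLatest r (insert v S) x then chainSum r d (insert v (S.erase x)) else 0 := by
  rw [latestSum, Finset.sum_insert hv, Finset.erase_insert hv]
  congr 1
  refine Finset.sum_congr rfl fun x hx => ?_
  rw [Finset.erase_insert_of_ne (fun h : v = x => hv (h ▸ hx))]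

theorem chainSum_eq_of_notMem {r r' : V → V → Prop} {d d' : Finset V → ℂ} {A : Finset V} {u : V}
    (hr : ∀ S ⊆ A, u ∉ S → ∀ x ∈ S, (IsLatest r' S x ↔ IsLatest r S x))
    (hd : ∀ S ⊆ A, u ∉ S → d' S = d S) {S : Finset V} (hS : S ⊆ A) (hu : u ∉ S) :
    chainSum r' d' S = chainSum r d S :=
  chainSum_congr (fun S => S ⊆ A ∧ u ∉ S)
    (fun _ _ h _ _ => ⟨(Finset.erase_subset _ _).trans h.1, fun h' => h.2 (Finset.mem_of_mem_erase h')⟩)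
    (fun S h _ => hd S h.1 h.2) (fun S x h hx => hr S h.1 h.2 x hx) S ⟨hS, hu⟩

/-- Attaching a vertex `v` that is earlier than its only neighbour `u`. -/
theorem latestSum_insert_earlier {r : V → V → Prop} {d d' : Finset V → ℂ} {A : Finset V} {u v : V}
    {q : ℂ} (hu : u ∈ A) (hv : v ∉ A) (hrv : ∀ x, ¬ r v x ∧ ¬ r x v)
    (hd1 : ∀ S ⊆ A, u ∈ S → d' (insert v S) = d S)
    (hd2 : ∀ S ⊆ A, u ∉ S → d' (insert v S) = d S + q)
    (hd3 : ∀ S ⊆ A, u ∉ S → d' S = d S)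
    (hq : q ≠ 0) (h0 : d ∅ = 0) (hne : ∀ S ⊆ A, S.Nonempty → S ≠ A → d S ≠ 0)
    (hne' : ∀ S ⊆ A, u ∉ S → d S + q ≠ 0) :
    latestSum (addRel r v u) d' (insert v A) = q⁻¹ * latestSum r d A := by
  classical
  have huv : u ≠ v := fun h => hv (h ▸ hu)
  have hlat : ∀ S ⊆ A, ∀ x ∈ S, (IsLatest (addRel r v u) (insert v S) x ↔ IsLatest r S x) := by
    intro S hS x hx
    have hxv : x ≠ v := fun h => hv (h ▸ hS hx)
    rw [isLatest_addRel]
    constructor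
    · exact fun h y hy => h.1 y (Finset.mem_insert_of_mem hy)
    · refine fun h => ⟨fun y hy hyx => ?_, fun h' => absurd h' hxv⟩
      rcases Finset.mem_insert.1 hy with rfl | hy
      · exact (hrv x).2
      · exact h y hy hyx
  have hlat2 : ∀ S ⊆ A, ∀ x ∈ S, (IsLatest (addRel r v u) S x ↔ IsLatest r S x) := by
    intro S hS x hx
    rw [isLatest_addRel]
    exact ⟨fun h => h.1, fun h => ⟨h, fun h' => absurd (hS hx) (h' ▸ hv)⟩⟩
  have hlatv : ∀ S, (IsLatest (addRel r v u) (insert v S) v ↔ u ∉ S) := by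
    intro S
    rw [isLatest_addRel]
    constructor
    · exact fun h hS => huv (h.2 rfl (Finset.mem_insert_of_mem hS))
    · refine fun h => ⟨fun y _ _ => (hrv y).1, fun _ h' => ?_⟩
      exact absurd ((Finset.mem_insert.1 h').resolve_left huv) h
  have heq : ∀ S ⊆ A, u ∉ S → chainSum (addRel r v u) d' S = chainSum r d S := fun S hS huS =>
    chainSum_eq_of_notMem (u := u) (fun S hS _ x hx => hlat2 S hS x hx) hd3 hS huS
  -- The positions of `v` telescope: for `u ∉ S` the two cases combine to `(d S + q)⁻¹ * (1 + q⁻¹ *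
  -- d S) = q⁻¹`. The set `A` is excluded because `d A` is not assumed nonzero.
  have key : ∀ S ⊆ A, S ≠ A → chainSum (addRel r v u) d' (insert v S) = q⁻¹ * chainSum r d S := by
    intro S
    induction S using Finset.strongInduction with
    | H S ih =>
      intro hS hSA
      have hvS : v ∉ S := fun h => hv (hS h)
      have hsum : ∑ x ∈ S, (if IsLatest (addRel r v u) (insert v S) x then
          chainSum (addRel r v u) d' (insert v (S.erase x)) else 0) = q⁻¹ * latestSum r d S := by
        rw [latestSum, Finset.mul_sum]
        refine Finset.sum_congr rfl fun x hx => ?_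
        rw [ih _ (Finset.erase_ssubset hx) ((Finset.erase_subset _ _).trans hS), mul_ite, mul_zero]
        · simp only [hlat S hS x hx]
        · intro h
          exact (h ▸ Finset.notMem_erase x S) (hS hx)
      rw [chainSum_of_nonempty _ _ (Finset.insert_nonempty _ _), latestSum_insert _ _ hvS, hsum,
        hlatv]
      have hdS := mul_chainSum r d (fun h => hne S hS h hSA) h0
      by_cases huS : u ∈ S
      · rw [if_neg (not_not.2 huS), zero_add, hd1 S hS huS, ← hdS]
        have := hne S hS ⟨u, huS⟩ hSA
        field_simp
      · rw [if_pos huS, hd2 S hS huS, heq S hS huS, ← hdS]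
        have := hne' S hS huS
        field_simp
        ring
  rw [latestSum_insert _ _ hv, hlatv, if_neg (not_not.2 hu), zero_add, latestSum, Finset.mul_sum]
  refine Finset.sum_congr rfl fun x hx => ?_
  rw [key _ (Finset.erase_subset _ _) (Finset.erase_ssubset hx).ne, mul_ite, mul_zero]
  simp only [hlat A subset_rfl x hx]

/-- Attaching a vertex `v` that is later than its only neighbour `u`. -/
theorem latestSum_insert_later {r : V → V → Prop} {d d' : Finset V → ℂ} {A : Finset V} {u v : V}
    {q : ℂ} (hu : u ∈ A) (hv : v ∉ A) (hrv : ∀ x, ¬ r v x ∧ ¬ r x v)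
    (hd1 : ∀ S ⊆ A, u ∈ S → d' (insert v S) = d S)
    (hd2 : ∀ S ⊆ A, u ∈ S → d' S = d S + q)
    (hd3 : ∀ S ⊆ A, u ∉ S → d' S = d S)
    (hq : q ≠ 0) (hA : d A = 0) (hne : ∀ S ⊆ A, S.Nonempty → S ≠ A → d S ≠ 0)
    (hne' : ∀ S ⊆ A, u ∈ S → d S + q ≠ 0) :
    latestSum (addRel r u v) d' (insert v A) = q⁻¹ * latestSum r d A := by
  classical
  have huv : u ≠ v := fun h => hv (h ▸ hu)
  have hlat2 : ∀ S ⊆ A, ∀ x ∈ S, (IsLatest (addRel r u v) S x ↔ IsLatest r S x) := by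
    intro S hS x hx
    rw [isLatest_addRel]
    exact ⟨fun h => h.1, fun h => ⟨h, fun _ h' => absurd (hS h') hv⟩⟩
  have hlat : ∀ S ⊆ A, ∀ x ∈ S,
      (IsLatest (addRel r u v) (insert v S) x ↔ IsLatest r S x ∧ x ≠ u) := by
    intro S hS x hx
    rw [isLatest_addRel]
    constructor
    · refine fun h => ⟨fun y hy => h.1 y (Finset.mem_insert_of_mem hy), fun hxu => ?_⟩
      exact huv (h.2 hxu (Finset.mem_insert_self _ _)).symm
    · refine fun h => ⟨fun y hy hyx => ?_, fun h' => absurd h' h.2⟩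
      rcases Finset.mem_insert.1 hy with rfl | hy
      · exact (hrv x).2
      · exact h.1 y hy hyx
  have hlatv : ∀ S, IsLatest (addRel r u v) (insert v S) v := by
    intro S
    rw [isLatest_addRel]
    exact ⟨fun y _ _ => (hrv y).1, fun h => absurd h.symm huv⟩
  have heq : ∀ S ⊆ A, u ∉ S → chainSum (addRel r u v) d' S = chainSum r d S := fun S hS huS =>
    chainSum_eq_of_notMem (u := u) (fun S hS _ x hx => hlat2 S hS x hx) hd3 hS huS
  have hlatS : ∀ S ⊆ A, latestSum (addRel r u v) d' S
      = ∑ x ∈ S, if IsLatest r S x then chainSum (addRel r u v) d' (S.erase x) else 0 := by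
    intro S hS
    exact Finset.sum_congr rfl fun x hx => by simp only [hlat2 S hS x hx]
  -- The order with `v` last contributes one chain sum, which cancels the `q` part of `(d S + q)`
  -- times the same chain sum in the other terms.
  have hsum : ∀ S ⊆ A, u ∈ S → (∀ x ∈ S, x ≠ u →
      chainSum (addRel r u v) d' (insert v (S.erase x))
        = q⁻¹ * (chainSum r d (S.erase x) - chainSum (addRel r u v) d' (S.erase x))) →
      latestSum (addRel r u v) d' (insert v S)
        = q⁻¹ * (latestSum r d S - d S * chainSum (addRel r u v) d' S) := by
    intro S hS huS hx
    have hvS : v ∉ S := fun h => hv (hS h)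
    have h1 : (d S + q) * chainSum (addRel r u v) d' S = latestSum (addRel r u v) d' S := by
      rw [chainSum_of_nonempty _ _ ⟨u, huS⟩, hd2 S hS huS, mul_inv_cancel_left₀ (hne' S hS huS)]
    have h2 : ∑ x ∈ S, (if IsLatest (addRel r u v) (insert v S) x then
          chainSum (addRel r u v) d' (insert v (S.erase x)) else 0)
        = q⁻¹ * (latestSum r d S - latestSum (addRel r u v) d' S) := by
      rw [hlatS S hS, latestSum, ← Finset.sum_sub_distrib, Finset.mul_sum]
      refine Finset.sum_congr rfl fun x hxS => ?_
      simp only [hlat S hS x hxS]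
      -- The constraint forbids `u` as last element; its terms in the two sums on the right cancel,
      -- because the chain sums agree on sets without `u`.
      by_cases hxu : x = u
      · subst hxu
        rw [heq (S.erase x) ((Finset.erase_subset _ _).trans hS) (Finset.notMem_erase _ _)]
        simp
      · rw [hx x hxS hxu]
        by_cases h : IsLatest r S x <;> simp [h, hxu]
    rw [latestSum_insert _ _ hvS, if_pos (hlatv S), h2, ← h1]
    field_simp
    ring
  -- Partial fractions `1 / (d (d + q)) = q⁻¹ (1 / d - 1 / (d + q))`, telescoped over the positions
  -- of `v` after `u`. In the end `d A = 0` removes the second term.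
  have key : ∀ S ⊆ A, S ≠ A → u ∈ S → chainSum (addRel r u v) d' (insert v S)
      = q⁻¹ * (chainSum r d S - chainSum (addRel r u v) d' S) := by
    intro S
    induction S using Finset.strongInduction with
    | H S ih =>
      intro hS hSA huS
      have hdS := hne S hS ⟨u, huS⟩ hSA
      rw [chainSum_of_nonempty _ _ (Finset.insert_nonempty _ _), hsum S hS huS,
        hd1 S hS huS, chainSum_of_nonempty r d ⟨u, huS⟩]
      · field_simp
      · intro x hx hxu
        refine ih _ (Finset.erase_ssubset hx) ((Finset.erase_subset _ _).trans hS) ?_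
          (Finset.mem_erase.2 ⟨Ne.symm hxu, huS⟩)
        intro h
        exact (h ▸ Finset.notMem_erase x S) (hS hx)
  rw [hsum A subset_rfl hu, hA, zero_mul, sub_zero]
  intro x hx hxu
  exact key _ (Finset.erase_subset _ _) (Finset.erase_ssubset hx).ne
    (Finset.mem_erase.2 ⟨Ne.symm hxu, hu⟩)

end Leaf

/-! ### Contour integrals along the imaginary axis. -/

section ImaginaryAxis

open MeasureTheory Filter Topology Complex

/-- Cauchy's theorem on the rectangle `[-R, 0] × [-R, R]`: the three sides off the axis have total
length `4R`, and `G` is at most `M / R²` on them. -/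
theorem integral_imaginaryAxis_eq_zero {G : ℂ → ℂ}
    (hd : ∀ z : ℂ, z.re ≤ 0 → DifferentiableAt ℂ G z) {M R₀ : ℝ}
    (hb : ∀ z : ℂ, z.re ≤ 0 → R₀ ≤ ‖z‖ → ‖G z‖ ≤ M / ‖z‖ ^ 2)
    (hi : Integrable fun k : ℝ => G (k * I)) : ∫ k : ℝ, G (k * I) = 0 := by
  have h1 : Tendsto (fun R : ℝ => ∫ y in (-R)..R, G (y * I)) atTop
      (𝓝 (∫ k : ℝ, G (k * I))) :=
    intervalIntegral_tendsto_integral hi tendsto_neg_atTop_atBot tendsto_id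
  have h2 : Tendsto (fun R : ℝ => ∫ y in (-R)..R, G (y * I)) atTop (𝓝 0) := by
    refine squeeze_zero_norm' (a := fun R => 4 * M * R⁻¹) ?_ ?_
    · filter_upwards [eventually_gt_atTop 0, eventually_ge_atTop R₀] with R hR hR0
      have side : ∀ z : ℂ, z.re ≤ 0 → R ≤ ‖z‖ → ‖G z‖ ≤ M / R ^ 2 := by
        intro z hz hRz
        have h := hb z hz (hR0.trans hRz)
        have hM : 0 ≤ M := by
          have hz0 : 0 < ‖z‖ ^ 2 := by have := hR.trans_le hRz; positivity
          have := (norm_nonneg _).trans h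
          rcases div_nonneg_iff.1 this with h' | h'
          · exact h'.1
          · linarith
        refine h.trans ?_
        gcongr
      have hrect := integral_boundary_rect_eq_zero_of_continuousOn_of_differentiableOn G
        ⟨-R, -R⟩ ⟨0, R⟩ ?_ ?_
      · simp only [ofReal_zero, zero_add, smul_eq_mul] at hrect
        have e : I * ∫ y in (-R)..R, G (y * I)
            = (∫ x in (-R)..0, G (x + (R : ℝ) * I)) - (∫ x in (-R)..0, G (x + (-R : ℝ) * I))
              + I * ∫ y in (-R)..R, G ((-R : ℝ) + y * I) := by
          linear_combination hrect
        have hRR : ∀ x y : ℝ, x ≤ 0 → (R ≤ |x| ∨ R ≤ |y|) → ‖G (x + y * I)‖ ≤ M / R ^ 2 := by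
          intro x y hx hxy
          refine side _ (by simpa using hx) ?_
          rcases hxy with h | h
          · exact h.trans (by simpa using abs_re_le_norm (x + y * I : ℂ))
          · exact h.trans (by simpa using abs_im_le_norm (x + y * I : ℂ))
        have b1 : ‖∫ x in (-R)..0, G (x + (R : ℝ) * I)‖ ≤ M / R ^ 2 * |0 - (-R)| := by
          refine intervalIntegral.norm_integral_le_of_norm_le_const fun x hx => ?_
          rw [Set.uIoc_of_le (by linarith)] at hx
          exact hRR x R hx.2 (Or.inr (le_abs_self R))
        have b2 : ‖∫ x in (-R)..0, G (x + (-R : ℝ) * I)‖ ≤ M / R ^ 2 * |0 - (-R)| := by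
          refine intervalIntegral.norm_integral_le_of_norm_le_const fun x hx => ?_
          rw [Set.uIoc_of_le (by linarith)] at hx
          exact hRR x (-R) hx.2 (Or.inr (by rw [abs_neg]; exact le_abs_self R))
        have b3 : ‖∫ y in (-R)..R, G ((-R : ℝ) + y * I)‖ ≤ M / R ^ 2 * |R - (-R)| := by
          refine intervalIntegral.norm_integral_le_of_norm_le_const fun y _ => ?_
          exact hRR (-R) y (by linarith) (Or.inl (by rw [abs_neg]; exact le_abs_self R))
        have hn : ‖∫ y in (-R)..R, G (y * I)‖ = ‖I * ∫ y in (-R)..R, G (y * I)‖ := by simp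
        rw [hn, e]
        refine (norm_add_le _ _).trans ?_
        rw [norm_mul, norm_I, one_mul]
        refine (add_le_add ((norm_sub_le _ _).trans (add_le_add b1 b2)) b3).trans (le_of_eq ?_)
        rw [show (0 : ℝ) - -R = R by ring, show R - -R = 2 * R by ring, abs_of_pos hR,
          abs_of_pos (by linarith : 0 < 2 * R)]
        field_simp
        ring
      · intro z hz
        rw [mem_reProdIm, Set.uIcc_of_le (by simpa using hR.le)] at hz
        exact (hd z hz.1.2).continuousAt.continuousWithinAt
      · intro z hz
        rw [mem_reProdIm] at hz
        have : z.re < 0 := by simpa [hR.le] using hz.1.2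
        exact (hd z this.le).differentiableWithinAt
    · simpa using tendsto_inv_atTop_zero.const_mul (4 * M)
  exact tendsto_nhds_unique h1 h2

/-- Two lower bounds on `‖y - z‖` are combined: `re y`, because `z` lies in the left half plane, and
`‖z‖ - ‖y‖`, which governs large `z`. -/
theorem exists_norm_inv_sub_le {y : ℂ} (hy : 0 < y.re) :
    ∃ C, ∀ z : ℂ, z.re ≤ 0 → ‖(y - z)⁻¹‖ ≤ C / (1 + ‖z‖) := by
  refine ⟨(1 + ‖y‖) / y.re + 1, fun z hz => ?_⟩
  have h1 : y.re ≤ ‖y - z‖ := by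
    have := re_le_norm (y - z)
    rw [sub_re] at this
    linarith
  have h2 : ‖z‖ ≤ ‖y‖ + ‖y - z‖ := by
    have := norm_sub_le y (y - z)
    simpa using this
  have h3 : 0 < ‖y - z‖ := hy.trans_le h1
  rw [norm_inv, le_div_iff₀ (by positivity), inv_mul_le_iff₀ h3]
  have h4 : 1 + ‖y‖ ≤ ‖y - z‖ * ((1 + ‖y‖) / y.re) := by
    rw [mul_div_assoc', le_div_iff₀ hy, mul_comm]
    gcongr
  nlinarith

theorem integrable_of_norm_le_inv_sq {f : ℝ → ℂ} (hf : Continuous f) {C : ℝ}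
    (hb : ∀ k, ‖f k‖ ≤ C / (1 + |k|) ^ 2) : Integrable f := by
  refine (integrable_inv_one_add_sq.const_mul C).mono' hf.aestronglyMeasurable
    (Eventually.of_forall fun k => (hb k).trans ?_)
  have hC : 0 ≤ C := by
    have := (norm_nonneg _).trans (hb 0)
    simpa using this
  rw [← div_eq_mul_inv]
  gcongr
  nlinarith [abs_nonneg k, sq_abs k]

theorem integral_two_mul_div_sq_add_sq {E : ℝ} (hE : 0 < E) :
    ∫ k : ℝ, 2 * E / (E ^ 2 + k ^ 2) = 2 * Real.pi := by
  have h : ∀ k : ℝ, 2 * E / (E ^ 2 + k ^ 2) = 2 / E * (1 + (k / E) ^ 2)⁻¹ := by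
    intro k
    have h1 : E ^ 2 + k ^ 2 ≠ 0 := by positivity
    have h2 : 1 + (k / E) ^ 2 ≠ 0 := by positivity
    field_simp
  simp_rw [h]
  rw [integral_const_mul, Measure.integral_comp_div (fun x : ℝ => (1 + x ^ 2)⁻¹),
    integral_univ_inv_one_add_sq, abs_of_pos hE, smul_eq_mul]
  field_simp

/-- Functions that are holomorphic on the closed left half plane and fall off at infinity. -/
def LeftDecay (F : ℂ → ℂ) : Prop :=
  (∀ z : ℂ, z.re ≤ 0 → DifferentiableAt ℂ F z) ∧
    ∃ M, ∀ z : ℂ, z.re ≤ 0 → ‖F z‖ ≤ M / (1 + ‖z‖)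

/-- Functions that are holomorphic and bounded on the closed left half plane. -/
def LeftBounded (F : ℂ → ℂ) : Prop :=
  (∀ z : ℂ, z.re ≤ 0 → DifferentiableAt ℂ F z) ∧ ∃ M, ∀ z : ℂ, z.re ≤ 0 → ‖F z‖ ≤ M

theorem LeftDecay.leftBounded {F : ℂ → ℂ} (h : LeftDecay F) : LeftBounded F := by
  obtain ⟨hd, M, hM⟩ := h
  refine ⟨hd, M, fun z hz => (hM z hz).trans ?_⟩
  have hM0 : 0 ≤ M := by simpa using (norm_nonneg _).trans (hM 0 (by simp))
  exact div_le_self hM0 (by linarith [norm_nonneg z])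

theorem leftBounded_const (c : ℂ) : LeftBounded fun _ => c :=
  ⟨fun _ _ => differentiableAt_const c, ‖c‖, fun _ _ => le_rfl⟩

theorem LeftBounded.sum {α : Type*} {s : Finset α} {F : α → ℂ → ℂ}
    (h : ∀ i ∈ s, LeftBounded (F i)) : LeftBounded fun z => ∑ i ∈ s, F i z := by
  refine ⟨fun z hz => DifferentiableAt.fun_sum fun i hi => (h i hi).1 z hz, ?_⟩
  choose! M hM using fun i hi => (h i hi).2
  exact ⟨∑ i ∈ s, M i, fun z hz => (norm_sum_le _ _).trans
    (Finset.sum_le_sum fun i hi => hM i hi z hz)⟩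

theorem LeftBounded.inv_sub_mul {F : ℂ → ℂ} (h : LeftBounded F) {y : ℂ} (hy : 0 < y.re) :
    LeftDecay fun z => (y - z)⁻¹ * F z := by
  obtain ⟨hd, M, hM⟩ := h
  obtain ⟨C, hC⟩ := exists_norm_inv_sub_le hy
  refine ⟨fun z hz => ?_, C * M, fun z hz => ?_⟩
  · refine DifferentiableAt.mul (DifferentiableAt.inv (by fun_prop) fun h0 => ?_) (hd z hz)
    have := congrArg re h0
    simp at this
    linarith
  · rw [norm_mul, mul_div_right_comm]
    exact mul_le_mul (hC z hz) (hM z hz) (norm_nonneg _) ((norm_nonneg _).trans (hC z hz))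

theorem LeftDecay.integrable {F : ℂ → ℂ} (h : LeftDecay F) {y : ℂ} (hy : 0 < y.re) (ε : ℝ)
    (hε : |ε| = 1) :
    Integrable fun k : ℝ => (y + (ε * k : ℝ) * I)⁻¹ * F (k * I) := by
  obtain ⟨hd, M, hM⟩ := h
  obtain ⟨C, hC⟩ := exists_norm_inv_sub_le hy
  have hM0 : 0 ≤ M := by simpa using (norm_nonneg _).trans (hM 0 (by simp))
  refine integrable_of_norm_le_inv_sq (C := C * M) ?_ fun k => ?_
  · refine Continuous.mul (Continuous.inv₀ (by fun_prop) fun k h0 => ?_) ?_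
    · have := congrArg re h0
      simp at this
      linarith
    · rw [continuous_iff_continuousAt]
      intro k
      exact ContinuousAt.comp (f := fun k : ℝ => (k * I : ℂ)) (hd _ (by simp)).continuousAt
        (by fun_prop)
  · have h1 := hC (-((ε * k : ℝ) * I)) (by simp)
    have h2 := hM (k * I) (by simp)
    rw [sub_neg_eq_add] at h1
    simp only [norm_neg, norm_mul, norm_I, norm_real, mul_one, Real.norm_eq_abs, hε, one_mul]
      at h1 h2
    rw [norm_mul, sq, ← div_mul_div_comm]
    exact mul_le_mul h1 h2 (norm_nonneg _) ((norm_nonneg _).trans h1)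

/-- The pole and the holomorphy domain are on the same side: the integral vanishes. -/
theorem LeftDecay.integral_inv_sub_mul {F : ℂ → ℂ} (h : LeftDecay F) {y : ℂ} (hy : 0 < y.re) :
    ∫ k : ℝ, (y - k * I)⁻¹ * F (k * I) = 0 := by
  have hi : Integrable fun k : ℝ => (y - k * I)⁻¹ * F (k * I) := by
    have := h.integrable hy (-1) (by simp)
    refine this.congr (Eventually.of_forall fun k => ?_)
    simp [sub_eq_add_neg]
  obtain ⟨M, hM⟩ := h.2
  obtain ⟨C, hC⟩ := exists_norm_inv_sub_le hy
  have hM0 : 0 ≤ M := by simpa using (norm_nonneg _).trans (hM 0 (by simp))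
  have hC0 : 0 ≤ C := by simpa using (norm_nonneg _).trans (hC 0 (by simp))
  refine integral_imaginaryAxis_eq_zero (G := fun z => (y - z)⁻¹ * F z) (M := C * M) (R₀ := 1)
    (h.leftBounded.inv_sub_mul hy).1 (fun z hz hz1 => ?_) hi
  have hz0 : 0 < ‖z‖ := by linarith
  rw [norm_mul, sq, ← div_mul_div_comm]
  have h1 : ‖(y - z)⁻¹‖ ≤ C / ‖z‖ := (hC z hz).trans (by gcongr; linarith)
  have h2 : ‖F z‖ ≤ M / ‖z‖ := (hM z hz).trans (by gcongr; linarith)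
  exact mul_le_mul h1 h2 (norm_nonneg _) ((norm_nonneg _).trans h1)

theorem LeftDecay.add {F H : ℂ → ℂ} (hF : LeftDecay F) (hH : LeftDecay H) :
    LeftDecay fun z => F z + H z := by
  obtain ⟨hd, M, hM⟩ := hF
  obtain ⟨hd', M', hM'⟩ := hH
  refine ⟨fun z hz => (hd z hz).add (hd' z hz), M + M', fun z hz => ?_⟩
  rw [add_div]
  exact (norm_add_le _ _).trans (add_le_add (hM z hz) (hM' z hz))

/-- The residue at `-E` without the residue theorem: subtract from `F` the multiple of `1 / (E - z)`
with the same value at `-E`. The difference divided by `E + z` has a removable singularity, so its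
integral is zero, and the subtracted part is `F (-E)` times a Lorentzian of integral `2π`. -/
theorem LeftDecay.integral_inv_add_mul {F : ℂ → ℂ} (h : LeftDecay F) {E : ℝ} (hE : 0 < E) :
    ∫ k : ℝ, ((E : ℂ) + k * I)⁻¹ * F (k * I) = 2 * Real.pi * F (-E) := by
  have hEre : 0 < (E : ℂ).re := by simpa using hE
  set c : ℂ := F (-E) with hc
  have hdec : LeftDecay fun z => ((E : ℂ) - z)⁻¹ * (-(c * (2 * E))) :=
    (leftBounded_const _).inv_sub_mul hEre
  set H : ℂ → ℂ := fun z => F z + ((E : ℂ) - z)⁻¹ * (-(c * (2 * E))) with hH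
  have hHd : LeftDecay H := h.add hdec
  have hE0 : (E : ℂ) ≠ 0 := by exact_mod_cast hE.ne'
  have hH0 : H (-E) = 0 := by
    simp only [hH, ← hc, sub_neg_eq_add]
    field_simp
    ring
  have hslope : ∀ z : ℂ, z ≠ -E → dslope H (-E) z = (E + z)⁻¹ * H z := by
    intro z hz
    rw [dslope_of_ne _ hz, slope_def_field, hH0, sub_zero, sub_neg_eq_add, div_eq_inv_mul, add_comm]
  have hne : ∀ k : ℝ, (k * I : ℂ) ≠ -E := by
    intro k hk
    have := congrArg re hk
    simp at this
    linarith
  have hHi : Integrable fun k : ℝ => ((E : ℂ) + k * I)⁻¹ * H (k * I) := by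
    simpa using hHd.integrable hEre 1 (by simp)
  have hFi : Integrable fun k : ℝ => ((E : ℂ) + k * I)⁻¹ * F (k * I) := by
    simpa using h.integrable hEre 1 (by simp)
  have hzero : ∫ k : ℝ, ((E : ℂ) + k * I)⁻¹ * H (k * I) = 0 := by
    have heq : ∀ k : ℝ, ((E : ℂ) + k * I)⁻¹ * H (k * I) = dslope H (-E) (k * I) :=
      fun k => (hslope _ (hne k)).symm
    simp_rw [heq] at hHi ⊢
    obtain ⟨M, hM⟩ := hHd.2
    have hM0 : 0 ≤ M := by simpa using (norm_nonneg _).trans (hM 0 (by simp))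
    -- For `‖z‖ ≥ 2E` one has `‖E + z‖ ≥ ‖z‖ / 2`, whence the two constants.
    refine integral_imaginaryAxis_eq_zero (M := 2 * M) (R₀ := 2 * E) (fun z hz => ?_)
      (fun z hz hzE => ?_) hHi
    · by_cases hzE : z = -E
      · subst hzE
        have hnhds : {z : ℂ | z.re < 0} ∈ 𝓝 (-E : ℂ) :=
          (isOpen_lt continuous_re continuous_const).mem_nhds (by simpa using hE)
        have := (differentiableOn_dslope (f := H) hnhds).2 fun z hz =>
          (hHd.1 z (le_of_lt hz)).differentiableWithinAt
        exact this.differentiableAt hnhds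
      · exact (differentiableAt_dslope_of_ne hzE).2 (hHd.1 z hz)
    · have hz0 : 0 < ‖z‖ := by linarith
      have hzE' : ‖z‖ / 2 ≤ ‖E + z‖ := by
        have h1 : ‖z‖ ≤ ‖E + z‖ + ‖(E : ℂ)‖ := by
          have := norm_sub_le (E + z) (E : ℂ)
          simpa using this
        rw [norm_real, Real.norm_eq_abs, abs_of_pos hE] at h1
        linarith
      rw [hslope z, norm_mul, norm_inv]
      · calc ‖E + z‖⁻¹ * ‖H z‖ ≤ (‖z‖ / 2)⁻¹ * (M / ‖z‖) := by
              gcongr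
              exact (hM z hz).trans (by gcongr; linarith)
          _ = 2 * M / ‖z‖ ^ 2 := by field_simp
      · rintro rfl
        simp [abs_of_pos hE] at hzE
        linarith
  have hsplit : ∀ k : ℝ, ((E : ℂ) + k * I)⁻¹ * H (k * I) = ((E : ℂ) + k * I)⁻¹ * F (k * I)
      - c * ((2 * E / (E ^ 2 + k ^ 2) : ℝ) : ℂ) := by
    intro k
    have h1 : (E : ℂ) + k * I ≠ 0 := fun h0 => by
      have := congrArg re h0
      simp at this
      linarith
    have h2 : (E : ℂ) - k * I ≠ 0 := fun h0 => by
      have := congrArg re h0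
      simp at this
      linarith
    have h3 : (E : ℂ) ^ 2 + k ^ 2 = (E + k * I) * (E - k * I) := by
      ring_nf
      rw [I_sq]
      ring
    simp only [hH]
    push_cast
    rw [h3]
    field_simp
    ring
  have hpi := integral_two_mul_div_sq_add_sq hE
  -- A function that is not integrable would have integral `0` instead of `2π`.
  have hint : Integrable fun k : ℝ => 2 * E / (E ^ 2 + k ^ 2) := by
    by_contra hcon
    rw [integral_undef hcon] at hpi
    have := Real.pi_pos
    linarith
  simp_rw [hsplit] at hzero
  have hint' : Integrable fun k : ℝ => c * ((2 * E / (E ^ 2 + k ^ 2) : ℝ) : ℂ) :=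
    hint.ofReal.const_mul c
  rw [integral_sub hFi hint', integral_const_mul, integral_complex_ofReal, hpi] at hzero
  push_cast at hzero
  linear_combination hzero

/-- The integrand decays only like `1/k`, so the limit is conditional. On a symmetric interval one
may average over `k` and `-k`, which leaves half the Lorentzian. Divided by `2π` this is the factor
1/2 of a line from a vertex to itself. -/
theorem tendsto_integral_inv_add {E : ℝ} (hE : 0 < E) (ε : ℝ) (hε : ε ^ 2 = 1) :
    Tendsto (fun R : ℝ => ∫ k in (-R)..R, ((E : ℂ) + (ε * k : ℝ) * I)⁻¹) atTop
      (𝓝 (Real.pi : ℂ)) := by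
  have hne : ∀ k : ℝ, (E : ℂ) + (k : ℝ) * I ≠ 0 := fun k h0 => by
    have := congrArg re h0
    simp at this
    linarith
  have hcont : Continuous fun k : ℝ => ((E : ℂ) + (ε * k : ℝ) * I)⁻¹ :=
    Continuous.inv₀ (by fun_prop) fun k => hne _
  have hpi := integral_two_mul_div_sq_add_sq hE
  have hint : Integrable fun k : ℝ => 2 * E / (E ^ 2 + k ^ 2) := by
    by_contra hcon
    rw [integral_undef hcon] at hpi
    have := Real.pi_pos
    linarith
  have hlim := intervalIntegral_tendsto_integral hint tendsto_neg_atTop_atBot tendsto_id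
  rw [hpi] at hlim
  have hlim' := ((continuous_ofReal.tendsto _).comp hlim).div_const 2
  have hpi2 : ((2 * Real.pi : ℝ) : ℂ) / 2 = Real.pi := by push_cast; ring
  rw [hpi2] at hlim'
  refine hlim'.congr fun R => ?_
  have hcont' : Continuous fun k : ℝ => ((E : ℂ) + (ε * (-k) : ℝ) * I)⁻¹ :=
    hcont.comp continuous_neg
  have hswap : ∫ k in (-R)..R, ((E : ℂ) + (ε * (-k) : ℝ) * I)⁻¹
      = ∫ k in (-R)..R, ((E : ℂ) + (ε * k : ℝ) * I)⁻¹ := by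
    have := intervalIntegral.integral_comp_neg (a := -R) (b := R)
      (fun k : ℝ => ((E : ℂ) + (ε * k : ℝ) * I)⁻¹)
    rwa [neg_neg] at this
  have hsum : ((∫ k in (-R)..R, 2 * E / (E ^ 2 + k ^ 2) : ℝ) : ℂ)
      = (∫ k in (-R)..R, ((E : ℂ) + (ε * k : ℝ) * I)⁻¹)
        + ∫ k in (-R)..R, ((E : ℂ) + (ε * (-k) : ℝ) * I)⁻¹ := by
    rw [← intervalIntegral.integral_ofReal, ← intervalIntegral.integral_add
      (hcont.intervalIntegrable _ _) (hcont'.intervalIntegrable _ _)]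
    refine intervalIntegral.integral_congr fun k _ => ?_
    have h1 := hne (ε * k)
    have h2 := hne (ε * (-k))
    have h3 : (E : ℂ) ^ 2 + k ^ 2 = (E + (ε * k : ℝ) * I) * (E + (ε * (-k) : ℝ) * I) := by
      have : (ε : ℂ) ^ 2 = 1 := by exact_mod_cast hε
      push_cast
      ring_nf
      rw [I_sq, this]
      ring
    rw [inv_add_inv h1 h2, ← h3]
    push_cast
    ring
  simp only [Function.comp_def, id_eq]
  rw [hsum, hswap]
  ring

end ImaginaryAxis

/-! ### Integrating over the energy of one additional line. -/

section Chord

open MeasureTheory Filter Topology Complex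

variable {V : Type*} [DecidableEq V]

/-- The denominators `d` after the energy `z` has been rerouted from `s` to `t`. -/
noncomputable def shiftDen (d : Finset V → ℂ) (s t : V) (z : ℂ) (S : Finset V) : ℂ :=
  d S - z * ((if s ∈ S then 1 else 0) - (if t ∈ S then 1 else 0))

theorem shiftDen_swap (d : Finset V → ℂ) (s t : V) (z : ℂ) :
    shiftDen d s t z = shiftDen d t s (-z) := by
  funext S
  unfold shiftDen
  ring

/-- The denominators `d` after a line of energy `E` between `s` and `t` has been added. -/
noncomputable def addDen (d : Finset V → ℂ) (s t : V) (E : ℝ) (S : Finset V) : ℂ :=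
  d S + if (s ∈ S ↔ t ∈ S) then 0 else (E : ℂ)

/-- On sets without `t` the denominators are `d S - z` or `d S`, so all poles in `z` lie in the
right half plane. If `s ∈ S`, the outermost factor `(d S - z)⁻¹` supplies the decay. -/
theorem leftBounded_chainSum {r : V → V → Prop} {d : Finset V → ℂ} {A : Finset V} {s t : V}
    (ht : t ∈ A) (hd : ∀ S ⊆ A, S.Nonempty → S ≠ A → 0 < (d S).re) {S : Finset V} (hS : S ⊆ A)
    (htS : t ∉ S) :
    LeftBounded (fun z => chainSum r (shiftDen d s t z) S) ∧
      (s ∈ S → LeftDecay fun z => chainSum r (shiftDen d s t z) S) := by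
  classical
  induction S using Finset.strongInduction with
  | H S ih =>
    have hSA : S ≠ A := fun h => htS (h ▸ ht)
    by_cases hsS : s ∈ S
    · have hne : S.Nonempty := ⟨s, hsS⟩
      have hdec : LeftDecay fun z => chainSum r (shiftDen d s t z) S := by
        have : (fun z => chainSum r (shiftDen d s t z) S) = fun z => (d S - z)⁻¹ *
            ∑ x ∈ S, if IsLatest r S x then chainSum r (shiftDen d s t z) (S.erase x) else 0 := by
          funext z
          rw [chainSum_of_nonempty _ _ hne, latestSum]
          simp [shiftDen, hsS, htS]
        rw [this]
        refine LeftBounded.inv_sub_mul (LeftBounded.sum fun x hx => ?_) (hd S hS hne hSA)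
        split_ifs
        · exact (ih _ (Finset.erase_ssubset hx) ((Finset.erase_subset _ _).trans hS)
            fun h => htS (Finset.mem_of_mem_erase h)).1
        · exact leftBounded_const 0
      exact ⟨hdec.leftBounded, fun _ => hdec⟩
    · refine ⟨?_, fun h => absurd h hsS⟩
      have : (fun z => chainSum r (shiftDen d s t z) S) = fun _ => chainSum r d S := by
        funext z
        refine chainSum_congr (fun S => s ∉ S ∧ t ∉ S) ?_ ?_ (fun _ _ _ _ => Iff.rfl) S ⟨hsS, htS⟩
        · exact fun S x h _ _ => ⟨fun h' => h.1 (Finset.mem_of_mem_erase h'),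
            fun h' => h.2 (Finset.mem_of_mem_erase h')⟩
        · intro S h _
          simp [shiftDen, h.1, h.2]
      rw [this]
      exact leftBounded_const _

/-- In the absence of `t`, setting `z = -E` adds `E` exactly when `s ∈ S`, that is when the new line
crosses the boundary, and the new constraint is void. -/
theorem chainSum_shiftDen_neg {r : V → V → Prop} {d : Finset V → ℂ} {s t : V} {E : ℝ}
    {S : Finset V} (htS : t ∉ S) :
    chainSum r (shiftDen d s t (-E)) S = chainSum (addRel r s t) (addDen d s t E) S := by
  rw [chainSum_addRel_of_notMem _ fun _ h => absurd h htS]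
  refine chainSum_congr (fun S => t ∉ S) (fun S x h _ _ h' => h (Finset.mem_of_mem_erase h'))
    (fun S h _ => ?_) (fun _ _ _ _ => Iff.rfl) S htS
  by_cases hs : s ∈ S <;> simp [shiftDen, addDen, h, hs]

/-- Split by the last element `x`. For `x = t` the only pole in the left half plane is `-E` and its
residue gives the new denominators. For `x = s`, after `k → -k`, no pole is left in the left half
plane and the integral is zero, just as the constraint forbids `s` to be later than `t`. Otherwise
`ih` applies; it is a hypothesis so that chain sums and the full latest sum share the argument. -/
theorem integral_latestSum_aux {r : V → V → Prop} {d : Finset V → ℂ} {A : Finset V} {s t : V}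
    {E : ℝ} (hE : 0 < E) (hst : s ≠ t) (hs : s ∈ A) (ht : t ∈ A)
    (hd : ∀ S ⊆ A, S.Nonempty → S ≠ A → 0 < (d S).re) {S : Finset V} (hS : S ⊆ A)
    (hsS : s ∈ S) (htS : t ∈ S)
    (ih : ∀ x ∈ S, x ≠ s → x ≠ t →
      Integrable (fun k : ℝ => ((E : ℂ) + k * I)⁻¹
        * chainSum r (shiftDen d s t (k * I)) (S.erase x)) ∧
      ∫ k : ℝ, ((E : ℂ) + k * I)⁻¹ * chainSum r (shiftDen d s t (k * I)) (S.erase x)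
        = 2 * Real.pi * chainSum (addRel r s t) (addDen d s t E) (S.erase x)) :
    Integrable (fun k : ℝ => ((E : ℂ) + k * I)⁻¹ * latestSum r (shiftDen d s t (k * I)) S) ∧
    ∫ k : ℝ, ((E : ℂ) + k * I)⁻¹ * latestSum r (shiftDen d s t (k * I)) S
      = 2 * Real.pi * latestSum (addRel r s t) (addDen d s t E) S := by
  classical
  have hEre : 0 < (E : ℂ).re := by simpa using hE
  have main : ∀ x ∈ S,
      Integrable (fun k : ℝ => ((E : ℂ) + k * I)⁻¹ *
        (if IsLatest r S x then chainSum r (shiftDen d s t (k * I)) (S.erase x) else 0)) ∧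
      ∫ k : ℝ, ((E : ℂ) + k * I)⁻¹ *
        (if IsLatest r S x then chainSum r (shiftDen d s t (k * I)) (S.erase x) else 0)
      = 2 * Real.pi * (if IsLatest (addRel r s t) S x then
          chainSum (addRel r s t) (addDen d s t E) (S.erase x) else 0) := by
    intro x hx
    have hsub : S.erase x ⊆ A := (Finset.erase_subset _ _).trans hS
    simp only [isLatest_addRel]
    by_cases hl : IsLatest r S x
    · simp only [hl, if_true, true_and]
      by_cases hxs : x = s
      · subst hxs
        have hdec := (leftBounded_chainSum (r := r) (s := t) (t := x) hs hd hsub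
          (Finset.notMem_erase _ _)).2 (Finset.mem_erase.2 ⟨hst.symm, htS⟩)
        have hneg : ∀ k : ℝ, ((E : ℂ) + k * I)⁻¹ * chainSum r (shiftDen d x t (k * I)) (S.erase x)
            = (fun k : ℝ => ((E : ℂ) - k * I)⁻¹
                * chainSum r (shiftDen d t x (k * I)) (S.erase x)) (-k) := by
          intro k
          simp [shiftDen_swap d x t]
        have hi : Integrable fun k : ℝ => ((E : ℂ) - k * I)⁻¹
            * chainSum r (shiftDen d t x (k * I)) (S.erase x) := by
          have := hdec.integrable hEre (-1) (by simp)
          refine this.congr (Eventually.of_forall fun k => ?_)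
          simp [sub_eq_add_neg]
        refine ⟨?_, ?_⟩
        · simp_rw [hneg]
          exact hi.comp_neg
        · simp_rw [hneg]
          rw [integral_neg_eq_self (fun k : ℝ => ((E : ℂ) - k * I)⁻¹
            * chainSum r (shiftDen d t x (k * I)) (S.erase x)), hdec.integral_inv_sub_mul hEre]
          simp [htS, hst.symm]
      · simp only [hxs, false_imp_iff, if_true]
        by_cases hxt : x = t
        · subst hxt
          have hdec := (leftBounded_chainSum (r := r) (s := s) (t := x) ht hd hsub
            (Finset.notMem_erase _ _)).2 (Finset.mem_erase.2 ⟨hst, hsS⟩)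
          refine ⟨by simpa using hdec.integrable hEre 1 (by simp), ?_⟩
          rw [hdec.integral_inv_add_mul hE, chainSum_shiftDen_neg (Finset.notMem_erase _ _)]
        · exact ih x hx hxs hxt
    · simp [hl]
  unfold latestSum
  simp_rw [Finset.mul_sum]
  refine ⟨integrable_finsetSum _ fun x hx => (main x hx).1, ?_⟩
  rw [integral_finsetSum _ fun x hx => (main x hx).1]
  exact Finset.sum_congr rfl fun x hx => (main x hx).2

/-- Energy rerouted from `s` to `t` does not change the denominator of a set containing both, so `(d
S)⁻¹` leaves the integral at each stage of the recursion. -/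
theorem integral_chainSum_shiftDen {r : V → V → Prop} {d : Finset V → ℂ} {A : Finset V} {s t : V}
    {E : ℝ} (hE : 0 < E) (hst : s ≠ t) (hs : s ∈ A) (ht : t ∈ A)
    (hd : ∀ S ⊆ A, S.Nonempty → S ≠ A → 0 < (d S).re) {S : Finset V} (hS : S ⊆ A)
    (hsS : s ∈ S) (htS : t ∈ S) :
    Integrable (fun k : ℝ => ((E : ℂ) + k * I)⁻¹ * chainSum r (shiftDen d s t (k * I)) S) ∧
    ∫ k : ℝ, ((E : ℂ) + k * I)⁻¹ * chainSum r (shiftDen d s t (k * I)) S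
      = 2 * Real.pi * chainSum (addRel r s t) (addDen d s t E) S := by
  induction S using Finset.strongInduction with
  | H S ih =>
    have h := integral_latestSum_aux (r := r) hE hst hs ht hd hS hsS htS fun x hx hxs hxt =>
      ih _ (Finset.erase_ssubset hx) ((Finset.erase_subset _ _).trans hS)
        (Finset.mem_erase.2 ⟨Ne.symm hxs, hsS⟩) (Finset.mem_erase.2 ⟨Ne.symm hxt, htS⟩)
    have hne : S.Nonempty := ⟨s, hsS⟩
    have e1 : ∀ k : ℝ, ((E : ℂ) + k * I)⁻¹ * chainSum r (shiftDen d s t (k * I)) S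
        = (d S)⁻¹ * (((E : ℂ) + k * I)⁻¹ * latestSum r (shiftDen d s t (k * I)) S) := by
      intro k
      rw [chainSum_of_nonempty _ _ hne]
      simp only [shiftDen, hsS, htS, if_true, sub_self, mul_zero, sub_zero]
      ring
    have e2 : chainSum (addRel r s t) (addDen d s t E) S
        = (d S)⁻¹ * latestSum (addRel r s t) (addDen d s t E) S := by
      rw [chainSum_of_nonempty _ _ hne]
      simp [addDen, hsS, htS]
    simp_rw [e1]
    refine ⟨h.1.const_mul _, ?_⟩
    rw [integral_const_mul, h.2, e2]
    ring

/-- Integrating over the energy of a new line from `s` to `t` adds its time ordering and its energy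
to the sum over the time orderings. -/
theorem integral_latestSum_shiftDen {r : V → V → Prop} {d : Finset V → ℂ} {A : Finset V} {s t : V}
    {E : ℝ} (hE : 0 < E) (hst : s ≠ t) (hs : s ∈ A) (ht : t ∈ A)
    (hd : ∀ S ⊆ A, S.Nonempty → S ≠ A → 0 < (d S).re) :
    ∫ k : ℝ, ((E : ℂ) + k * I)⁻¹ * latestSum r (shiftDen d s t (k * I)) A
      = 2 * Real.pi * latestSum (addRel r s t) (addDen d s t E) A :=
  (integral_latestSum_aux hE hst hs ht hd subset_rfl hs ht fun _ _ hxs hxt =>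
    integral_chainSum_shiftDen hE hst hs ht hd (Finset.erase_subset _ _)
      (Finset.mem_erase.2 ⟨Ne.symm hxs, hs⟩) (Finset.mem_erase.2 ⟨Ne.symm hxt, ht⟩)).2

end Chord

/-! ### Absolute convergence of the integral over the chords. -/

section Convolution

open MeasureTheory Filter Topology

open scoped ENNReal

/-- The larger of `X` and `Y` is at least `Z / 2`. Its power `-b` is split off, and the rest, of
total exponent `1 + a - b`, is bounded by a power of the smaller one. The lower bound `Y₀` of `Y` is
kept separate so that it can depend on a single coordinate. -/
theorem inv_mul_rpow_neg_le {X Y Y₀ Z a b : ℝ} (hX : 0 < X) (hY₀ : 0 < Y₀) (hY : Y₀ ≤ Y)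
    (hZ : 0 < Z) (hZXY : Z ≤ X + Y) (hb : 0 ≤ b) (hba : b ≤ a) (hb1 : b ≤ 1) :
    X⁻¹ * Y ^ (-a) ≤ 2 ^ b * Z ^ (-b) * (X ^ (-(1 + a - b)) + Y₀ ^ (-(1 + a - b))) := by
  have hYp : 0 < Y := hY₀.trans_le hY
  have half : ∀ W : ℝ, 0 < W → Z ≤ 2 * W → W ^ (-b) ≤ 2 ^ b * Z ^ (-b) := by
    intro W hW hZW
    rw [Real.rpow_neg hW.le, Real.rpow_neg hZ.le, ← div_eq_mul_inv,
      le_div_iff₀ (by positivity), inv_mul_le_iff₀ (by positivity), mul_comm (W ^ b),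
      ← Real.mul_rpow (by norm_num) hW.le]
    exact Real.rpow_le_rpow hZ.le hZW hb
  rcases le_total Y X with h | h
  · calc X⁻¹ * Y ^ (-a) = X ^ (-b) * (X ^ (b - 1) * Y ^ (-a)) := by
          rw [← mul_assoc, ← Real.rpow_add hX, ← Real.rpow_neg_one]
          congr 2
          ring
      _ ≤ X ^ (-b) * (Y ^ (b - 1) * Y ^ (-a)) := by
          have := Real.rpow_le_rpow_of_nonpos hYp h (by linarith : b - 1 ≤ 0)
          gcongr
      _ = X ^ (-b) * Y ^ (-(1 + a - b)) := by
          rw [← Real.rpow_add hYp]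
          congr 2
          ring
      _ ≤ 2 ^ b * Z ^ (-b) * Y₀ ^ (-(1 + a - b)) := by
          have h1 := Real.rpow_le_rpow_of_nonpos hY₀ hY (by linarith : -(1 + a - b) ≤ 0)
          exact mul_le_mul (half X hX (by linarith)) h1 (by positivity) (by positivity)
      _ ≤ _ := by
          have : 0 < X ^ (-(1 + a - b)) := by positivity
          gcongr
          linarith
  · calc X⁻¹ * Y ^ (-a) = Y ^ (-b) * (X⁻¹ * Y ^ (b - a)) := by
          rw [mul_left_comm, ← Real.rpow_add hYp]
          congr 2
          ring
      _ ≤ Y ^ (-b) * (X⁻¹ * X ^ (b - a)) := by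
          have := Real.rpow_le_rpow_of_nonpos hX h (by linarith : b - a ≤ 0)
          gcongr
      _ = Y ^ (-b) * X ^ (-(1 + a - b)) := by
          rw [← Real.rpow_neg_one X, ← Real.rpow_add hX]
          congr 2
          ring
      _ ≤ 2 ^ b * Z ^ (-b) * X ^ (-(1 + a - b)) := by
          gcongr
          exact half Y hYp (by linarith)
      _ ≤ _ := by
          have : 0 < Y₀ ^ (-(1 + a - b)) := by positivity
          gcongr
          linarith

variable {V : Type*}

/-- Convolution with a `1/k` kernel costs an arbitrarily small power. The coordinate `v`, where `w`
is `±1`, bounds `1 + ‖ω - k • w‖` below by `1 + |w v * ω v - k|`; its power with exponent `-p`, `p >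
1`, is integrable in `k`, and the integral does not depend on `ω` by translation invariance. -/
theorem lintegral_mul_comp_sub_smul_le [Fintype V] {h : ℝ → ℝ≥0∞} {u : (V → ℝ) → ℝ≥0∞} {M C a b : ℝ}
    {w : V → ℝ} {v : V} (hw : ‖w‖ ≤ 1) (hwv : w v ^ 2 = 1) (hb : 0 ≤ b) (hba : b < a) (hb1 : b ≤ 1)
    (hM : 0 ≤ M) (hC : 0 ≤ C)
    (hh : ∀ k, h k ≤ ENNReal.ofReal (M * (1 + |k|)⁻¹))
    {Z : Submodule ℝ (V → ℝ)} (hwZ : w ∈ Z)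
    (hu : ∀ ω ∈ Z, u ω ≤ ENNReal.ofReal (C * (1 + ‖ω‖) ^ (-a))) :
    ∃ C', 0 ≤ C' ∧ ∀ ω ∈ Z, ∫⁻ k, h k * u (ω - k • w) ≤ ENNReal.ofReal (C' * (1 + ‖ω‖) ^ (-b)) := by
  set p := 1 + a - b with hp
  set K : ℝ≥0∞ := ∫⁻ k : ℝ, ENNReal.ofReal ((1 + ‖k‖) ^ (-p)) with hK
  have hKfin : K < ∞ := finite_integral_one_add_norm (by
    rw [hp, Module.finrank_self, Nat.cast_one]; linarith)
  refine ⟨M * C * 2 ^ b * (2 * K.toReal), by positivity, fun ω hω => ?_⟩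
  have hpt : ∀ k : ℝ, h k * u (ω - k • w) ≤
      ENNReal.ofReal (M * C * 2 ^ b * (1 + ‖ω‖) ^ (-b)) *
        (ENNReal.ofReal ((1 + ‖k‖) ^ (-p)) + ENNReal.ofReal ((1 + ‖w v * ω v - k‖) ^ (-p))) := by
    intro k
    refine (mul_le_mul' (hh k) (hu _ (Z.sub_mem hω (Z.smul_mem k hwZ)))).trans ?_
    rw [← ENNReal.ofReal_add (by positivity) (by positivity),
      ← ENNReal.ofReal_mul (by positivity), ← ENNReal.ofReal_mul (by positivity)]
    refine ENNReal.ofReal_le_ofReal ?_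
    have h1 : 1 + ‖w v * ω v - k‖ ≤ 1 + ‖ω - k • w‖ := by
      have h2 := norm_le_pi_norm (ω - k • w) v
      have h3 : ‖w v * ω v - k‖ = ‖(ω - k • w) v‖ := by
        have h4 : w v * ω v - k = w v * (ω - k • w) v := by
          simp only [Pi.sub_apply, Pi.smul_apply, smul_eq_mul]
          linear_combination k * hwv
        have h5 : ‖w v‖ = 1 := by
          rw [Real.norm_eq_abs, ← sq_eq_sq₀ (abs_nonneg _) zero_le_one, sq_abs, hwv, one_pow]
        rw [h4, norm_mul, h5, one_mul]
      linarith
    have h2 : 1 + ‖ω‖ ≤ (1 + |k|) + (1 + ‖ω - k • w‖) := by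
      have h3 : ‖ω‖ ≤ ‖ω - k • w‖ + ‖k • w‖ := by
        have := norm_add_le (ω - k • w) (k • w)
        simpa using this
      have h4 : ‖k • w‖ ≤ |k| := by
        rw [norm_smul, Real.norm_eq_abs]
        exact mul_le_of_le_one_right (abs_nonneg k) hw
      linarith
    have key := inv_mul_rpow_neg_le (X := 1 + |k|) (a := a) (by positivity) (by positivity) h1
      (by positivity) h2 hb hba.le hb1
    calc M * (1 + |k|)⁻¹ * (C * (1 + ‖ω - k • w‖) ^ (-a))
        = M * C * ((1 + |k|)⁻¹ * (1 + ‖ω - k • w‖) ^ (-a)) := by ring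
      _ ≤ M * C * (2 ^ b * (1 + ‖ω‖) ^ (-b) *
          ((1 + |k|) ^ (-p) + (1 + ‖w v * ω v - k‖) ^ (-p))) := by gcongr
      _ = _ := by rw [Real.norm_eq_abs k]; ring
  have hmeas : Measurable fun k : ℝ => ENNReal.ofReal ((1 + ‖k‖) ^ (-p)) := by fun_prop
  have hK2 : ∫⁻ k : ℝ, ENNReal.ofReal ((1 + ‖w v * ω v - k‖) ^ (-p)) = K :=
    lintegral_sub_left_eq_self (fun k : ℝ => ENNReal.ofReal ((1 + ‖k‖) ^ (-p))) _
  refine (lintegral_mono hpt).trans ?_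
  rw [lintegral_const_mul' _ _ ENNReal.ofReal_ne_top, lintegral_add_left hmeas, ← hK, hK2,
    ← two_mul]
  conv_lhs => rw [← ENNReal.ofReal_toReal hKfin.ne]
  rw [show (2 : ℝ≥0∞) = ENNReal.ofReal 2 by simp, ← ENNReal.ofReal_mul (by norm_num),
    ← ENNReal.ofReal_mul (by positivity)]
  exact le_of_eq (congrArg _ (by ring))

theorem lintegral_pi_succ {n : ℕ} {F : (Fin (n + 1) → ℝ) → ℝ≥0∞} (hF : Measurable F) :
    ∫⁻ x, F x = ∫⁻ k : ℝ, ∫⁻ y : Fin n → ℝ, F (Fin.cons k y) := by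
  have e := (volume_preserving_piFinSuccAbove (fun _ : Fin (n + 1) => ℝ) 0).symm
  rw [← e.lintegral_comp_emb (MeasurableEquiv.measurableEmbedding _), Measure.volume_eq_prod,
    lintegral_prod]
  · simp [MeasurableEquiv.piFinSuccAbove, Fin.insertNthEquiv]
  · exact (hF.comp (MeasurableEquiv.measurable _)).aemeasurable

theorem integral_pi_succ {n : ℕ} {F : (Fin (n + 1) → ℝ) → ℂ} (hF : Integrable F) :
    ∫ x, F x = ∫ k : ℝ, ∫ y : Fin n → ℝ, F (Fin.cons k y) := by
  have e := (volume_preserving_piFinSuccAbove (fun _ : Fin (n + 1) => ℝ) 0).symm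
  rw [← e.integral_comp (MeasurableEquiv.measurableEmbedding _), Measure.volume_eq_prod,
    integral_prod]
  · simp [MeasurableEquiv.piFinSuccAbove, Fin.insertNthEquiv]
  · exact e.integrable_comp_of_integrable hF

/-- The decay exponent starts at 1 and every chord costs a part of it, so each `b < 1` can be
reached; `(1 + b) / 2` is the exponent passed to the previous chord. -/
theorem lintegral_chords_le [Fintype V] {n : ℕ} (h : Fin n → ℝ → ℝ≥0∞) (hm : ∀ j, Measurable (h j))
    (u : (V → ℝ) → ℝ≥0∞) (hum : Measurable u) (w : Fin n → V → ℝ) (hw : ∀ j, ‖w j‖ ≤ 1)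
    (hwv : ∀ j, ∃ v, w j v ^ 2 = 1) {M : ℝ} (hM : 0 ≤ M)
    (hh : ∀ j k, h j k ≤ ENNReal.ofReal (M * (1 + |k|)⁻¹)) {C : ℝ} (hC : 0 ≤ C)
    {Z : Submodule ℝ (V → ℝ)} (hwZ : ∀ j, w j ∈ Z)
    (hu : ∀ ω ∈ Z, u ω ≤ ENNReal.ofReal (C * (1 + ‖ω‖)⁻¹)) {b : ℝ} (hb : 0 ≤ b) (hb1 : b < 1) :
    ∃ C', 0 ≤ C' ∧ ∀ ω ∈ Z, ∫⁻ x : Fin n → ℝ, (∏ j, h j (x j)) * u (ω - ∑ j, x j • w j)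
      ≤ ENNReal.ofReal (C' * (1 + ‖ω‖) ^ (-b)) := by
  induction n generalizing b with
  | zero =>
    refine ⟨C, hC, fun ω hω => ?_⟩
    rw [lintegral_unique]
    simp only [Finset.univ_eq_empty, Finset.prod_empty, Finset.sum_empty, sub_zero, one_mul]
    rw [volume_pi, Measure.pi_of_empty]
    simp only [Measure.dirac_apply_of_mem (Set.mem_univ _), mul_one]
    refine (hu ω hω).trans (ENNReal.ofReal_le_ofReal ?_)
    rw [← Real.rpow_neg_one]
    gcongr
    · linarith [norm_nonneg ω]
  | succ n ih =>
    obtain ⟨C₁, hC₁, h₁⟩ := ih (fun j => h j.succ) (fun j => hm _) (fun j => w j.succ)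
      (fun j => hw _) (fun j => hwv _) (fun j k => hh _ _) (fun j => hwZ _) (b := (1 + b) / 2) (by linarith)
      (by linarith)
    obtain ⟨v, hv⟩ := hwv 0
    obtain ⟨C₂, hC₂, h₂⟩ := lintegral_mul_comp_sub_smul_le (hw 0) hv hb
      (by linarith : b < (1 + b) / 2) hb1.le hM hC₁ (hh 0) (hwZ 0) h₁
    refine ⟨C₂, hC₂, fun ω hω => ?_⟩
    refine le_of_eq_of_le ?_ (h₂ ω hω)
    rw [lintegral_pi_succ]
    · refine lintegral_congr fun k => ?_
      rw [← lintegral_const_mul]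
      · refine lintegral_congr fun y => ?_
        simp only [Fin.prod_univ_succ, Fin.sum_univ_succ, Fin.cons_zero, Fin.cons_succ, mul_assoc,
          sub_sub]
      · fun_prop
    · fun_prop

/-- The integrand of the line energies `x j` of chords with directions `w j`. -/
noncomputable def chordIntegrand {n : ℕ} (h : Fin n → ℝ → ℂ) (f : (V → ℝ) → ℂ)
    (w : Fin n → V → ℝ) (ω : V → ℝ) (x : Fin n → ℝ) : ℂ :=
  (∏ j, h j (x j)) * f (ω - ∑ j, x j • w j)

theorem integrable_chordIntegrand [Fintype V] {n : ℕ} {h : Fin n → ℝ → ℂ} (hc : ∀ j, Continuous (h j))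
    {f : (V → ℝ) → ℂ} (hf : Continuous f) {w : Fin n → V → ℝ} (hw : ∀ j, ‖w j‖ ≤ 1)
    (hwv : ∀ j, ∃ v, w j v ^ 2 = 1) {M : ℝ} (hh : ∀ j k, ‖h j k‖ ≤ M * (1 + |k|)⁻¹) {C : ℝ}
    {Z : Submodule ℝ (V → ℝ)} (hwZ : ∀ j, w j ∈ Z)
    (hC : ∀ ω ∈ Z, ‖f ω‖ ≤ C * (1 + ‖ω‖)⁻¹) {ω : V → ℝ} (hω : ω ∈ Z) : Integrable (chordIntegrand h f w ω) := by
  have hcont : Continuous (chordIntegrand h f w ω) := by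
    unfold chordIntegrand
    fun_prop
  have hC0 : 0 ≤ C := by simpa using (norm_nonneg _).trans (hC 0 Z.zero_mem)
  have hh' : ∀ j k, ‖h j k‖ₑ ≤ ENNReal.ofReal (max M 0 * (1 + |k|)⁻¹) := by
    intro j k
    rw [← ofReal_norm]
    refine ENNReal.ofReal_le_ofReal ((hh j k).trans ?_)
    gcongr
    exact le_max_left _ _
  have hC' : ∀ ω ∈ Z, ‖f ω‖ₑ ≤ ENNReal.ofReal (C * (1 + ‖ω‖)⁻¹) := by
    intro ω hω
    rw [← ofReal_norm]
    exact ENNReal.ofReal_le_ofReal (hC ω hω)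
  -- Exponent `b = 0` suffices, as only finiteness is needed.
  obtain ⟨C', -, h'⟩ := lintegral_chords_le (fun j k => ‖h j k‖ₑ)
    (fun j => (hc j).enorm.measurable) (fun ω => ‖f ω‖ₑ) hf.enorm.measurable w hw hwv
    (le_max_right _ _) hh' hC0 hwZ hC' le_rfl one_pos
  refine ⟨hcont.aestronglyMeasurable, lt_of_le_of_lt (lintegral_mono fun x => ?_)
    ((h' ω hω).trans_lt ENNReal.ofReal_lt_top)⟩
  rw [chordIntegrand, enorm_mul]
  refine mul_le_mul' (le_of_eq ?_) le_rfl
  simp only [enorm_eq_nnnorm, nnnorm_prod, ENNReal.ofNNReal_finsetProd]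

theorem integral_chordIntegrand_succ {n : ℕ} {h : Fin (n + 1) → ℝ → ℂ} {f : (V → ℝ) → ℂ}
    {w : Fin (n + 1) → V → ℝ} {ω : V → ℝ} (hi : Integrable (chordIntegrand h f w ω)) :
    ∫ x, chordIntegrand h f w ω x = ∫ k : ℝ, h 0 k *
      ∫ y, chordIntegrand (fun j => h j.succ) f (fun j => w j.succ) (ω - k • w 0) y := by
  rw [integral_pi_succ hi]
  refine integral_congr_ae (Eventually.of_forall fun k => ?_)
  simp only
  rw [← integral_const_mul]
  refine integral_congr_ae (Eventually.of_forall fun y => ?_)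
  simp only [chordIntegrand, Fin.prod_univ_succ, Fin.sum_univ_succ, Fin.cons_zero, Fin.cons_succ,
    mul_assoc, sub_sub]

end Convolution

/-! ### Trees: energy flow and the product of the poles. -/

section Trees

open Complex

variable {V ι : Type*}

/-- The constraints that the source `p i` of each line `i ∈ F` is earlier than its target `q i`. -/
def lineRel (p q : ι → V) (F : Finset ι) : V → V → Prop := fun x y => ∃ i ∈ F, p i = x ∧ q i = y

theorem lineRel_insert [DecidableEq ι] (p q : ι → V) (F : Finset ι) (e : ι) :
    lineRel p q (insert e F) = addRel (lineRel p q F) (p e) (q e) := by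
  funext x y
  simp only [lineRel, addRel, Finset.mem_insert, exists_eq_or_imp, eq_iff_iff]
  rw [or_comm, eq_comm (a := x), eq_comm (a := y)]

variable [DecidableEq V]

/-- The energy denominator of the vertex set `S`: the energies of the lines of `F` between `S` and
its complement, plus `i` times the external energy of `S`. -/
noncomputable def lineDen (p q : ι → V) (F : Finset ι) (E : ι → ℝ) (ω : V → ℝ) (S : Finset V) :
    ℂ :=
  I * ((∑ v ∈ S, ω v : ℝ) : ℂ) + ∑ i ∈ F, if (p i ∈ S ↔ q i ∈ S) then 0 else (E i : ℂ)

/-- The external energies carried by a unit of energy on the line `i`. -/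
noncomputable def lineDir (p q : ι → V) (i : ι) : V → ℝ := Pi.single (p i) 1 - Pi.single (q i) 1

theorem lineDir_apply (p q : ι → V) (i : ι) (v : V) :
    lineDir p q i v = (if v = p i then 1 else 0) - (if v = q i then 1 else 0) := by
  simp [lineDir, Pi.single_apply]

theorem sum_lineDir (p q : ι → V) (i : ι) {A : Finset V} (hp : p i ∈ A) (hq : q i ∈ A) :
    ∑ v ∈ A, lineDir p q i v = 0 := by
  simp [lineDir_apply, Finset.sum_sub_distrib, hp, hq]

theorem lineDen_insert [DecidableEq ι] (p q : ι → V) {F : Finset ι} (E : ι → ℝ) (ω : V → ℝ) {e : ι}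
    (he : e ∉ F) :
    lineDen p q (insert e F) E ω = addDen (lineDen p q F E ω) (p e) (q e) (E e) := by
  funext S
  rw [lineDen, addDen, lineDen, Finset.sum_insert he]
  ring

theorem lineDen_sub_smul_lineDir (p q : ι → V) (F : Finset ι) (E : ι → ℝ) (ω : V → ℝ) (e : ι)
    (k : ℝ) : lineDen p q F E (ω - k • lineDir p q e)
      = shiftDen (lineDen p q F E ω) (p e) (q e) (k * I) := by
  funext S
  have h : ∑ v ∈ S, (ω - k • lineDir p q e) v = ∑ v ∈ S, ω v
      - k * ((if p e ∈ S then 1 else 0) - (if q e ∈ S then 1 else 0)) := by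
    simp [lineDir_apply, Finset.sum_sub_distrib, ← Finset.mul_sum]
  rw [lineDen, shiftDen, lineDen, h]
  simp only [ofReal_sub, ofReal_mul, apply_ite ofReal, ofReal_one, ofReal_zero]
  ring

theorem lineDen_re (p q : ι → V) (F : Finset ι) (E : ι → ℝ) (ω : V → ℝ) (S : Finset V) :
    (lineDen p q F E ω S).re = ∑ i ∈ F, if (p i ∈ S ↔ q i ∈ S) then 0 else E i := by
  simp only [lineDen, add_re, re_sum]
  simp [apply_ite re]

theorem lineDen_re_nonneg (p q : ι → V) (F : Finset ι) {E : ι → ℝ} (hE : ∀ i, 0 < E i) (ω : V → ℝ)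
    (S : Finset V) : 0 ≤ (lineDen p q F E ω S).re := by
  rw [lineDen_re]
  refine Finset.sum_nonneg fun i _ => ?_
  split_ifs
  exacts [le_rfl, (hE i).le]

theorem lineDen_re_pos (p q : ι → V) {F : Finset ι} {E : ι → ℝ} (hE : ∀ i, 0 < E i) (ω : V → ℝ)
    {S : Finset V} (h : ∃ i ∈ F, ¬ (p i ∈ S ↔ q i ∈ S)) : 0 < (lineDen p q F E ω S).re := by
  rw [lineDen_re]
  obtain ⟨i, hi, hc⟩ := h
  refine Finset.sum_pos' (fun i _ => ?_) ⟨i, hi, by rw [if_neg hc]; exact hE i⟩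
  split_ifs
  exacts [le_rfl, (hE i).le]

/-- Conservation of energy at the vertices in `A` when the lines in `F` carry the energies `k`. -/
def ConservesOn (p q : ι → V) (A : Finset V) (F : Finset ι) (ω : V → ℝ) (k : ι → ℝ) : Prop :=
  ∀ v ∈ A, ω v = ∑ i ∈ F, k i * lineDir p q i v

theorem ConservesOn.sum_eq_zero {p q : ι → V} {A : Finset V} {F : Finset ι} {ω : V → ℝ} {k : ι → ℝ}
    (h : ConservesOn p q A F ω k) (hF : ∀ i ∈ F, p i ∈ A ∧ q i ∈ A) : ∑ v ∈ A, ω v = 0 := by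
  rw [Finset.sum_congr rfl h, Finset.sum_comm]
  refine Finset.sum_eq_zero fun i hi => ?_
  rw [← Finset.mul_sum, sum_lineDir p q i (hF i hi).1 (hF i hi).2, mul_zero]

variable [DecidableEq ι]

/-- `F` is the set of the lines of a tree with vertex set `A`. -/
inductive TreeOn (p q : ι → V) : Finset V → Finset ι → Prop
  | single (v : V) : TreeOn p q {v} ∅
  | grow {A : Finset V} {F : Finset ι} {u v : V} {e : ι} (h : TreeOn p q A F) (hu : u ∈ A)
      (hv : v ∉ A) (he : e ∉ F) (huv : (p e = v ∧ q e = u) ∨ (p e = u ∧ q e = v)) :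
      TreeOn p q (insert v A) (insert e F)

namespace TreeOn

variable {p q : ι → V} {A : Finset V} {F : Finset ι}

theorem endpoints (h : TreeOn p q A F) : ∀ i ∈ F, p i ∈ A ∧ q i ∈ A := by
  induction h with
  | single v => simp
  | grow h hu hv he huv ih =>
    intro i hi
    rcases Finset.mem_insert.1 hi with rfl | hi
    · rcases huv with ⟨h1, h2⟩ | ⟨h1, h2⟩ <;> simp [h1, h2, hu]
    · exact ⟨Finset.mem_insert_of_mem (ih i hi).1, Finset.mem_insert_of_mem (ih i hi).2⟩

theorem nonempty (h : TreeOn p q A F) : A.Nonempty := by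
  cases h with
  | single v => exact Finset.singleton_nonempty v
  | grow => exact Finset.insert_nonempty _ _

theorem card (h : TreeOn p q A F) : F.card + 1 = A.card := by
  induction h with
  | single v => simp
  | grow h hu hv he huv ih => rw [Finset.card_insert_of_notMem he, Finset.card_insert_of_notMem hv, ih]

theorem exists_crossing (h : TreeOn p q A F) (S : Finset V) (h1 : ∃ a ∈ A, a ∈ S)
    (h2 : ∃ a ∈ A, a ∉ S) : ∃ i ∈ F, ¬ (p i ∈ S ↔ q i ∈ S) := by
  induction h with
  | single v =>
    obtain ⟨a, ha, haS⟩ := h1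
    obtain ⟨b, hb, hbS⟩ := h2
    rw [Finset.mem_singleton] at ha hb
    exact absurd (hb.trans ha.symm ▸ haS) hbS
  | @grow A F u v e h hu hv he huv ih =>
    by_cases hboth : (∃ a ∈ A, a ∈ S) ∧ ∃ a ∈ A, a ∉ S
    · obtain ⟨i, hi, hc⟩ := ih hboth.1 hboth.2
      exact ⟨i, Finset.mem_insert_of_mem hi, hc⟩
    · have huvS : ¬ (u ∈ S ↔ v ∈ S) := by
        intro hiff
        apply hboth
        obtain ⟨a, ha, haS⟩ := h1
        obtain ⟨b, hb, hbS⟩ := h2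
        constructor
        · rcases Finset.mem_insert.1 ha with rfl | ha
          · exact ⟨u, hu, hiff.2 haS⟩
          · exact ⟨a, ha, haS⟩
        · rcases Finset.mem_insert.1 hb with rfl | hb
          · exact ⟨u, hu, fun h => hbS (hiff.1 h)⟩
          · exact ⟨b, hb, hbS⟩
      refine ⟨e, Finset.mem_insert_self _ _, ?_⟩
      rcases huv with ⟨h1, h2⟩ | ⟨h1, h2⟩ <;> rw [h1, h2]
      · exact fun h => huvS h.symm
      · exact huvS

end TreeOn

/-- The only line at the leaf `v` must carry `± ω v`, and for the rest of the tree this energy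
enters at `u`. -/
theorem conservesOn_insert {p q : ι → V} {A : Finset V} {F : Finset ι} {ω : V → ℝ} {k : ι → ℝ}
    {u v : V} {e : ι} (hF : ∀ i ∈ F, p i ∈ A ∧ q i ∈ A) (hu : u ∈ A)
    (hv : v ∉ A) (he : e ∉ F) (huv : (p e = v ∧ q e = u) ∨ (p e = u ∧ q e = v)) :
    ConservesOn p q (insert v A) (insert e F) ω k ↔
      k e = lineDir p q e v * ω v ∧ ConservesOn p q A F (ω + Pi.single u (ω v)) k := by
  have hvu : v ≠ u := fun h => hv (h ▸ hu)
  have hsq : lineDir p q e v * lineDir p q e v = 1 := by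
    rcases huv with ⟨h1, h2⟩ | ⟨h1, h2⟩ <;> simp [lineDir_apply, h1, h2, hvu]
  have hdir : ∀ x ∈ A, lineDir p q e x = - lineDir p q e v * (if x = u then 1 else 0) := by
    intro x hx
    have hxv : x ≠ v := fun h => hv (h ▸ hx)
    by_cases hxu : x = u <;> rcases huv with ⟨h1, h2⟩ | ⟨h1, h2⟩ <;>
      simp [lineDir_apply, h1, h2, hvu, hvu.symm, hxu, hxv]
  have hFv : ∑ i ∈ F, k i * lineDir p q i v = 0 := by
    refine Finset.sum_eq_zero fun i hi => ?_
    have h1 : v ≠ p i := fun h => hv (h ▸ (hF i hi).1)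
    have h2 : v ≠ q i := fun h => hv (h ▸ (hF i hi).2)
    simp [lineDir_apply, h1, h2]
  have h1 : (ω v = k e * lineDir p q e v) ↔ k e = lineDir p q e v * ω v := by
    constructor
    · intro h
      rw [h]
      linear_combination (-k e) * hsq
    · intro h
      rw [h]
      linear_combination (-ω v) * hsq
  unfold ConservesOn
  rw [Finset.forall_mem_insert, Finset.sum_insert he, hFv, add_zero, h1]
  refine and_congr_right fun hk => forall₂_congr fun x hx => ?_
  rw [Finset.sum_insert he, hdir x hx, hk, Pi.add_apply, Pi.single_apply]
  by_cases hxu : x = u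
  · simp only [hxu, if_true]
    constructor <;> intro h
    · linear_combination h - ω v * hsq
    · linear_combination h + ω v * hsq
  · simp [hxu]

/-- Elimination of leaves determines the flow uniquely and linearly in `ω`. That the external
energies add up to zero is the conservation law at the initial vertex. -/
theorem TreeOn.exists_coefficients {p q : ι → V} {A : Finset V} {F : Finset ι}
    (h : TreeOn p q A F) : ∃ c : ι → V → ℝ, ∀ ω : V → ℝ, ∑ v ∈ A, ω v = 0 → ∀ k : ι → ℝ,
      (ConservesOn p q A F ω k ↔ ∀ i ∈ F, k i = ∑ v ∈ A, c i v * ω v) := by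
  induction h with
  | single v =>
    refine ⟨0, fun ω hω k => ?_⟩
    simpa [ConservesOn] using hω
  | @grow A F u v e h hu hv he huv ih =>
    obtain ⟨c, hc⟩ := ih
    -- Energy entering at `v` flows on through `u`, so `v` inherits the coefficients of `u` on the
    -- old lines.
    refine ⟨fun i w => if i = e then (if w = v then lineDir p q e v else 0) else
      (if w = v then c i u else c i w), fun ω hω k => ?_⟩
    have hsum : ∑ x ∈ A, (ω + Pi.single u (ω v) : V → ℝ) x = 0 := by
      rw [Finset.sum_insert hv] at hω
      simp only [Pi.add_apply, Finset.sum_add_distrib, Finset.sum_pi_single', hu, if_true]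
      linarith
    rw [conservesOn_insert h.endpoints hu hv he huv, hc _ hsum, Finset.forall_mem_insert]
    refine and_congr (Eq.congr rfl ?_) (forall₂_congr fun i hi => Eq.congr rfl ?_)
    · simp only [if_true, Finset.sum_insert hv]
      rw [Finset.sum_eq_zero, add_zero]
      intro x hx
      rw [if_neg (ne_of_mem_of_not_mem hx hv), zero_mul]
    · have hie : i ≠ e := fun h => he (h ▸ hi)
      simp only [if_neg hie, Pi.add_apply, mul_add, Finset.sum_add_distrib, Finset.sum_insert hv,
        if_true]
      rw [add_comm]
      congr 1
      · simp [Pi.single_apply, hu]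
      · refine Finset.sum_congr rfl fun x hx => ?_
        rw [if_neg (ne_of_mem_of_not_mem hx hv)]

/-- Induction over the leaves: the new line has `q = E e + i k e`, its orientation selects
`latestSum_insert_earlier` or `latestSum_insert_later`, and the smaller tree has the external energy
of `v` moved to `u`. -/
theorem TreeOn.prod_inv_eq_latestSum {p q : ι → V} {A : Finset V} {F : Finset ι}
    (h : TreeOn p q A F) {E : ι → ℝ} (hE : ∀ i, 0 < E i) {ω : V → ℝ} {k : ι → ℝ}
    (hk : ConservesOn p q A F ω k) :
    ∏ i ∈ F, ((E i : ℂ) + k i * I)⁻¹ = latestSum (lineRel p q F) (lineDen p q F E ω) A := by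
  induction h generalizing ω with
  | single v =>
    have : IsLatest (lineRel p q ∅) {v} v := fun y hy hyv =>
      absurd (Finset.mem_singleton.1 hy) hyv
    simp [latestSum, this, chainSum_empty]
  | @grow A F u v e h hu hv he huv ih =>
    obtain ⟨hke, hk'⟩ := (conservesOn_insert h.endpoints hu hv he huv).1 hk
    have hvu : v ≠ u := fun h => hv (h ▸ hu)
    have hsum := hk'.sum_eq_zero h.endpoints
    rw [Finset.prod_insert he, ih hk', lineRel_insert]
    have hrv : ∀ x, ¬ lineRel p q F v x ∧ ¬ lineRel p q F x v := by
      refine fun x => ⟨?_, ?_⟩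
      · rintro ⟨i, hi, h1, -⟩
        exact hv (h1 ▸ (h.endpoints i hi).1)
      · rintro ⟨i, hi, -, h1⟩
        exact hv (h1 ▸ (h.endpoints i hi).2)
    have hcrossv : ∀ S : Finset V, ∑ i ∈ F, (if (p i ∈ insert v S ↔ q i ∈ insert v S) then 0 else (E i : ℂ))
        = ∑ i ∈ F, if (p i ∈ S ↔ q i ∈ S) then 0 else (E i : ℂ) := by
      intro S
      refine Finset.sum_congr rfl fun i hi => ?_
      have h1 : p i ≠ v := fun h' => hv (h' ▸ (h.endpoints i hi).1)
      have h2 : q i ≠ v := fun h' => hv (h' ▸ (h.endpoints i hi).2)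
      simp [h1, h2]
    have hωS : ∀ S : Finset V, ∑ x ∈ S, (ω + Pi.single u (ω v) : V → ℝ) x
        = ∑ x ∈ S, ω x + if u ∈ S then ω v else 0 := by
      intro S
      simp [Finset.sum_add_distrib]
    have hsubv : ∀ S ⊆ A, v ∉ S := fun S hS h => hv (hS h)
    have hS1 : ∀ S ⊆ A, u ∈ S → lineDen p q (insert e F) E ω (insert v S)
        = lineDen p q F E (ω + Pi.single u (ω v)) S := by
      intro S hS huS
      rw [lineDen, lineDen, Finset.sum_insert he, hcrossv, hωS, Finset.sum_insert (hsubv S hS),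
        if_pos huS, if_pos, zero_add, add_comm (ω v)]
      rcases huv with ⟨h1, h2⟩ | ⟨h1, h2⟩ <;> simp [h1, h2, huS]
    have hS3 : ∀ S ⊆ A, u ∉ S → lineDen p q (insert e F) E ω S
        = lineDen p q F E (ω + Pi.single u (ω v)) S := by
      intro S hS huS
      rw [lineDen, lineDen, Finset.sum_insert he, hωS, if_neg huS, add_zero, if_pos, zero_add]
      have := hsubv S hS
      rcases huv with ⟨h1, h2⟩ | ⟨h1, h2⟩ <;> simp [h1, h2, huS, this]
    have hpos : ∀ S ⊆ A, S.Nonempty → S ≠ A → lineDen p q F E (ω + Pi.single u (ω v)) S ≠ 0 := by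
      intro S hS hne hSA h0
      have hcross : ∃ i ∈ F, ¬ (p i ∈ S ↔ q i ∈ S) := by
        refine h.exists_crossing S (hne.imp fun a ha => ⟨hS ha, ha⟩) ?_
        by_contra hcon
        push Not at hcon
        exact hSA (Finset.Subset.antisymm hS hcon)
      have := lineDen_re_pos p q hE (ω + Pi.single u (ω v)) hcross
      rw [h0] at this
      exact lt_irrefl _ this
    have hq : ∀ x : ℝ, ∀ S, lineDen p q F E (ω + Pi.single u (ω v)) S + (E e + x * I) ≠ 0 := by
      intro x S h0
      have h1 := congrArg re h0
      have h2 := lineDen_re_nonneg p q F hE (ω + Pi.single u (ω v)) S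
      have h3 := hE e
      simp only [add_re, ofReal_re, mul_re, I_re, mul_zero, ofReal_im, I_im, mul_one, sub_self,
        add_zero, zero_re] at h1
      linarith
    have hempty : lineDen p q F E (ω + Pi.single u (ω v)) ∅ = 0 := by simp [lineDen]
    have hq0 : (E e : ℂ) + k e * I ≠ 0 := by
      have := hq (k e) ∅
      rwa [hempty, zero_add] at this
    rcases huv with ⟨h1, h2⟩ | ⟨h1, h2⟩
    · have hkv : k e = ω v := by simp [hke, lineDir_apply, h1, h2, hvu]
      rw [h1, h2]
      refine (latestSum_insert_earlier hu hv hrv hS1 ?_ hS3 hq0 hempty hpos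
        fun S _ _ => hq _ S).symm
      intro S hS huS
      rw [lineDen, lineDen, Finset.sum_insert he, hcrossv, hωS, Finset.sum_insert (hsubv S hS),
        if_neg huS, if_neg, hkv]
      · push_cast
        ring
      · simp [h1, h2, huS, hvu.symm]
    · have hkv : k e = - ω v := by simp [hke, lineDir_apply, h1, h2, hvu]
      rw [h1, h2]
      have hA0 : lineDen p q F E (ω + Pi.single u (ω v)) A = 0 := by
        rw [lineDen, hsum, Finset.sum_eq_zero]
        · simp
        · intro i hi
          simp [h.endpoints i hi]
      refine (latestSum_insert_later hu hv hrv hS1 ?_ hS3 hq0 hA0 hpos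
        fun S _ _ => hq _ S).symm
      intro S hS huS
      rw [lineDen, lineDen, Finset.sum_insert he, hωS, if_pos huS, if_neg, hkv]
      · push_cast
        ring
      · simp [h1, h2, huS, hsubv S hS]

end Trees

/-! ### From a tree to the graph: integrating over the chords. -/

section Chords

open Complex MeasureTheory Filter Topology

variable {V ι : Type*}

/-- The orientation `p', q'` of the lines arises from `p, q` by reversing those with `ε i = -1`. -/
def IsReorientation (p q p' q' : ι → V) (ε : ι → ℝ) : Prop :=
  ∀ i, (ε i = 1 ∧ p' i = p i ∧ q' i = q i) ∨ (ε i = -1 ∧ p' i = q i ∧ q' i = p i)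

/-- External energies that add up to zero. -/
def zeroSum (V : Type*) [Fintype V] : Submodule ℝ (V → ℝ) where
  carrier := {ω | ∑ v, ω v = 0}
  add_mem' := by
    intro a b ha hb
    simp only [Set.mem_ofPred_eq, Pi.add_apply, Finset.sum_add_distrib] at *
    rw [ha, hb, add_zero]
  zero_mem' := by simp
  smul_mem' := by
    intro c x hx
    simp only [Set.mem_ofPred_eq, Pi.smul_apply, smul_eq_mul, ← Finset.mul_sum] at *
    rw [hx, mul_zero]

theorem mem_zeroSum [Fintype V] {ω : V → ℝ} : ω ∈ zeroSum V ↔ ∑ v, ω v = 0 := Iff.rfl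

theorem one_add_sum_le_prod_one_add (s : Finset ι) {f : ι → ℝ} (hf : ∀ i, 0 ≤ f i) :
    1 + ∑ i ∈ s, f i ≤ ∏ i ∈ s, (1 + f i) := by
  classical
  induction s using Finset.induction_on with
  | empty => simp
  | insert a s ha ih =>
    rw [Finset.sum_insert ha, Finset.prod_insert ha]
    have h1 : 0 ≤ ∑ i ∈ s, f i := Finset.sum_nonneg fun i _ => hf i
    have h2 := hf a
    nlinarith [mul_le_mul_of_nonneg_left ih (by linarith : 0 ≤ 1 + f a)]

theorem add_mul_I_ne_zero {E : ℝ} (hE : 0 < E) (x : ℝ) : (E : ℂ) + x * I ≠ 0 := fun h0 => by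
  have := congrArg re h0
  simp at this
  linarith

theorem exists_norm_inv_le {E ε : ℝ} (hE : 0 < E) (hε : |ε| = 1) :
    ∃ C, 0 ≤ C ∧ ∀ k : ℝ, ‖((E : ℂ) + (ε * k : ℝ) * I)⁻¹‖ ≤ C * (1 + |k|)⁻¹ := by
  obtain ⟨C, hC⟩ := exists_norm_inv_sub_le (y := E) (by simpa using hE)
  refine ⟨C, by simpa using (norm_nonneg _).trans (hC 0 (by simp)), fun k => ?_⟩
  have := hC (-((ε * k : ℝ) * I)) (by simp)
  rw [sub_neg_eq_add] at this
  simpa only [norm_neg, norm_mul, norm_I, norm_real, mul_one, Real.norm_eq_abs, hε, one_mul,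
    div_eq_mul_inv] using this

theorem IsReorientation.abs_eq {p q p' q' : ι → V} {ε : ι → ℝ} (h : IsReorientation p q p' q' ε)
    (i : ι) : |ε i| = 1 := by
  rcases h i with ⟨h, -⟩ | ⟨h, -⟩ <;> simp [h]

/-- The energy of the line `i` of a tree, as a function of the external energies. -/
noncomputable def treeFlow [Fintype V] (c : ι → V → ℝ) (ω : V → ℝ) (i : ι) : ℝ := ∑ v, c i v * ω v

theorem continuous_treeFlow [Fintype V] (c : ι → V → ℝ) (i : ι) :
    Continuous fun ω => treeFlow c ω i := by
  unfold treeFlow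
  fun_prop

/-- The product of the poles of the lines of a tree, as a function of the external energies. -/
noncomputable def treeFactor [Fintype V] (T : Finset ι) (E ε : ι → ℝ) (c : ι → V → ℝ)
    (ω : V → ℝ) : ℂ :=
  ∏ i ∈ T, ((E i : ℂ) + (ε i * treeFlow c ω i : ℝ) * I)⁻¹

theorem continuous_inv_add {E : ℝ} (hE : 0 < E) (ε : ℝ) :
    Continuous fun k : ℝ => ((E : ℂ) + (ε * k : ℝ) * I)⁻¹ :=
  Continuous.inv₀ (by fun_prop) fun k => add_mul_I_ne_zero hE _

theorem continuous_treeFactor [Fintype V] (T : Finset ι) {E : ι → ℝ} (hE : ∀ i, 0 < E i)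
    (ε : ι → ℝ) (c : ι → V → ℝ) : Continuous (treeFactor T E ε c) := by
  unfold treeFactor
  exact continuous_finsetProd _ fun i _ =>
    (continuous_inv_add (hE i) (ε i)).comp (continuous_treeFlow c i)

variable [DecidableEq V]

theorem IsReorientation.lineDir {p q p' q' : ι → V} {ε : ι → ℝ} (h : IsReorientation p q p' q' ε)
    (i : ι) : lineDir p q i = ε i • lineDir p' q' i := by
  rcases h i with ⟨h, h1, h2⟩ | ⟨h, h1, h2⟩ <;> simp [_root_.lineDir, h, h1, h2]

theorem norm_lineDir_le [Fintype V] (p q : ι → V) (i : ι) : ‖lineDir p q i‖ ≤ 1 := by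
  rw [pi_norm_le_iff_of_nonneg zero_le_one]
  intro v
  rw [lineDir_apply]
  split_ifs <;> simp

theorem lineDir_mem_zeroSum [Fintype V] (p q : ι → V) (i : ι) : lineDir p q i ∈ zeroSum V :=
  sum_lineDir p q i (Finset.mem_univ _) (Finset.mem_univ _)

/-- Conservation bounds `‖ω‖` by the sum of the line energies, and one plus this sum is at most the
product of the `1 + |k i|` that controls the poles. -/
theorem exists_norm_treeFactor_le [Fintype V] {p q : ι → V} {T : Finset ι} {E ε : ι → ℝ}
    (hE : ∀ i, 0 < E i) (hε : ∀ i, |ε i| = 1) {c : ι → V → ℝ}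
    (hc : ∀ ω ∈ zeroSum V, ConservesOn p q Finset.univ T ω (treeFlow c ω)) :
    ∃ C, ∀ ω ∈ zeroSum V, ‖treeFactor T E ε c ω‖ ≤ C * (1 + ‖ω‖)⁻¹ := by
  choose C hC0 hC using fun i => exists_norm_inv_le (hE i) (hε i)
  refine ⟨∏ i ∈ T, C i, fun ω hω => ?_⟩
  have h1 : ‖ω‖ ≤ ∑ i ∈ T, |treeFlow c ω i| := by
    rw [pi_norm_le_iff_of_nonneg (Finset.sum_nonneg fun i _ => abs_nonneg _)]
    intro v
    rw [hc ω hω v (Finset.mem_univ v)]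
    refine (norm_sum_le _ _).trans (Finset.sum_le_sum fun i _ => ?_)
    rw [norm_mul, Real.norm_eq_abs]
    exact mul_le_of_le_one_right (abs_nonneg _)
      ((norm_le_pi_norm _ v).trans (norm_lineDir_le p q i))
  have h2 := one_add_sum_le_prod_one_add T fun i => abs_nonneg (treeFlow c ω i)
  rw [treeFactor, norm_prod]
  calc _ ≤ ∏ i ∈ T, C i * (1 + |treeFlow c ω i|)⁻¹ :=
        Finset.prod_le_prod (fun i _ => norm_nonneg _) fun i _ => hC i _
    _ = (∏ i ∈ T, C i) * (∏ i ∈ T, (1 + |treeFlow c ω i|))⁻¹ := by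
        rw [Finset.prod_mul_distrib, Finset.prod_inv_distrib]
    _ ≤ _ := by
        have h3 : 0 ≤ ∏ i ∈ T, C i := Finset.prod_nonneg fun i _ => hC0 i
        gcongr
        linarith

theorem integrable_chords [Fintype V] {p q : ι → V} {T : Finset ι} {E ε : ι → ℝ}
    (hE : ∀ i, 0 < E i) (hε : ∀ i, |ε i| = 1) {c : ι → V → ℝ}
    (hc : ∀ ω ∈ zeroSum V, ConservesOn p q Finset.univ T ω (treeFlow c ω)) {n : ℕ} (e : Fin n → ι)
    (he : ∀ j, p (e j) ≠ q (e j)) {ω : V → ℝ} (hω : ω ∈ zeroSum V) :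
    Integrable (chordIntegrand (fun j k => ((E (e j) : ℂ) + (ε (e j) * k : ℝ) * I)⁻¹)
      (treeFactor T E ε c) (fun j => lineDir p q (e j)) ω) := by
  obtain ⟨C, hC⟩ := exists_norm_treeFactor_le hE hε hc
  choose M hM0 hM using fun i => exists_norm_inv_le (hE i) (hε i)
  refine integrable_chordIntegrand (M := ∑ j, M (e j)) (fun j => continuous_inv_add (hE _) _)
    (continuous_treeFactor T hE ε c) (fun j => norm_lineDir_le p q _) (fun j => ?_) (fun j k => ?_)
    (fun j => lineDir_mem_zeroSum p q _) hC hω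
  · refine ⟨p (e j), ?_⟩
    simp [lineDir_apply, he j]
  · refine (hM (e j) k).trans ?_
    gcongr
    exact Finset.single_le_sum (f := fun j => M (e j)) (fun j _ => hM0 _) (Finset.mem_univ j)

variable [DecidableEq ι]

theorem TreeOn.reorient {p q p' q' : ι → V} {ε : ι → ℝ} (h : IsReorientation p q p' q' ε)
    {A : Finset V} {T : Finset ι} (hT : TreeOn p q A T) : TreeOn p' q' A T := by
  induction hT with
  | single v => exact TreeOn.single v
  | @grow A F u v e h' hu hv he huv ih =>
    refine TreeOn.grow ih hu hv he ?_
    rcases h e with ⟨-, h1, h2⟩ | ⟨-, h1, h2⟩ <;> rw [h1, h2]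
    · exact huv
    · exact huv.symm.imp (fun h => ⟨h.2, h.1⟩) (fun h => ⟨h.2, h.1⟩)

/-- The energy integral over the energies of the chords of a tree is the sum over the time
orderings of the vertices. -/
theorem integral_chords [Fintype V] {p q p' q' : ι → V} {ε : ι → ℝ}
    (hor : IsReorientation p q p' q' ε) {T : Finset ι} (hT : TreeOn p q Finset.univ T) {E : ι → ℝ}
    (hE : ∀ i, 0 < E i) {c : ι → V → ℝ}
    (hc : ∀ ω ∈ zeroSum V, ConservesOn p q Finset.univ T ω (treeFlow c ω)) {n : ℕ} (e : Fin n → ι)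
    (hinj : Function.Injective e) (heT : ∀ j, e j ∉ T)
    (he : ∀ j, p (e j) ≠ q (e j)) {ω : V → ℝ} (hω : ω ∈ zeroSum V) :
    ∫ x, chordIntegrand (fun j k => ((E (e j) : ℂ) + (ε (e j) * k : ℝ) * I)⁻¹)
      (treeFactor T E ε c) (fun j => lineDir p q (e j)) ω x
    = (2 * Real.pi) ^ n * latestSum (lineRel p' q' (T ∪ Finset.univ.image e))
        (lineDen p' q' (T ∪ Finset.univ.image e) E ω) Finset.univ := by
  induction n generalizing ω with
  | zero =>
    rw [integral_unique]
    simp only [chordIntegrand, Finset.univ_eq_empty, Finset.prod_empty, Finset.sum_empty, sub_zero,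
      one_mul, Finset.image_empty, Finset.union_empty, pow_zero]
    rw [volume_pi, Measure.pi_of_empty]
    simp only [Measure.real, Measure.dirac_apply_of_mem (Set.mem_univ _), ENNReal.toReal_one,
      one_smul]
    refine (hT.reorient hor).prod_inv_eq_latestSum hE (k := fun i => ε i * treeFlow c ω i) ?_
    intro v hv
    rw [hc ω hω v hv]
    refine Finset.sum_congr rfl fun i _ => ?_
    rw [hor.lineDir i]
    simp only [Pi.smul_apply, smul_eq_mul]
    ring
  | succ n ih =>
    rw [integral_chordIntegrand_succ (integrable_chords hE hor.abs_eq hc e he hω)]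
    have ih' : ∀ k : ℝ, ∫ y, chordIntegrand
        (fun (j : Fin n) k => ((E (e j.succ) : ℂ) + (ε (e j.succ) * k : ℝ) * I)⁻¹)
        (treeFactor T E ε c) (fun j => lineDir p q (e j.succ)) (ω - k • lineDir p q (e 0)) y
        = (2 * Real.pi) ^ n * latestSum
          (lineRel p' q' (T ∪ Finset.univ.image fun j : Fin n => e j.succ))
          (lineDen p' q' (T ∪ Finset.univ.image fun j : Fin n => e j.succ) E
            (ω - k • lineDir p q (e 0))) Finset.univ := fun k =>
      ih (fun j => e j.succ) (hinj.comp (Fin.succ_injective n)) (fun j => heT _) (fun j => he _)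
        ((zeroSum V).sub_mem hω ((zeroSum V).smul_mem k (lineDir_mem_zeroSum p q _)))
    simp_rw [ih']
    set F := T ∪ Finset.univ.image fun j : Fin n => e j.succ with hF
    have hins : T ∪ Finset.univ.image e = insert (e 0) F := by
      ext i
      simp only [hF, Finset.mem_union, Finset.mem_image, Finset.mem_univ, true_and,
        Finset.mem_insert, Fin.exists_fin_succ]
      tauto
    have heF : e 0 ∉ F := by
      simp only [hF, Finset.mem_union, Finset.mem_image, Finset.mem_univ, true_and, not_or,
        not_exists]
      exact ⟨heT 0, fun j hj => Fin.succ_ne_zero j (hinj hj)⟩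
    have hpq' : p' (e 0) ≠ q' (e 0) := by
      rcases hor (e 0) with ⟨-, h1, h2⟩ | ⟨-, h1, h2⟩ <;> rw [h1, h2]
      exacts [he 0, (he 0).symm]
    -- The energy measured along the reoriented chord is `ε k`, and reflection invariance of the
    -- measure allows it to be the integration variable.
    set g : ℝ → ℂ := fun k => ((E (e 0) : ℂ) + k * I)⁻¹ * latestSum (lineRel p' q' F)
      (shiftDen (lineDen p' q' F E ω) (p' (e 0)) (q' (e 0)) (k * I)) Finset.univ with hg
    have hgε : ∀ k : ℝ, ((E (e 0) : ℂ) + (ε (e 0) * k : ℝ) * I)⁻¹ * ((2 * Real.pi) ^ n *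
        latestSum (lineRel p' q' F) (lineDen p' q' F E (ω - k • lineDir p q (e 0))) Finset.univ)
        = (2 * Real.pi) ^ n * g (ε (e 0) * k) := by
      intro k
      rw [hor.lineDir, smul_smul, mul_comm k, lineDen_sub_smul_lineDir]
      simp only [hg]
      ring
    have hgint : ∫ k : ℝ, g (ε (e 0) * k) = ∫ k : ℝ, g k := by
      rcases hor (e 0) with ⟨h, -⟩ | ⟨h, -⟩
      · simp [h]
      · simp only [h, neg_mul, one_mul]
        exact integral_neg_eq_self g _
    simp_rw [hgε]
    rw [integral_const_mul, hgint, hg, integral_latestSum_shiftDen (hE _) hpq' (Finset.mem_univ _)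
      (Finset.mem_univ _), hins, lineRel_insert, lineDen_insert p' q' E ω heF]
    · ring
    -- The tree alone already crosses the boundary of every nonempty proper vertex set.
    · intro S _ hne hS
      refine lineDen_re_pos p' q' hE ω ?_
      obtain ⟨i, hi, hcr⟩ := (hT.reorient hor).exists_crossing S
        (hne.imp fun a ha => ⟨Finset.mem_univ _, ha⟩) (by
          by_contra hcon
          push Not at hcon
          exact hS (Finset.Subset.antisymm (Finset.subset_univ _) hcon))
      exact ⟨i, Finset.mem_union_left _ hi, hcr⟩

end Chords

/-! ### Spanning trees and the line energies they determine. -/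

section EnergyIntegral

open Complex MeasureTheory Filter Topology

variable {V ι : Type*}

namespace FeynmanGraph

theorem exists_boundary_line {G : FeynmanGraph V ι} {A : Set ι} (hA : (G.joinedBy A).Connected)
    (S : Set V) {a b : V} (ha : a ∈ S) (hb : b ∉ S) :
    ∃ i ∈ A, (G.src i ∈ S ∧ G.tgt i ∉ S) ∨ (G.tgt i ∈ S ∧ G.src i ∉ S) := by
  obtain ⟨w⟩ := hA.preconnected a b
  obtain ⟨d, -, h1, h2⟩ := w.exists_boundary_dart S ha hb
  have hadj := (SimpleGraph.fromRel_adj _ _ _).1 d.adj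
  rcases hadj.2 with ⟨i, hi, hs, ht⟩ | ⟨i, hi, hs, ht⟩
  · exact ⟨i, hi, Or.inl ⟨hs ▸ h1, ht ▸ h2⟩⟩
  · exact ⟨i, hi, Or.inr ⟨ht ▸ h1, hs ▸ h2⟩⟩

/-- Connectedness supplies a line of `T` across the boundary of any proper vertex set, so a tree
inside `T` grows until it spans. It then has `|V| - 1` lines, hence is all of `T`. -/
theorem IsSpanningTree.treeOn [Fintype V] [DecidableEq V] [DecidableEq ι] {G : FeynmanGraph V ι}
    {T : Finset ι} (hT : G.IsSpanningTree T) : TreeOn G.src G.tgt Finset.univ T := by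
  obtain ⟨v₀⟩ := hT.1.nonempty
  have grow : ∀ n, n + 1 ≤ Fintype.card V →
      ∃ A F, TreeOn G.src G.tgt A F ∧ F ⊆ T ∧ A.card = n + 1 := by
    intro n
    induction n with
    | zero => exact fun _ => ⟨{v₀}, ∅, TreeOn.single v₀, by simp, by simp⟩
    | succ n ih =>
      intro hn
      obtain ⟨A, F, h, hFT, hA⟩ := ih (by omega)
      obtain ⟨b, hb⟩ : ∃ b, b ∉ A := by
        by_contra hcon
        push Not at hcon
        rw [Finset.eq_univ_iff_forall.2 hcon, Finset.card_univ] at hA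
        omega
      obtain ⟨a, ha⟩ := h.nonempty
      obtain ⟨i, hi, hcr⟩ := exists_boundary_line hT.1 (A : Set V) (Finset.mem_coe.2 ha)
        (mt Finset.mem_coe.1 hb)
      simp only [Finset.mem_coe] at hcr
      have hiF : i ∉ F := by
        intro hiF
        have := h.endpoints i hiF
        tauto
      rcases hcr with ⟨h1, h2⟩ | ⟨h1, h2⟩
      · exact ⟨_, _, h.grow h1 h2 hiF (Or.inr ⟨rfl, rfl⟩),
          Finset.insert_subset hi hFT, by rw [Finset.card_insert_of_notMem h2, hA]⟩
      · exact ⟨_, _, h.grow h1 h2 hiF (Or.inl ⟨rfl, rfl⟩),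
          Finset.insert_subset hi hFT, by rw [Finset.card_insert_of_notMem h2, hA]⟩
  have hV : 0 < Fintype.card V := Fintype.card_pos_iff.2 ⟨v₀⟩
  obtain ⟨A, F, h, hFT, hA⟩ := grow (Fintype.card V - 1) (by omega)
  have hAu : A = Finset.univ := by
    rw [← Finset.card_eq_iff_eq_univ, hA]
    omega
  have hF : F = T := by
    refine Finset.eq_of_subset_of_card_le hFT ?_
    have h1 := h.card
    have h2 := hT.2
    rw [hAu, Finset.card_univ] at h1
    omega
  rw [← hAu, ← hF]
  exact h

theorem sum_eq_sum_add_sum_compl [Fintype ι] [DecidableEq ι] {M : Type*} [AddCommMonoid M]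
    (T : Finset ι) (f : ι → M) : ∑ i, f i = ∑ i ∈ T, f i + ∑ l : {l : ι // l ∉ T}, f l := by
  rw [← Fintype.sum_subtype_add_sum_subtype (fun i => i ∈ T) f, ← Finset.sum_coe_sort T f]
  congr!

theorem conserves_iff [Fintype ι] [DecidableEq V] (G : FeynmanGraph V ι) (ω : V → ℝ)
    (k : ι → ℝ) : G.Conserves ω k ↔ ∀ v, ω v = ∑ i, k i * lineDir G.src G.tgt i v := by
  refine forall_congr' fun v => ?_
  have : ∑ i, k i * lineDir G.src G.tgt i v
      = ∑ i with G.src i = v, k i - ∑ i with G.tgt i = v, k i := by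
    simp only [lineDir_apply, mul_sub, Finset.sum_sub_distrib, mul_ite, mul_one, mul_zero,
      Finset.sum_filter, eq_comm (a := v)]
  rw [this, eq_sub_iff_add_eq]

/-- The external energies at the tree when the lines outside it carry the energies `x`. -/
noncomputable def residualEnergy [DecidableEq V] [Fintype ι] [DecidableEq ι]
    (G : FeynmanGraph V ι) (ω : V → ℝ) (T : Finset ι) (x : {l : ι // l ∉ T} → ℝ) : V → ℝ :=
  ω - ∑ l, x l • lineDir G.src G.tgt l

theorem residualEnergy_mem [Fintype V] [DecidableEq V] [Fintype ι] [DecidableEq ι]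
    (G : FeynmanGraph V ι) {ω : V → ℝ} (hω : ω ∈ zeroSum V) (T : Finset ι)
    (x : {l : ι // l ∉ T} → ℝ) : G.residualEnergy ω T x ∈ zeroSum V :=
  (zeroSum V).sub_mem hω ((zeroSum V).sum_mem fun _ _ =>
    (zeroSum V).smul_mem _ (lineDir_mem_zeroSum _ _ _))

theorem conserves_iff_conservesOn [Fintype V] [DecidableEq V] [Fintype ι] [DecidableEq ι]
    (G : FeynmanGraph V ι) (ω : V → ℝ) (T : Finset ι) (x : {l : ι // l ∉ T} → ℝ) (k : ι → ℝ)
    (hk : ∀ l : {l : ι // l ∉ T}, k l = x l) :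
    G.Conserves ω k ↔
      ConservesOn G.src G.tgt Finset.univ T (G.residualEnergy ω T x) k := by
  rw [conserves_iff]
  simp only [ConservesOn, Finset.mem_univ, true_imp_iff]
  refine forall_congr' fun v => ?_
  rw [sum_eq_sum_add_sum_compl T]
  simp only [residualEnergy, Pi.sub_apply, Finset.sum_apply, Pi.smul_apply, smul_eq_mul, hk]
  rw [sub_eq_iff_eq_add]

/-- Existence, from the tree flow, makes the choice in `lineEnergy` meaningful, and uniqueness
identifies it. -/
theorem lineEnergy_spec [Fintype V] [DecidableEq V] [Fintype ι] [DecidableEq ι]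
    (G : FeynmanGraph V ι) {ω : V → ℝ} (hω : ω ∈ zeroSum V) {T : Finset ι} {c : ι → V → ℝ}
    (hc : ∀ ω ∈ zeroSum V, ∀ k, ConservesOn G.src G.tgt Finset.univ T ω k ↔
      ∀ i ∈ T, k i = treeFlow c ω i) (x : {l : ι // l ∉ T} → ℝ) :
    (∀ i ∈ T, G.lineEnergy ω T x i = treeFlow c (G.residualEnergy ω T x) i) ∧
      ∀ l : {l : ι // l ∉ T}, G.lineEnergy ω T x l = x l := by
  have hex : ∃ k : ι → ℝ, G.Conserves ω k ∧ ∀ l : {l : ι // l ∉ T}, k l = x l := by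
    set k : ι → ℝ := fun i => if h : i ∈ T then
      treeFlow c (G.residualEnergy ω T x) i else x ⟨i, h⟩ with hkdef
    have hk : ∀ l : {l : ι // l ∉ T}, k l = x l := fun l => dif_neg l.2
    refine ⟨k, ?_, hk⟩
    rw [conserves_iff_conservesOn G ω T x _ hk, hc _ (residualEnergy_mem G hω T x)]
    exact fun i hi => dif_pos hi
  have hspec := Classical.epsilon_spec hex
  refine ⟨?_, hspec.2⟩
  exact (hc _ (residualEnergy_mem G hω T x) _).1
    ((conserves_iff_conservesOn G ω T x _ hspec.2).1 hspec.1)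

end FeynmanGraph

end EnergyIntegral

/-! ### Splitting off the lines from a vertex to itself; exhaustion by the cutoff. -/

section CutoffLimit

open Complex MeasureTheory Filter Topology

/-- Fubini for a product in separate groups of variables. It will separate the lines from a vertex
to itself, which do not enter the conservation laws. -/
theorem integral_mul_restrict_pi {α : Type*} [Fintype α] (P : α → Prop) [DecidablePred P]
    (F : ({l // P l} → ℝ) → ℂ) (H : ({l // ¬ P l} → ℝ) → ℂ) :
    ∫ x : α → ℝ, F (fun l => x l) * H (fun l => x l) = (∫ u, F u) * ∫ y, H y := by
  have e := volume_preserving_piEquivPiSubtypeProd (fun _ : α => ℝ) P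
  have h := e.integral_comp (MeasurableEquiv.measurableEmbedding _) (fun z => F z.1 * H z.2)
  rw [Measure.volume_eq_prod, integral_prod_mul] at h
  exact h

theorem integral_prod_indicator_Icc {β : Type*} [Fintype β] (H : β → ℝ → ℂ) {Λ : ℝ} (hΛ : 0 ≤ Λ) :
    ∫ u : β → ℝ, ∏ l, (Set.Icc (-Λ) Λ).indicator (H l) (u l)
      = ∏ l, ∫ k in (-Λ)..Λ, H l k := by
  rw [integral_fintype_prod_volume_eq_prod (fun l => (Set.Icc (-Λ) Λ).indicator (H l))]
  refine Finset.prod_congr rfl fun l _ => ?_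
  rw [integral_indicator measurableSet_Icc, integral_Icc_eq_integral_Ioc,
    intervalIntegral.integral_of_le (by linarith)]

variable {V ι : Type*} [DecidableEq V]

/-- The integrand of the energies `y` of the lines `a l`, added to the tree `T`. -/
noncomputable def chordFactor [Fintype V] {δ : Type*} [Fintype δ] (p q : ι → V) (T : Finset ι) (E ε : ι → ℝ)
    (c : ι → V → ℝ) (ω : V → ℝ) (a : δ → ι) (y : δ → ℝ) : ℂ :=
  (∏ l, ((E (a l) : ℂ) + (ε (a l) * y l : ℝ) * I)⁻¹) *
    treeFactor T E ε c (ω - ∑ l, y l • lineDir p q (a l))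

theorem integrable_chordFactor_and_integral_eq [Fintype V] [DecidableEq ι] {δ : Type*} [Fintype δ] {p q p' q' : ι → V}
    {ε : ι → ℝ}
    (hor : IsReorientation p q p' q' ε) {T : Finset ι} (hT : TreeOn p q Finset.univ T) {E : ι → ℝ}
    (hE : ∀ i, 0 < E i) {c : ι → V → ℝ}
    (hc : ∀ ω ∈ zeroSum V, ConservesOn p q Finset.univ T ω (treeFlow c ω)) (a : δ → ι)
    (hinj : Function.Injective a) (haT : ∀ j, a j ∉ T)
    (ha : ∀ j, p (a j) ≠ q (a j)) {ω : V → ℝ} (hω : ω ∈ zeroSum V) :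
    Integrable (chordFactor p q T E ε c ω a) ∧
    ∫ y, chordFactor p q T E ε c ω a y = (2 * Real.pi) ^ Fintype.card δ *
      latestSum (lineRel p' q' (T ∪ Finset.univ.image a))
        (lineDen p' q' (T ∪ Finset.univ.image a) E ω) Finset.univ := by
  set e := (Fintype.equivFin δ).symm with he
  have hmp := volume_measurePreserving_piCongrLeft (fun _ : δ => ℝ) e
  have hcomp : ∀ x : Fin (Fintype.card δ) → ℝ, chordFactor p q T E ε c ω a
      (MeasurableEquiv.piCongrLeft (fun _ : δ => ℝ) e x) =
      chordIntegrand (fun j k => ((E (a (e j)) : ℂ) + (ε (a (e j)) * k : ℝ) * I)⁻¹)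
        (treeFactor T E ε c) (fun j => lineDir p q (a (e j))) ω x := by
    intro x
    have hx : ∀ j, MeasurableEquiv.piCongrLeft (fun _ : δ => ℝ) e x (e j) = x j := fun j => by
      rw [MeasurableEquiv.coe_piCongrLeft, Equiv.piCongrLeft_apply_apply]
    rw [chordFactor, chordIntegrand, ← e.prod_comp, ← e.sum_comp]
    simp only [hx]
  have himage : Finset.univ.image (fun j => a (e j)) = Finset.univ.image a := by
    ext i
    simp only [Finset.mem_image, Finset.mem_univ, true_and]
    exact e.surjective.exists (p := fun j => a j = i) |>.symm
  constructor
  · have hi := integrable_chords hE hor.abs_eq hc (fun j => a (e j)) (fun j => ha _) hω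
    rw [← hmp.integrable_comp_emb (MeasurableEquiv.measurableEmbedding _)]
    exact hi.congr (Eventually.of_forall fun x => (hcomp x).symm)
  · rw [← hmp.integral_comp (MeasurableEquiv.measurableEmbedding _)]
    simp_rw [hcomp]
    rw [integral_chords hor hT hE hc (fun j => a (e j)) (hinj.comp e.injective) (fun j => haT _)
      (fun j => ha _) hω, himage]

/-- The lines outside `F` begin and end at the same vertex: they cross no boundary and order no two
vertices. -/
theorem latestSum_lineRel_univ [Fintype ι] (p q : ι → V) (F : Finset ι) (hF : ∀ i ∉ F, p i = q i)
    (E : ι → ℝ) (ω : V → ℝ) (A : Finset V) :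
    latestSum (lineRel p q F) (lineDen p q F E ω) A
      = latestSum (lineRel p q Finset.univ) (lineDen p q Finset.univ E ω) A := by
  have hd : lineDen p q F E ω = lineDen p q Finset.univ E ω := by
    funext S
    rw [lineDen, lineDen]
    congr 1
    refine Finset.sum_subset (Finset.subset_univ _) fun i _ hi => ?_
    rw [hF i hi, if_pos Iff.rfl]
  have hr : ∀ (S : Finset V) x, IsLatest (lineRel p q F) S x
      ↔ IsLatest (lineRel p q Finset.univ) S x := by
    intro S x
    refine forall₃_congr fun y _ hyx => not_congr ?_
    constructor
    · rintro ⟨i, -, h⟩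
      exact ⟨i, Finset.mem_univ i, h⟩
    · rintro ⟨i, -, h1, h2⟩
      refine ⟨i, ?_, h1, h2⟩
      by_contra hi
      exact hyx (by rw [← h1, ← h2, hF i hi])
  rw [hd]
  exact latestSum_congr (fun _ => True) (by simp) (by simp) (fun S x _ _ => hr S x) (by simp)
    (fun x _ => hr A x)

/-- The set of the energies of the lines `a l` for which no energy exceeds the cutoff `Λ`. -/
def chordRegion [Fintype V] {δ : Type*} [Fintype δ] (p q : ι → V) (T : Finset ι) (c : ι → V → ℝ) (ω : V → ℝ)
    (a : δ → ι) (Λ : ℝ) : Set (δ → ℝ) :=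
  {y | (∀ l, |y l| ≤ Λ) ∧ ∀ i ∈ T, |treeFlow c (ω - ∑ l, y l • lineDir p q (a l)) i| ≤ Λ}

theorem aecover_chordRegion [Fintype V] {δ : Type*} [Fintype δ] (p q : ι → V) (T : Finset ι) (c : ι → V → ℝ)
    (ω : V → ℝ) (a : δ → ι) : AECover volume atTop (chordRegion p q T c ω a) where
  ae_eventually_mem := by
    refine Eventually.of_forall fun y => ?_
    have h1 : ∀ᶠ Λ : ℝ in atTop, ∀ l, |y l| ≤ Λ :=
      eventually_all.2 fun l => eventually_ge_atTop _
    have h2 : ∀ᶠ Λ : ℝ in atTop, ∀ i ∈ T,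
        |treeFlow c (ω - ∑ l, y l • lineDir p q (a l)) i| ≤ Λ :=
      (Finset.eventually_all T).2 fun i _ => eventually_ge_atTop _
    filter_upwards [h1, h2] with Λ h1 h2 using ⟨h1, h2⟩
  measurableSet Λ := by
    have h : chordRegion p q T c ω a Λ = (⋂ l, {y : δ → ℝ | |y l| ≤ Λ}) ∩ ⋂ i ∈ T,
        {y : δ → ℝ | |treeFlow c (ω - ∑ l, y l • lineDir p q (a l)) i| ≤ Λ} := by
      ext y
      simp [chordRegion]
    rw [h]
    refine (MeasurableSet.iInter fun l =>
      (isClosed_le (by fun_prop) continuous_const).measurableSet).inter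
      (Finset.measurableSet_biInter _ fun i _ => (isClosed_le ?_ continuous_const).measurableSet)
    exact ((continuous_treeFlow c i).comp (by fun_prop)).abs

end CutoffLimit

/-! ### The limit of the cutoff integral for one choice of poles. -/

section PoleIntegral

open Complex MeasureTheory Filter Topology

variable {V ι : Type*} [DecidableEq V] [Fintype ι] [DecidableEq ι]

namespace FeynmanGraph

/-- The number of lines from a vertex to itself outside `T`. -/
def selfLoops (G : FeynmanGraph V ι) (T : Finset ι) : ℕ :=
  Fintype.card {l : {l : ι // l ∉ T} // G.src l = G.tgt l}

theorem residualEnergy_eq (G : FeynmanGraph V ι) (ω : V → ℝ) (T : Finset ι)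
    (x : {l : ι // l ∉ T} → ℝ) : G.residualEnergy ω T x
      = ω - ∑ l : {l : {l : ι // l ∉ T} // ¬ G.src l = G.tgt l},
        x l.1 • lineDir G.src G.tgt l.1 := by
  rw [residualEnergy]
  congr 1
  rw [← Fintype.sum_subtype_add_sum_subtype (fun l : {l : ι // l ∉ T} => G.src l = G.tgt l),
    Finset.sum_eq_zero, zero_add]
  intro l _
  rw [lineDir, l.2, sub_self, smul_zero]

theorem prod_eq_prod_mul_prod_compl {M : Type*} [CommMonoid M]
    (T : Finset ι) (f : ι → M) : ∏ i, f i = (∏ i ∈ T, f i) * ∏ l : {l : ι // l ∉ T}, f l := by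
  rw [← Fintype.prod_subtype_mul_prod_subtype (fun i => i ∈ T) f, ← Finset.prod_coe_sort T f]
  congr!

variable [Fintype V]

/-- The cutoff region is the product of a cube for the lines from a vertex to itself and a region
for the other chords. The cube gives conditionally convergent integrals with limit `π` each; on the
other factor absolute convergence makes the shape of the cutoff irrelevant. -/
theorem tendsto_poleIntegral (G : FeynmanGraph V ι) {T : Finset ι} (hT : G.IsSpanningTree T)
    {p' q' : ι → V} {ε : ι → ℝ} (hor : IsReorientation G.src G.tgt p' q' ε) {E : ι → ℝ}
    (hE : ∀ i, 0 < E i) {ω : V → ℝ} (hω : ∑ v, ω v = 0) :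
    Tendsto (fun Λ : ℝ => (((2 * Real.pi) ^ Fintype.card {l : ι // l ∉ T} : ℝ) : ℂ)⁻¹ *
      ∫ x in {x : {l : ι // l ∉ T} → ℝ | ∀ i, |G.lineEnergy ω T x i| ≤ Λ},
        ∏ i, ((E i : ℂ) + (ε i * G.lineEnergy ω T x i : ℝ) * I)⁻¹) atTop
      (𝓝 ((2 : ℂ)⁻¹ ^ G.selfLoops T *
        latestSum (lineRel p' q' Finset.univ) (lineDen p' q' Finset.univ E ω) Finset.univ)) := by
  have hω' : ω ∈ zeroSum V := hω
  have htree := hT.treeOn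
  obtain ⟨c, hc⟩ := htree.exists_coefficients
  have hcons : ∀ ω ∈ zeroSum V, ConservesOn G.src G.tgt Finset.univ T ω (treeFlow c ω) :=
    fun ω hω => (hc ω hω _).2 fun i _ => rfl
  have hspec := G.lineEnergy_spec hω' hc
  set P : {l : ι // l ∉ T} → Prop := fun l => G.src l = G.tgt l with hP
  set a : {l // ¬ P l} → ι := fun l => l.1 with ha
  set H : {l : ι // l ∉ T} → ℝ → ℂ := fun l k => ((E l : ℂ) + (ε l * k : ℝ) * I)⁻¹ with hH
  have hK : ∀ x : {l : ι // l ∉ T} → ℝ,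
      ∏ i, ((E i : ℂ) + (ε i * G.lineEnergy ω T x i : ℝ) * I)⁻¹
      = (∏ l : {l // P l}, H l (x l)) *
        chordFactor G.src G.tgt T E ε c ω a (fun l => x l) := by
    intro x
    have h1 : ∏ i ∈ T, ((E i : ℂ) + (ε i * G.lineEnergy ω T x i : ℝ) * I)⁻¹
        = treeFactor T E ε c (G.residualEnergy ω T x) :=
      Finset.prod_congr rfl fun i hi => by rw [(hspec x).1 i hi]
    rw [prod_eq_prod_mul_prod_compl T, h1,
      ← Fintype.prod_subtype_mul_prod_subtype P, chordFactor, residualEnergy_eq]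
    simp only [(hspec x).2, hH, ha]
    ring
  have hmem : ∀ Λ : ℝ, ∀ x : {l : ι // l ∉ T} → ℝ, (∀ i, |G.lineEnergy ω T x i| ≤ Λ) ↔
      (∀ l : {l // P l}, x l ∈ Set.Icc (-Λ) Λ) ∧
        (fun l : {l // ¬ P l} => x l) ∈ chordRegion G.src G.tgt T c ω a Λ := by
    intro Λ x
    have hres := G.residualEnergy_eq ω T x
    constructor
    · intro h
      refine ⟨fun l => abs_le.1 ?_, fun l => ?_, fun i hi => ?_⟩
      · rw [← (hspec x).2]; exact h _
      · change |x l.1| ≤ Λ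
        rw [← (hspec x).2]; exact h _
      · have := h i
        rwa [(hspec x).1 i hi, hres] at this
    · rintro ⟨h1, h2, h3⟩ i
      by_cases hi : i ∈ T
      · rw [(hspec x).1 i hi, hres]
        exact h3 i hi
      · rw [(hspec x).2 ⟨i, hi⟩]
        by_cases hl : P ⟨i, hi⟩
        · exact abs_le.2 (h1 ⟨⟨i, hi⟩, hl⟩)
        · exact h2 ⟨⟨i, hi⟩, hl⟩
  have hcover := aecover_chordRegion G.src G.tgt T c ω a
  have hfactor : ∀ Λ : ℝ, 0 ≤ Λ →
      ∫ x in {x : {l : ι // l ∉ T} → ℝ | ∀ i, |G.lineEnergy ω T x i| ≤ Λ},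
        ∏ i, ((E i : ℂ) + (ε i * G.lineEnergy ω T x i : ℝ) * I)⁻¹
      = (∏ l : {l // P l}, ∫ k in (-Λ)..Λ, H l k) *
        ∫ y in chordRegion G.src G.tgt T c ω a Λ, chordFactor G.src G.tgt T E ε c ω a y := by
    intro Λ hΛ
    have hmeas : MeasurableSet {x : {l : ι // l ∉ T} → ℝ | ∀ i, |G.lineEnergy ω T x i| ≤ Λ} := by
      have : {x : {l : ι // l ∉ T} → ℝ | ∀ i, |G.lineEnergy ω T x i| ≤ Λ}
          = (⋂ l : {l // P l}, (fun x : {l : ι // l ∉ T} → ℝ => x l) ⁻¹' Set.Icc (-Λ) Λ) ∩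
            (fun (x : {l : ι // l ∉ T} → ℝ) (l : {l // ¬ P l}) => x l) ⁻¹'
              chordRegion G.src G.tgt T c ω a Λ := by
        ext x
        simp only [Set.mem_inter_iff, Set.mem_iInter, Set.mem_preimage]
        exact hmem Λ x
      rw [this]
      refine (MeasurableSet.iInter fun l =>
        (measurable_pi_apply _) measurableSet_Icc).inter ?_
      exact (measurable_pi_lambda _ fun l => measurable_pi_apply _) (hcover.measurableSet Λ)
    rw [← integral_indicator hmeas, ← integral_indicator (hcover.measurableSet Λ),
      ← integral_prod_indicator_Icc (fun l : {l // P l} => H l) hΛ, ← integral_mul_restrict_pi P]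
    refine integral_congr_ae (Eventually.of_forall fun x => ?_)
    by_cases hx : ∀ i, |G.lineEnergy ω T x i| ≤ Λ
    · obtain ⟨h1, h2⟩ := (hmem Λ x).1 hx
      simp only
      rw [Set.indicator_of_mem (s := {x | ∀ i, |G.lineEnergy ω T x i| ≤ Λ}) hx, hK,
        Set.indicator_of_mem h2]
      congr 1
      exact Finset.prod_congr rfl fun l _ => (Set.indicator_of_mem (h1 l) _).symm
    · simp only
      rw [Set.indicator_of_notMem (s := {x | ∀ i, |G.lineEnergy ω T x i| ≤ Λ}) hx]
      rw [hmem, not_and_or] at hx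
      rcases hx with hx | hx
      · push Not at hx
        obtain ⟨l, hl⟩ := hx
        rw [Finset.prod_eq_zero (Finset.mem_univ l) (Set.indicator_of_notMem hl _), zero_mul]
      · rw [Set.indicator_of_notMem hx, mul_zero]
  have hainj : Function.Injective a := fun l m h => Subtype.ext (Subtype.ext h)
  obtain ⟨hint, hval⟩ := integrable_chordFactor_and_integral_eq hor htree hE hcons a hainj
    (fun l => l.1.2) (fun l => l.2) hω'
  have hlim1 := hcover.integral_tendsto_of_countably_generated hint
  have hlim2 : Tendsto (fun Λ : ℝ => ∏ l : {l // P l}, ∫ k in (-Λ)..Λ, H l k) atTop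
      (𝓝 (∏ _l : {l // P l}, (Real.pi : ℂ))) :=
    tendsto_finsetProd _ fun l _ => tendsto_integral_inv_add (hE _) _ (by
      rw [← sq_abs, hor.abs_eq, one_pow])
  have hlim := ((hlim2.mul hlim1).const_mul
    (((2 * Real.pi) ^ Fintype.card {l : ι // l ∉ T} : ℝ) : ℂ)⁻¹)
  have hcard : Fintype.card {l : ι // l ∉ T}
      = Fintype.card {l // P l} + Fintype.card {l // ¬ P l} := by
    rw [← Fintype.card_sum]
    exact (Fintype.card_congr (Equiv.sumCompl P)).symm
  have hF : ∀ i ∉ T ∪ Finset.univ.image a, p' i = q' i := by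
    intro i hi
    simp only [Finset.mem_union, Finset.mem_image, Finset.mem_univ, true_and, not_or,
      not_exists] at hi
    have hpq : G.src i = G.tgt i := by
      by_contra hne
      exact hi.2 ⟨⟨i, hi.1⟩, hne⟩ rfl
    rcases hor i with ⟨-, h1, h2⟩ | ⟨-, h1, h2⟩ <;> rw [h1, h2, hpq]
  -- All powers of `2π` cancel except for `π / (2π) = 1/2` per line from a vertex to itself.
  have hconst : (((2 * Real.pi) ^ Fintype.card {l : ι // l ∉ T} : ℝ) : ℂ)⁻¹ *
      ((∏ _l : {l // P l}, (Real.pi : ℂ)) *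
        ∫ y, chordFactor G.src G.tgt T E ε c ω a y)
      = (2 : ℂ)⁻¹ ^ G.selfLoops T *
        latestSum (lineRel p' q' Finset.univ) (lineDen p' q' Finset.univ E ω) Finset.univ := by
    have hpi : (Real.pi : ℂ) ≠ 0 := by exact_mod_cast Real.pi_ne_zero
    rw [hval, latestSum_lineRel_univ p' q' _ hF, hcard, Finset.prod_const, Finset.card_univ,
      selfLoops]
    push_cast
    rw [pow_add, mul_pow 2 (Real.pi : ℂ) (Fintype.card {l // P l})]
    simp only [inv_pow]
    field_simp
    exact mul_comm _ _
  rw [hconst] at hlim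
  refine hlim.congr' ?_
  filter_upwards [eventually_ge_atTop 0] with Λ hΛ
  rw [hfactor Λ hΛ]

theorem continuous_lineEnergy (G : FeynmanGraph V ι) {T : Finset ι} (hT : G.IsSpanningTree T)
    {ω : V → ℝ} (hω : ∑ v, ω v = 0) (i : ι) : Continuous fun x => G.lineEnergy ω T x i := by
  obtain ⟨c, hc⟩ := hT.treeOn.exists_coefficients
  have hspec := G.lineEnergy_spec (mem_zeroSum.2 hω) hc
  by_cases hi : i ∈ T
  · simp only [fun x => (hspec x).1 i hi]
    refine (continuous_treeFlow c i).comp ?_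
    unfold residualEnergy
    fun_prop
  · simp only [fun x => (hspec x).2 ⟨i, hi⟩]
    fun_prop

theorem integrableOn_poles (G : FeynmanGraph V ι) {T : Finset ι} (hT : G.IsSpanningTree T)
    {E : ι → ℝ} (hE : ∀ i, 0 < E i) {ω : V → ℝ} (hω : ∑ v, ω v = 0) (ε : ι → ℝ) (Λ : ℝ) :
    IntegrableOn (fun x => ∏ i, ((E i : ℂ) + (ε i * G.lineEnergy ω T x i : ℝ) * I)⁻¹)
      {x : {l : ι // l ∉ T} → ℝ | ∀ i, |G.lineEnergy ω T x i| ≤ Λ} := by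
  obtain ⟨c, hc⟩ := hT.treeOn.exists_coefficients
  have hspec := G.lineEnergy_spec (mem_zeroSum.2 hω) hc
  have hcont : Continuous fun x : {l : ι // l ∉ T} → ℝ =>
      ∏ i, ((E i : ℂ) + (ε i * G.lineEnergy ω T x i : ℝ) * I)⁻¹ :=
    continuous_finsetProd _ fun i _ =>
      (continuous_inv_add (hE i) (ε i)).comp (G.continuous_lineEnergy hT hω i)
  refine (hcont.continuousOn.integrableOn_compact
    (isCompact_closedBall (0 : {l : ι // l ∉ T} → ℝ) (max Λ 0))).mono_set fun x hx => ?_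
  rw [mem_closedBall_zero_iff, pi_norm_le_iff_of_nonneg (le_max_right _ _)]
  intro l
  rw [← (hspec x).2, Real.norm_eq_abs]
  exact (hx l).trans (le_max_left _ _)

end FeynmanGraph

end PoleIntegral

/-! ### Partial fractions, and the D-function as a sum over time orderings. -/

section OrderSum

open Complex MeasureTheory Filter Topology

/-- The part of the numerator of a propagator that does not depend on the energy `k`. -/
noncomputable def LineKind.numeratorConst (γ : Fin 4 → Matrix (Fin 4) (Fin 4) ℂ) :
    (κ : LineKind) → Matrix (Fin κ.spinDim) (Fin κ.spinDim) ℂ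
  | .scalar => (1 : Matrix (Fin 1) (Fin 1) ℂ)
  | .fermion m q => ((m : ℂ) • (1 : Matrix (Fin 4) (Fin 4) ℂ)
        - ∑ j : Fin 3, (q j : ℂ) • γ j.succ : Matrix (Fin 4) (Fin 4) ℂ)

/-- The coefficient of `i k` in the numerator of a propagator. -/
noncomputable def LineKind.numeratorSlope (γ : Fin 4 → Matrix (Fin 4) (Fin 4) ℂ) :
    (κ : LineKind) → Matrix (Fin κ.spinDim) (Fin κ.spinDim) ℂ
  | .scalar => (0 : Matrix (Fin 1) (Fin 1) ℂ)
  | .fermion _ _ => γ 0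

theorem LineKind.numerator_eq (γ : Fin 4 → Matrix (Fin 4) (Fin 4) ℂ) (κ : LineKind) (k : ℝ) :
    κ.numerator γ k = κ.numeratorConst γ + (I * (k : ℂ)) • κ.numeratorSlope γ := by
  cases κ with
  | scalar => simp [numerator, numeratorConst, numeratorSlope]
  | fermion m q =>
    simp only [numerator, numeratorConst, numeratorSlope]
    abel

/-- The sign of an orientation. -/
def signOf (b : Bool) : ℝ := if b then 1 else -1

/-- Partial fractions of a propagator. -/
theorem LineKind.two_mul_propagator (γ : Fin 4 → Matrix (Fin 4) (Fin 4) ℂ) (κ : LineKind) {E : ℝ}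
    (hE : 0 < E) (k : ℝ) (a b : Fin κ.spinDim) :
    2 * (E : ℂ) * κ.propagator γ k E a b = ∑ s : Bool,
      (κ.numeratorConst γ a b - ((signOf s * E : ℝ) : ℂ) * κ.numeratorSlope γ a b) *
        ((E : ℂ) + (signOf s * k : ℝ) * I)⁻¹ := by
  have h1 := add_mul_I_ne_zero hE k
  have h2 : (E : ℂ) - k * I ≠ 0 := by simpa [sub_eq_add_neg] using add_mul_I_ne_zero hE (-k)
  have h3 : ((k ^ 2 + E ^ 2 : ℝ) : ℂ) = (E + k * I) * (E - k * I) := by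
    push_cast
    ring_nf
    rw [I_sq]
    ring
  rw [propagator, numerator_eq, Matrix.smul_apply, Matrix.add_apply, Matrix.smul_apply, h3,
    Fintype.sum_bool]
  simp only [signOf, smul_eq_mul, if_true, Bool.false_eq_true, if_false, one_mul, neg_mul,
    ofReal_neg, ← sub_eq_add_neg, sub_neg_eq_add]
  rw [mul_inv]
  field_simp
  ring

variable {V ι : Type*}

namespace FeynmanGraph

/-- Start of the line `i` after reversal of the lines with `s i = false`. -/
def srcOf (G : FeynmanGraph V ι) (s : ι → Bool) (i : ι) : V := if s i then G.src i else G.tgt i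

/-- End of the line `i` after reversal of the lines with `s i = false`. -/
def tgtOf (G : FeynmanGraph V ι) (s : ι → Bool) (i : ι) : V := if s i then G.tgt i else G.src i

theorem isReorientation (G : FeynmanGraph V ι) (s : ι → Bool) :
    IsReorientation G.src G.tgt (G.srcOf s) (G.tgtOf s) (fun i => signOf (s i)) := by
  intro i
  cases h : s i <;> simp [srcOf, tgtOf, signOf, h]

variable [Fintype ι] [DecidableEq ι]

/-- The numerators of the lines at the poles selected by `s`. -/
noncomputable def poleNumerator (G : FeynmanGraph V ι) (γ : Fin 4 → Matrix (Fin 4) (Fin 4) ℂ)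
    (a b : ∀ i, Fin (G.kind i).spinDim) (s : ι → Bool) (E : ι → ℝ) : ℂ :=
  ∏ i, ((G.kind i).numeratorConst γ (a i) (b i)
    - ((signOf (s i) * E i : ℝ) : ℂ) * (G.kind i).numeratorSlope γ (a i) (b i))

theorem integrand_eq (G : FeynmanGraph V ι) (γ : Fin 4 → Matrix (Fin 4) (Fin 4) ℂ)
    (Γ : (∀ i, Fin (G.kind i).spinDim) → (∀ i, Fin (G.kind i).spinDim) → ℂ) {E : ι → ℝ}
    (hE : ∀ i, 0 < E i) (k : ι → ℝ) :
    G.integrand γ Γ E k = ∑ a, ∑ b, ∑ s : ι → Bool, Γ a b * G.poleNumerator γ a b s E *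
      ∏ i, ((E i : ℂ) + (signOf (s i) * k i : ℝ) * I)⁻¹ := by
  rw [integrand, Finset.mul_sum]
  refine Finset.sum_congr rfl fun a _ => ?_
  rw [Finset.mul_sum]
  refine Finset.sum_congr rfl fun b _ => ?_
  rw [mul_left_comm, ← Finset.prod_mul_distrib]
  simp_rw [LineKind.two_mul_propagator γ _ (hE _)]
  rw [Finset.prod_univ_sum, Finset.mul_sum, Fintype.piFinset_univ]
  refine Finset.sum_congr rfl fun s _ => ?_
  rw [Finset.prod_mul_distrib, poleNumerator, mul_assoc]

variable [Fintype V] [DecidableEq V]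

/-- The zero-temperature `D`-function as a sum over the poles of the propagators and the time
orderings of the vertices. -/
noncomputable def orderSum (G : FeynmanGraph V ι) (γ : Fin 4 → Matrix (Fin 4) (Fin 4) ℂ)
    (Γ : (∀ i, Fin (G.kind i).spinDim) → (∀ i, Fin (G.kind i).spinDim) → ℂ)
    (ω : V → ℝ) (T : Finset ι) (E : ι → ℝ) : ℂ :=
  ∑ a, ∑ b, ∑ s : ι → Bool, Γ a b * G.poleNumerator γ a b s E * ((2 : ℂ)⁻¹ ^ G.selfLoops T *
    latestSum (lineRel (G.srcOf s) (G.tgtOf s) Finset.univ)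
      (lineDen (G.srcOf s) (G.tgtOf s) Finset.univ E ω) Finset.univ)

/-- At finite cutoff the region is bounded, so the sum over the pole choices can be taken out of the
integral; every term then has a limit of its own. -/
theorem isD0Value_orderSum (G : FeynmanGraph V ι) (γ : Fin 4 → Matrix (Fin 4) (Fin 4) ℂ)
    (Γ : (∀ i, Fin (G.kind i).spinDim) → (∀ i, Fin (G.kind i).spinDim) → ℂ)
    {T : Finset ι} (hT : G.IsSpanningTree T) {ω : V → ℝ} (hω : ∑ v, ω v = 0) {E : ι → ℝ}
    (hE : ∀ i, 0 < E i) : G.IsD0Value γ Γ ω T E (G.orderSum γ Γ ω T E) := by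
  have hlim : Tendsto (fun Λ : ℝ => ∑ a : ∀ i, Fin (G.kind i).spinDim,
      ∑ b : ∀ i, Fin (G.kind i).spinDim, ∑ s : ι → Bool,
      Γ a b * G.poleNumerator γ a b s E *
        ((((2 * Real.pi) ^ Fintype.card {l : ι // l ∉ T} : ℝ) : ℂ)⁻¹ *
        ∫ x in {x : {l : ι // l ∉ T} → ℝ | ∀ i, |G.lineEnergy ω T x i| ≤ Λ},
          ∏ i, ((E i : ℂ) + (signOf (s i) * G.lineEnergy ω T x i : ℝ) * I)⁻¹)) atTop
      (𝓝 (G.orderSum γ Γ ω T E)) :=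
    tendsto_finsetSum _ fun a _ => tendsto_finsetSum _ fun b _ => tendsto_finsetSum _ fun s _ =>
      (G.tendsto_poleIntegral hT (G.isReorientation s) hE hω).const_mul _
  refine hlim.congr fun Λ => ?_
  rw [cutoffD0]
  simp_rw [integrand_eq G γ Γ hE]
  have hi : ∀ (a b : ∀ i, Fin (G.kind i).spinDim) (s : ι → Bool), IntegrableOn (fun x =>
      Γ a b * G.poleNumerator γ a b s E *
        ∏ i, ((E i : ℂ) + (signOf (s i) * G.lineEnergy ω T x i : ℝ) * I)⁻¹)
      {x : {l : ι // l ∉ T} → ℝ | ∀ i, |G.lineEnergy ω T x i| ≤ Λ} := fun a b s =>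
    (G.integrableOn_poles hT hE hω (fun i => signOf (s i)) Λ).const_mul _
  rw [integral_finsetSum _ fun a _ => integrable_finsetSum _ fun b _ =>
    integrable_finsetSum _ fun s _ => hi a b s, Finset.mul_sum]
  refine Finset.sum_congr rfl fun a _ => ?_
  rw [integral_finsetSum _ fun b _ => integrable_finsetSum _ fun s _ => hi a b s, Finset.mul_sum]
  refine Finset.sum_congr rfl fun b _ => ?_
  rw [integral_finsetSum _ fun s _ => hi a b s, Finset.mul_sum]
  refine Finset.sum_congr rfl fun s _ => ?_
  rw [integral_const_mul]
  ring

end FeynmanGraph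

end OrderSum

/-! ### Cancellation over a cut set. -/

section CutIdentity

open Complex

variable {V ι : Type*}

namespace FeynmanGraph

/-- The separating set is the connected component of a vertex after the lines have been snipped. -/
theorem IsCutSet.exists_separation [Fintype V] [Nonempty V] {G : FeynmanGraph V ι} {C : Finset ι}
    (hC : G.IsCutSet C) : ∃ S : Finset V, S.Nonempty ∧ S ≠ Finset.univ ∧
      ∀ i ∉ C, (G.src i ∈ S ↔ G.tgt i ∈ S) := by
  classical
  have hpre : ¬ (G.joinedBy {i | i ∉ C}).Preconnected := fun h => hC ⟨h⟩
  unfold SimpleGraph.Preconnected at hpre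
  push Not at hpre
  obtain ⟨a, b, hab⟩ := hpre
  refine ⟨Finset.univ.filter fun x => (G.joinedBy {i | i ∉ C}).Reachable a x, ⟨a, ?_⟩, ?_, ?_⟩
  · simp
  · intro h
    have : b ∈ Finset.univ.filter fun x => (G.joinedBy {i | i ∉ C}).Reachable a x := by
      rw [h]; exact Finset.mem_univ b
    exact hab (by simpa using this)
  · intro i hi
    simp only [Finset.mem_filter, Finset.mem_univ, true_and]
    by_cases hst : G.src i = G.tgt i
    · rw [hst]
    · have hadj : (G.joinedBy {i | i ∉ C}).Adj (G.src i) (G.tgt i) :=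
        (SimpleGraph.fromRel_adj _ _ _).2 ⟨hst, Or.inl ⟨i, hi, rfl, rfl⟩⟩
      exact ⟨fun h => h.trans hadj.reachable, fun h => h.trans hadj.symm.reachable⟩

theorem IsConnected.exists_crossing {G : FeynmanGraph V ι} (hG : G.IsConnected) {S : Finset V}
    [Fintype V] (hne : S.Nonempty) (hS : S ≠ Finset.univ) :
    ∃ i, ¬ (G.src i ∈ S ↔ G.tgt i ∈ S) := by
  obtain ⟨a, ha⟩ := hne
  obtain ⟨b, hb⟩ : ∃ b, b ∉ S := by
    by_contra hcon
    push Not at hcon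
    exact hS (Finset.eq_univ_iff_forall.2 hcon)
  obtain ⟨i, -, h⟩ := exists_boundary_line hG (S : Set V) (Finset.mem_coe.2 ha)
    (mt Finset.mem_coe.1 hb)
  simp only [Finset.mem_coe] at h
  exact ⟨i, by tauto⟩

variable [DecidableEq V]

/-- The denominators obtained from `lineDen` by additive continuation: the energies of the lines
that leave `S` minus those of the lines that enter `S`, plus `i` times the external energy. -/
noncomputable def flowDen [Fintype ι] (G : FeynmanGraph V ι) (t : ι → Bool) (ω : V → ℝ) (E : ι → ℝ)
    (S : Finset V) : ℂ :=
  I * ((∑ v ∈ S, ω v : ℝ) : ℂ) + ∑ i, ((signOf (t i) * E i : ℝ) : ℂ) *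
    ((if G.src i ∈ S then 1 else 0) - (if G.tgt i ∈ S then 1 else 0))

theorem flowDen_union [Fintype ι] (G : FeynmanGraph V ι) (t : ι → Bool) (ω : V → ℝ) (E : ι → ℝ)
    {S U : Finset V} (h : Disjoint S U) :
    G.flowDen t ω E (S ∪ U) = G.flowDen t ω E S + G.flowDen t ω E U := by
  have hind : ∀ v, (if v ∈ S ∪ U then (1 : ℂ) else 0)
      = (if v ∈ S then 1 else 0) + (if v ∈ U then 1 else 0) := by
    intro v
    by_cases hS : v ∈ S
    · simp [hS, Finset.disjoint_left.1 h hS]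
    · simp [hS]
  rw [flowDen, flowDen, flowDen, Finset.sum_union h]
  simp only [hind]
  rw [add_add_add_comm, ← Finset.sum_add_distrib]
  congr 1
  · push_cast
    ring
  · exact Finset.sum_congr rfl fun i _ => by ring

theorem flowDen_univ [Fintype V] [Fintype ι] (G : FeynmanGraph V ι) (t : ι → Bool) {ω : V → ℝ}
    (hω : ∑ v, ω v = 0) (E : ι → ℝ) : G.flowDen t ω E Finset.univ = 0 := by
  simp [flowDen, hω]

/-- On the vertex sets that no line enters the two kinds of denominators agree. -/
theorem latestSum_lineDen_eq_flowDen [Fintype V] [Fintype ι] (G : FeynmanGraph V ι)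
    (s : ι → Bool) (ω : V → ℝ) (E : ι → ℝ) :
    latestSum (lineRel (G.srcOf s) (G.tgtOf s) Finset.univ)
      (lineDen (G.srcOf s) (G.tgtOf s) Finset.univ E ω) Finset.univ
    = latestSum (lineRel (G.srcOf s) (G.tgtOf s) Finset.univ) (G.flowDen s ω E) Finset.univ := by
  -- A latest element is the source of no line into the rest of `S`, so its removal preserves the
  -- property that no line enters.
  have hD : ∀ (S : Finset V) x, (∀ i, G.tgtOf s i ∈ S → G.srcOf s i ∈ S) → x ∈ S →
      IsLatest (lineRel (G.srcOf s) (G.tgtOf s) Finset.univ) S x →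
      ∀ i, G.tgtOf s i ∈ S.erase x → G.srcOf s i ∈ S.erase x := by
    intro S x hS hx hl i hi
    rw [Finset.mem_erase] at hi ⊢
    exact ⟨fun h => hl _ hi.2 hi.1 ⟨i, Finset.mem_univ i, h, rfl⟩, hS i hi.2⟩
  refine latestSum_congr (fun S => ∀ i, G.tgtOf s i ∈ S → G.srcOf s i ∈ S) hD ?_
    (fun _ _ _ _ => Iff.rfl) (fun x hx hl => hD _ x (fun _ _ => Finset.mem_univ _) hx hl)
    (fun _ _ => Iff.rfl)
  intro S hS _
  rw [lineDen, flowDen]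
  congr 1
  refine Finset.sum_congr rfl fun i _ => ?_
  have h := hS i
  unfold srcOf tgtOf at *
  cases hs : s i <;> simp only [hs, signOf, if_true, if_false, Bool.false_eq_true] at h ⊢ <;>
    by_cases h1 : G.src i ∈ S <;> by_cases h2 : G.tgt i ∈ S <;> simp_all

/-- The orientation `t` with the lines in `B` reversed. -/
def flipOn [DecidableEq ι] (B : Finset ι) (t : ι → Bool) (i : ι) : Bool :=
  if i ∈ B then !(t i) else t i

theorem flipOn_involutive [DecidableEq ι] (B : Finset ι) : Function.Involutive (flipOn B) := by
  intro t
  funext i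
  unfold flipOn
  split_ifs <;> simp

theorem signOf_flipOn_mul_reflectOn [DecidableEq ι] (B : Finset ι) (t : ι → Bool) (E : ι → ℝ)
    (i : ι) : signOf (flipOn B t i) * reflectOn B E i = signOf (t i) * E i := by
  unfold flipOn reflectOn signOf
  cases t i <;> split_ifs <;> simp_all

/-- Summing over the orientations of the lines in `C` removes their constraints. -/
theorem sum_latestSum_flipOn [Fintype V] [DecidableEq ι] (G : FeynmanGraph V ι)
    (t : ι → Bool) {r : V → V → Prop} {d : Finset V → ℂ} (C : Finset ι)
    (h0 : latestSum r d Finset.univ = 0) :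
    ∑ B ∈ C.powerset, latestSum (fun x y => r x y ∨
      lineRel (G.srcOf (flipOn B t)) (G.tgtOf (flipOn B t)) C x y) d Finset.univ = 0 := by
  induction C using Finset.induction_on with
  | empty => simpa [lineRel] using h0
  | insert e C he ih =>
    have hrel : ∀ s : ι → Bool, (fun x y => r x y ∨
        lineRel (G.srcOf s) (G.tgtOf s) (insert e C) x y) = addRel (fun x y => r x y ∨
        lineRel (G.srcOf s) (G.tgtOf s) C x y) (G.srcOf s e) (G.tgtOf s e) := by
      intro s
      funext x y
      rw [lineRel_insert]
      simp only [addRel, or_assoc]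
    have hcongr : ∀ B : Finset ι, lineRel (G.srcOf (flipOn (insert e B) t))
        (G.tgtOf (flipOn (insert e B) t)) C
        = lineRel (G.srcOf (flipOn B t)) (G.tgtOf (flipOn B t)) C := by
      intro B
      funext x y
      refine propext (exists_congr fun i => and_congr_right fun hi => ?_)
      have hie : i ≠ e := ne_of_mem_of_not_mem hi he
      simp [srcOf, tgtOf, flipOn, hie]
    -- Pair `B` with `insert e B`: they differ only in the constraint of `e` and realize both of its
    -- orientations.
    rw [Finset.sum_powerset_insert he, ← Finset.sum_add_distrib]
    by_cases hst : G.src e = G.tgt e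
    · have hloop : ∀ s, G.srcOf s e = G.tgtOf s e := by
        intro s
        simp [srcOf, tgtOf, hst]
      simp_rw [hrel, hcongr, hloop, latestSum_addRel_self]
      rw [Finset.sum_add_distrib, ih, add_zero]
    · rw [← ih]
      refine Finset.sum_congr rfl fun B hB => ?_
      have heB : e ∉ B := fun h => he (Finset.mem_powerset.1 hB h)
      have h1 : G.srcOf (flipOn (insert e B) t) e = G.tgtOf (flipOn B t) e := by
        cases h : t e <;> simp [srcOf, tgtOf, flipOn, heB, h]
      have h2 : G.tgtOf (flipOn (insert e B) t) e = G.srcOf (flipOn B t) e := by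
        cases h : t e <;> simp [srcOf, tgtOf, flipOn, heB, h]
      rw [hrel, hrel, hcongr, h1, h2]
      refine latestSum_add_addRel d ?_ _ (Finset.mem_univ _) (Finset.mem_univ _)
      unfold srcOf tgtOf
      split_ifs
      exacts [hst, Ne.symm hst]

/-- The signed energies are the same for all `B`, so in the form `flowDen` the denominators are
common to all terms. Summing over `B` frees the lines of `C`, no remaining constraint joins `S` to
its complement, and the factor that comes out is the denominator of the whole vertex set, which is
zero. -/
theorem sum_latestSum_reflectOn_eq_zero [Fintype V] [Fintype ι] [DecidableEq ι]
    (G : FeynmanGraph V ι) {ω : V → ℝ} (hω : ∑ v, ω v = 0) {C : Finset ι}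
    {S : Finset V} (hSne : S.Nonempty) (hSu : S ≠ Finset.univ)
    (hS : ∀ i ∉ C, (G.src i ∈ S ↔ G.tgt i ∈ S)) (t : ι → Bool) (E : ι → ℝ)
    (hgen : ∀ U : Finset V, U.Nonempty → U ≠ Finset.univ → G.flowDen t ω E U ≠ 0) :
    ∑ B ∈ C.powerset,
      latestSum (lineRel (G.srcOf (flipOn B t)) (G.tgtOf (flipOn B t)) Finset.univ)
        (lineDen (G.srcOf (flipOn B t)) (G.tgtOf (flipOn B t)) Finset.univ (reflectOn B E) ω)
        Finset.univ = 0 := by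
  have hflow : ∀ B, G.flowDen (flipOn B t) ω (reflectOn B E) = G.flowDen t ω E := by
    intro B
    funext U
    simp only [flowDen, signOf_flipOn_mul_reflectOn]
  simp_rw [latestSum_lineDen_eq_flowDen, hflow]
  have hunion : S ∪ Sᶜ = Finset.univ := Finset.union_compl S
  have hzero : latestSum (lineRel (G.srcOf t) (G.tgtOf t) Cᶜ) (G.flowDen t ω E) Finset.univ = 0 := by
    rw [← hunion]
    refine latestSum_union_eq_zero disjoint_compl_right ?_
      (fun A hA U hU => G.flowDen_union t ω E ((disjoint_compl_right (a := S)).mono hA hU))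
      (by simp [flowDen]) ?_ hSne ?_ ?_
    · intro a ha b hb
      rw [Finset.mem_compl] at hb
      have key : ∀ i ∉ C, (G.srcOf t i ∈ S ↔ G.tgtOf t i ∈ S) := by
        intro i hi
        unfold srcOf tgtOf
        split_ifs
        exacts [hS i hi, (hS i hi).symm]
      refine ⟨?_, ?_⟩
      · rintro ⟨i, hi, rfl, rfl⟩
        exact hb ((key i (Finset.mem_compl.1 hi)).1 ha)
      · rintro ⟨i, hi, rfl, rfl⟩
        exact hb ((key i (Finset.mem_compl.1 hi)).2 ha)
    · intro U _ hU hne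
      exact hgen U hU (by rwa [hunion] at hne)
    · rw [Finset.nonempty_iff_ne_empty, Ne, Finset.compl_eq_empty_iff]
      exact hSu
    · rw [hunion, flowDen_univ G t hω]
  rw [← G.sum_latestSum_flipOn t C hzero]
  refine Finset.sum_congr rfl fun B hB => ?_
  congr 1
  funext x y
  have hcompl : ∀ i ∉ C, flipOn B t i = t i := fun i hi =>
    if_neg fun h => hi (Finset.mem_powerset.1 hB h)
  refine propext ⟨?_, ?_⟩
  · rintro ⟨i, -, h1, h2⟩
    by_cases hi : i ∈ C
    · exact Or.inr ⟨i, hi, h1, h2⟩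
    · refine Or.inl ⟨i, Finset.mem_compl.2 hi, ?_, ?_⟩
      · simpa [srcOf, hcompl i hi] using h1
      · simpa [tgtOf, hcompl i hi] using h2
  · rintro (⟨i, hi, h1, h2⟩ | ⟨i, -, h1, h2⟩)
    · have hi := Finset.mem_compl.1 hi
      refine ⟨i, Finset.mem_univ i, ?_, ?_⟩
      · simpa [srcOf, hcompl i hi] using h1
      · simpa [tgtOf, hcompl i hi] using h2
    · exact ⟨i, Finset.mem_univ i, h1, h2⟩

/-- The reflections of the energies in a cut set annihilate the sum over the time orderings. -/
theorem sum_orderSum_reflectOn_eq_zero [Fintype V] [Fintype ι] [DecidableEq ι]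
    (G : FeynmanGraph V ι) (γ : Fin 4 → Matrix (Fin 4) (Fin 4) ℂ)
    (Γ : (∀ i, Fin (G.kind i).spinDim) → (∀ i, Fin (G.kind i).spinDim) → ℂ)
    {ω : V → ℝ} (hω : ∑ v, ω v = 0) (T : Finset ι) {C : Finset ι}
    {S : Finset V} (hSne : S.Nonempty) (hSu : S ≠ Finset.univ)
    (hS : ∀ i ∉ C, (G.src i ∈ S ↔ G.tgt i ∈ S)) (E : ι → ℝ)
    (hgen : ∀ t : ι → Bool, ∀ U : Finset V, U.Nonempty → U ≠ Finset.univ →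
      G.flowDen t ω E U ≠ 0) :
    ∑ B ∈ C.powerset, G.orderSum γ Γ ω T (reflectOn B E) = 0 := by
  have hflip : ∀ (B : Finset ι) (a b : ∀ i, Fin (G.kind i).spinDim),
      ∑ s : ι → Bool, Γ a b * G.poleNumerator γ a b s (reflectOn B E) *
        ((2 : ℂ)⁻¹ ^ G.selfLoops T * latestSum (lineRel (G.srcOf s) (G.tgtOf s) Finset.univ)
          (lineDen (G.srcOf s) (G.tgtOf s) Finset.univ (reflectOn B E) ω) Finset.univ)
      = ∑ t : ι → Bool, Γ a b * G.poleNumerator γ a b t E * ((2 : ℂ)⁻¹ ^ G.selfLoops T *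
        latestSum (lineRel (G.srcOf (flipOn B t)) (G.tgtOf (flipOn B t)) Finset.univ)
          (lineDen (G.srcOf (flipOn B t)) (G.tgtOf (flipOn B t)) Finset.univ (reflectOn B E) ω)
          Finset.univ) := by
    intro B a b
    -- With the pole choices written as `s = flipOn B t`, the numerators at the reflected energies
    -- no longer depend on `B`.
    rw [← Equiv.sum_comp ((flipOn_involutive B).toPerm _)]
    refine Finset.sum_congr rfl fun t _ => ?_
    simp only [Function.Involutive.coe_toPerm, poleNumerator, signOf_flipOn_mul_reflectOn]
  simp only [orderSum, hflip]
  rw [Finset.sum_comm]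
  refine Finset.sum_eq_zero fun a _ => ?_
  rw [Finset.sum_comm]
  refine Finset.sum_eq_zero fun b _ => ?_
  rw [Finset.sum_comm]
  refine Finset.sum_eq_zero fun t _ => ?_
  rw [← Finset.mul_sum, ← Finset.mul_sum,
    G.sum_latestSum_reflectOn_eq_zero hω hSne hSu hS t E (hgen t), mul_zero, mul_zero]

end FeynmanGraph

end CutIdentity

/-! ### Rationality and extension from generic energies. -/

section Rational

open MvPolynomial

variable {V ι : Type*}

theorem evalAt_add (P Q : MvPolynomial ι ℂ) (E : ι → ℝ) :
    evalAt (P + Q) E = evalAt P E + evalAt Q E := map_add _ _ _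

theorem evalAt_mul (P Q : MvPolynomial ι ℂ) (E : ι → ℝ) :
    evalAt (P * Q) E = evalAt P E * evalAt Q E := map_mul _ _ _

theorem evalAt_sum {α : Type*} (s : Finset α) (P : α → MvPolynomial ι ℂ) (E : ι → ℝ) :
    evalAt (∑ a ∈ s, P a) E = ∑ a ∈ s, evalAt (P a) E := map_sum _ _ _

theorem evalAt_prod {α : Type*} (s : Finset α) (P : α → MvPolynomial ι ℂ) (E : ι → ℝ) :
    evalAt (∏ a ∈ s, P a) E = ∏ a ∈ s, evalAt (P a) E := map_prod _ _ _

theorem evalAt_C (c : ℂ) (E : ι → ℝ) : evalAt (C c) E = c := by simp [evalAt]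

theorem evalAt_X (i : ι) (E : ι → ℝ) : evalAt (X i) E = E i := by simp [evalAt]

theorem evalAt_one (E : ι → ℝ) : evalAt (1 : MvPolynomial ι ℂ) E = 1 := by simp [evalAt]

theorem evalAt_zero (E : ι → ℝ) : evalAt (0 : MvPolynomial ι ℂ) E = 0 := by simp [evalAt]

theorem ne_zero_of_evalAt_ne_zero {P : MvPolynomial ι ℂ} {E : ι → ℝ} (h : evalAt P E ≠ 0) :
    P ≠ 0 := by
  rintro rfl
  exact h (evalAt_zero E)

/-- Two polynomials that agree at all positive arguments are equal. -/
theorem eq_of_evalAt_eq_of_pos {P Q : MvPolynomial ι ℂ}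
    (h : ∀ E : ι → ℝ, (∀ i, 0 < E i) → evalAt P E = evalAt Q E) : P = Q := by
  refine funext_set (fun _ => Complex.ofReal '' Set.Ioi 0) (fun _ => ?_) fun x hx => ?_
  · exact (Set.Ioi_infinite (0 : ℝ)).image Complex.ofReal_injective.injOn
  · choose E hE hEx using fun i => hx i (Set.mem_univ i)
    have hxE : x = fun i => (E i : ℂ) := funext fun i => (hEx i).symm
    rw [hxE]
    exact h E fun i => hE i

/-- `f` agrees with a rational function without poles at positive arguments, except perhaps at the
poles. -/
def IsRationalOnPos (f : (ι → ℝ) → ℂ) : Prop :=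
  ∃ P Q : MvPolynomial ι ℂ, (∀ E : ι → ℝ, (∀ i, 0 < E i) → evalAt Q E ≠ 0) ∧
    ∀ E, evalAt Q E ≠ 0 → f E = ratFun P Q E

namespace IsRationalOnPos

theorem evalAt (P : MvPolynomial ι ℂ) : IsRationalOnPos (evalAt P) :=
  ⟨P, 1, fun E _ => by simp [evalAt_one], fun E _ => by simp [ratFun, evalAt_one]⟩

theorem const (c : ℂ) : IsRationalOnPos fun _ : ι → ℝ => c := by
  have := evalAt (ι := ι) (C c)
  simpa only [funext (evalAt_C (ι := ι) c)] using this

theorem add {f g : (ι → ℝ) → ℂ} (hf : IsRationalOnPos f) (hg : IsRationalOnPos g) :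
    IsRationalOnPos fun E => f E + g E := by
  obtain ⟨P, Q, hQ, h⟩ := hf
  obtain ⟨P', Q', hQ', h'⟩ := hg
  refine ⟨P * Q' + Q * P', Q * Q', fun E hE => ?_, fun E hE => ?_⟩
  · rw [evalAt_mul]
    exact mul_ne_zero (hQ E hE) (hQ' E hE)
  · rw [evalAt_mul] at hE
    simp only [h E (left_ne_zero_of_mul hE), h' E (right_ne_zero_of_mul hE), ratFun, evalAt_add,
      evalAt_mul]
    rw [div_add_div _ _ (left_ne_zero_of_mul hE) (right_ne_zero_of_mul hE)]

theorem mul {f g : (ι → ℝ) → ℂ} (hf : IsRationalOnPos f) (hg : IsRationalOnPos g) :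
    IsRationalOnPos fun E => f E * g E := by
  obtain ⟨P, Q, hQ, h⟩ := hf
  obtain ⟨P', Q', hQ', h'⟩ := hg
  refine ⟨P * P', Q * Q', fun E hE => ?_, fun E hE => ?_⟩
  · rw [evalAt_mul]
    exact mul_ne_zero (hQ E hE) (hQ' E hE)
  · rw [evalAt_mul] at hE
    simp only [h E (left_ne_zero_of_mul hE), h' E (right_ne_zero_of_mul hE), ratFun, evalAt_mul]
    rw [div_mul_div_comm]

theorem inv_evalAt {Q : MvPolynomial ι ℂ}
    (hQ : ∀ E : ι → ℝ, (∀ i, 0 < E i) → _root_.evalAt Q E ≠ 0) :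
    IsRationalOnPos fun E => (_root_.evalAt Q E)⁻¹ :=
  ⟨1, Q, hQ, fun E _ => by rw [ratFun, evalAt_one, one_div]⟩

theorem sum {α : Type*} {s : Finset α} {f : α → (ι → ℝ) → ℂ}
    (h : ∀ a ∈ s, IsRationalOnPos (f a)) : IsRationalOnPos fun E => ∑ a ∈ s, f a E := by
  classical
  induction s using Finset.induction_on with
  | empty => simpa using const 0
  | insert a s ha ih =>
    simp only [Finset.sum_insert ha]
    exact (h a (Finset.mem_insert_self a s)).add
      (ih fun b hb => h b (Finset.mem_insert_of_mem hb))

end IsRationalOnPos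

/-- The reversal of the signs of the variables in `B`. -/
noncomputable def reflectPoly [DecidableEq ι] (B : Finset ι) :
    MvPolynomial ι ℂ →ₐ[ℂ] MvPolynomial ι ℂ :=
  aeval fun i => if i ∈ B then -X i else X i

theorem evalAt_reflectPoly [DecidableEq ι] (B : Finset ι) (P : MvPolynomial ι ℂ) (E : ι → ℝ) :
    evalAt (reflectPoly B P) E = evalAt P (reflectOn B E) := by
  induction P using MvPolynomial.induction_on with
  | C a => rw [reflectPoly, aeval_C, algebraMap_eq, evalAt_C, evalAt_C]
  | add p q hp hq => rw [map_add, evalAt_add, evalAt_add, hp, hq]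
  | mul_X p i hp =>
    rw [map_mul, evalAt_mul, evalAt_mul, hp, evalAt_X]
    congr 1
    by_cases hi : i ∈ B <;> simp [reflectPoly, reflectOn, hi, evalAt]

theorem reflectOn_reflectOn [DecidableEq ι] (B : Finset ι) (E : ι → ℝ) :
    reflectOn B (reflectOn B E) = E := by
  funext i
  unfold reflectOn
  split_ifs <;> simp

/-- Expanding the product means choosing the identity or the reflection for each line of `C`, that
is, a subset `B`. -/
theorem annihilationOp_apply [DecidableEq ι] (C : Finset ι) (f : (ι → ℝ) → ℂ) (E : ι → ℝ) :
    annihilationOp C f E = ∑ B ∈ C.powerset, f (reflectOn B E) := by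
  induction C using Finset.induction_on generalizing E with
  | empty =>
    have : reflectOn (∅ : Finset ι) E = E := by
      funext i
      simp [reflectOn]
    simp [annihilationOp, this]
  | insert e C he ih =>
    have hstep : annihilationOp (insert e C) f E
        = annihilationOp C f E + annihilationOp C f (Function.update E e (-E e)) := by
      unfold annihilationOp
      rw [Finset.noncommProd_insert_of_notMem _ _ _ _ he]
      rfl
    rw [hstep, ih, ih, Finset.sum_powerset_insert he]
    congr 1
    refine Finset.sum_congr rfl fun B hB => ?_
    have heB : e ∉ B := fun h => he (Finset.mem_powerset.1 hB h)
    congr 1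
    funext i
    by_cases hi : i = e
    · subst hi
      simp [reflectOn, heB]
    · simp [reflectOn, hi]

namespace FeynmanGraph

variable [DecidableEq V] [Fintype ι]

/-- `flowDen` as a polynomial in the line energies. -/
noncomputable def flowPoly (G : FeynmanGraph V ι) (t : ι → Bool) (ω : V → ℝ) (S : Finset V) :
    MvPolynomial ι ℂ :=
  C (Complex.I * ((∑ v ∈ S, ω v : ℝ) : ℂ)) + ∑ i, C ((signOf (t i) : ℂ) *
    ((if G.src i ∈ S then 1 else 0) - (if G.tgt i ∈ S then 1 else 0))) * X i

theorem evalAt_flowPoly (G : FeynmanGraph V ι) (t : ι → Bool) (ω : V → ℝ) (S : Finset V)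
    (E : ι → ℝ) : evalAt (G.flowPoly t ω S) E = G.flowDen t ω E S := by
  rw [flowPoly, flowDen, evalAt_add, evalAt_C, evalAt_sum]
  congr 1
  refine Finset.sum_congr rfl fun i _ => ?_
  rw [evalAt_mul, evalAt_C, evalAt_X]
  push_cast
  ring

theorem flowPoly_ne_zero [Fintype V] {G : FeynmanGraph V ι} (hG : G.IsConnected) (t : ι → Bool) (ω : V → ℝ)
    {S : Finset V} (hne : S.Nonempty) (hS : S ≠ Finset.univ) : G.flowPoly t ω S ≠ 0 := by
  obtain ⟨e, he⟩ := hG.exists_crossing hne hS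
  -- Each energy is set equal to its own coefficient; the real part becomes a sum of squares, and
  -- the crossing line contributes a nonzero one.
  set E : ι → ℝ := fun i => signOf (t i) *
    ((if G.src i ∈ S then 1 else 0) - (if G.tgt i ∈ S then 1 else 0)) with hE
  refine ne_zero_of_evalAt_ne_zero (E := E) fun h0 => ?_
  rw [evalAt_flowPoly, flowDen] at h0
  have hre := congrArg Complex.re h0
  have hterm : ∀ i, (((signOf (t i) * E i : ℝ) : ℂ) *
      ((if G.src i ∈ S then 1 else 0) - (if G.tgt i ∈ S then 1 else 0))).re = (E i) ^ 2 := by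
    intro i
    simp only [hE]
    split_ifs <;> simp <;> ring
  simp only [Complex.add_re, Complex.re_sum, hterm] at hre
  simp only [Complex.mul_re, Complex.I_re, Complex.ofReal_re, zero_mul, Complex.I_im,
    Complex.ofReal_im, mul_zero, sub_self, zero_add, Complex.zero_re] at hre
  have hz := (Finset.sum_eq_zero_iff_of_nonneg fun i _ => sq_nonneg (E i)).1 hre e
    (Finset.mem_univ e)
  have : E e ≠ 0 := by
    simp only [hE, signOf]
    by_cases h1 : G.src e ∈ S <;> by_cases h2 : G.tgt e ∈ S <;> simp_all <;> split_ifs <;> simp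
  exact this (pow_eq_zero_iff two_ne_zero |>.1 hz)

/-- `lineDen` as a polynomial in the line energies. -/
noncomputable def linePoly (p q : ι → V) (ω : V → ℝ) (S : Finset V) : MvPolynomial ι ℂ :=
  C (Complex.I * ((∑ v ∈ S, ω v : ℝ) : ℂ)) + ∑ i, if (p i ∈ S ↔ q i ∈ S) then 0 else X i

theorem evalAt_linePoly (p q : ι → V) (ω : V → ℝ) (S : Finset V) (E : ι → ℝ) :
    evalAt (linePoly p q ω S) E = lineDen p q Finset.univ E ω S := by
  rw [linePoly, lineDen, evalAt_add, evalAt_C, evalAt_sum]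
  congr 1
  refine Finset.sum_congr rfl fun i _ => ?_
  split_ifs
  · exact evalAt_zero E
  · exact evalAt_X i E

/-- A crossing line gives each denominator a positive real part at positive energies, so no inverse
in the recursion has a pole there. -/
theorem isRationalOnPos_chainSum [Fintype V] (r : V → V → Prop) {p q : ι → V} (ω : V → ℝ)
    (hcr : ∀ S : Finset V, S.Nonempty → S ≠ Finset.univ → ∃ i, ¬ (p i ∈ S ↔ q i ∈ S))
    (S : Finset V) (hS : S ≠ Finset.univ) :
    IsRationalOnPos fun E => chainSum r (lineDen p q Finset.univ E ω) S := by
  classical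
  induction S using Finset.strongInduction with
  | H S ih =>
    rcases S.eq_empty_or_nonempty with rfl | hne
    · simpa only [chainSum_empty] using IsRationalOnPos.const 1
    · simp only [chainSum_of_nonempty _ _ hne, latestSum]
      refine IsRationalOnPos.mul ?_ (IsRationalOnPos.sum fun x hx => ?_)
      · simp only [← evalAt_linePoly]
        refine IsRationalOnPos.inv_evalAt fun E hE h0 => ?_
        rw [evalAt_linePoly] at h0
        obtain ⟨i, hi⟩ := hcr S hne hS
        have := lineDen_re_pos p q hE ω ⟨i, Finset.mem_univ i, hi⟩
        rw [h0] at this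
        exact lt_irrefl _ this
      · by_cases h : IsLatest r S x
        · simp only [h, if_true]
          refine ih _ (Finset.erase_ssubset hx) fun h => ?_
          exact Finset.notMem_erase x S (h ▸ Finset.mem_univ x)
        · simpa only [h, if_false] using IsRationalOnPos.const 0

theorem isRationalOnPos_orderSum [Fintype V] [DecidableEq ι] {G : FeynmanGraph V ι} (hG : G.IsConnected)
    (γ : Fin 4 → Matrix (Fin 4) (Fin 4) ℂ)
    (Γ : (∀ i, Fin (G.kind i).spinDim) → (∀ i, Fin (G.kind i).spinDim) → ℂ)
    (ω : V → ℝ) (T : Finset ι) : IsRationalOnPos (G.orderSum γ Γ ω T) := by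
  classical
  unfold orderSum
  refine IsRationalOnPos.sum fun a _ => IsRationalOnPos.sum fun b _ =>
    IsRationalOnPos.sum fun s _ => ?_
  refine ((IsRationalOnPos.const _).mul ?_).mul ((IsRationalOnPos.const _).mul ?_)
  · have : G.poleNumerator γ a b s = evalAt (∏ i, (C ((G.kind i).numeratorConst γ (a i) (b i))
        + C (-(signOf (s i) : ℂ) * (G.kind i).numeratorSlope γ (a i) (b i)) * X i)) := by
      funext E
      rw [evalAt_prod, poleNumerator]
      refine Finset.prod_congr rfl fun i _ => ?_
      rw [evalAt_add, evalAt_mul, evalAt_C, evalAt_C, evalAt_X]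
      push_cast
      ring
    rw [this]
    exact IsRationalOnPos.evalAt _
  · unfold latestSum
    refine IsRationalOnPos.sum fun x _ => ?_
    split_ifs
    · refine isRationalOnPos_chainSum _ ω (fun S hne hS => ?_) _ fun h => ?_
      · obtain ⟨i, hi⟩ := hG.exists_crossing hne hS
        refine ⟨i, ?_⟩
        unfold srcOf tgtOf
        split_ifs
        exacts [hi, fun h => hi h.symm]
      · exact (Finset.erase_ssubset (Finset.mem_univ x)).ne h
    · exact IsRationalOnPos.const 0

end FeynmanGraph

/-- If the reflected values of a rational function add up to zero away from the zeros of a nonzero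
polynomial, then they do wherever no denominator vanishes. -/
theorem sum_ratFun_reflectOn_eq_zero [DecidableEq ι] {P Q Z : MvPolynomial ι ℂ} (hZ : Z ≠ 0)
    (𝓑 : Finset (Finset ι))
    (h : ∀ E : ι → ℝ, evalAt Z E ≠ 0 → (∀ B ∈ 𝓑, evalAt Q (reflectOn B E) ≠ 0) →
      ∑ B ∈ 𝓑, ratFun P Q (reflectOn B E) = 0)
    {E : ι → ℝ} (hE : ∀ B ∈ 𝓑, evalAt Q (reflectOn B E) ≠ 0) :
    ∑ B ∈ 𝓑, ratFun P Q (reflectOn B E) = 0 := by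
  -- The sum is `N / W` over a common denominator. The polynomial `N * (Z * W)` vanishes at all
  -- positive points, so it is zero, and `N = 0` because `Z` and `W` are not.
  set N := ∑ B ∈ 𝓑, reflectPoly B P * ∏ B' ∈ 𝓑.erase B, reflectPoly B' Q with hN
  set W := ∏ B ∈ 𝓑, reflectPoly B Q with hW
  have hWE : ∀ E : ι → ℝ, evalAt W E = ∏ B ∈ 𝓑, evalAt Q (reflectOn B E) := fun E => by
    rw [hW, evalAt_prod]
    exact Finset.prod_congr rfl fun B _ => evalAt_reflectPoly B Q E
  have hNE : ∀ E : ι → ℝ, (∀ B ∈ 𝓑, evalAt Q (reflectOn B E) ≠ 0) →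
      evalAt N E = (∑ B ∈ 𝓑, ratFun P Q (reflectOn B E)) * evalAt W E := by
    intro E hE
    rw [hN, evalAt_sum, Finset.sum_mul]
    refine Finset.sum_congr rfl fun B hB => ?_
    rw [hWE, ← Finset.mul_prod_erase 𝓑 _ hB, evalAt_mul, evalAt_prod, ratFun, evalAt_reflectPoly,
      ← mul_assoc, div_mul_cancel₀ _ (hE B hB)]
    simp only [evalAt_reflectPoly]
  have hW0 : W ≠ 0 := by
    rw [hW]
    refine Finset.prod_ne_zero_iff.2 fun B hB => ?_
    exact ne_zero_of_evalAt_ne_zero (E := E) (by rw [evalAt_reflectPoly]; exact hE B hB)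
  have hNZW : N * (Z * W) = 0 := by
    refine eq_of_evalAt_eq_of_pos fun E' _ => ?_
    rw [evalAt_mul, evalAt_mul, evalAt_zero]
    by_cases hz : evalAt Z E' = 0
    · rw [hz, zero_mul, mul_zero]
    · by_cases hw : evalAt W E' = 0
      · rw [hw, mul_zero, mul_zero]
      · rw [hWE] at hw
        have hw := Finset.prod_ne_zero_iff.1 hw
        rw [hNE E' hw, h E' hz hw, zero_mul, zero_mul]
  have hN0 : N = 0 := (mul_eq_zero.1 hNZW).resolve_right (mul_ne_zero hZ hW0)
  have hval := hNE E hE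
  rw [hN0, evalAt_zero] at hval
  refine (mul_eq_zero.1 hval.symm).resolve_right ?_
  rw [hWE]
  exact Finset.prod_ne_zero_iff.2 hE

end Rational

/-! ### Assembly: existence of the rational function and annihilation by cut sets. -/

theorem theorem3 {V ι : Type*} [Fintype V] [DecidableEq V] [Fintype ι] [DecidableEq ι]
    (G : FeynmanGraph V ι) (hG : G.IsConnected)
    (γ : Fin 4 → Matrix (Fin 4) (Fin 4) ℂ) (hγ : IsDiracGamma γ)
    (Γ : (∀ i, Fin (G.kind i).spinDim) → (∀ i, Fin (G.kind i).spinDim) → ℂ)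
    (ω : V → ℝ) (hω : ∑ v, ω v = 0)
    (T : Finset ι) (hT : G.IsSpanningTree T) :
    (∃ P Q : MvPolynomial ι ℂ, G.RepresentsD0 γ Γ ω T P Q) ∧
    ∀ P Q : MvPolynomial ι ℂ, G.RepresentsD0 γ Γ ω T P Q →
      ∀ C : Finset ι, G.IsCutSet C →
        ∀ E : ι → ℝ, (∀ B ⊆ C, evalAt Q (reflectOn B E) ≠ 0) →
          annihilationOp C (ratFun P Q) E = 0 := by
  obtain ⟨P₁, Q₁, hQ₁, h₁⟩ := FeynmanGraph.isRationalOnPos_orderSum hG γ Γ ω T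
  have hval : ∀ E : ι → ℝ, (∀ i, 0 < E i) → G.IsD0Value γ Γ ω T E (ratFun P₁ Q₁ E) :=
    fun E hE => h₁ E (hQ₁ E hE) ▸ G.isD0Value_orderSum γ Γ hT hω hE
  refine ⟨⟨P₁, Q₁, fun E hE => ⟨hQ₁ E hE, hval E hE⟩⟩, fun P Q hPQ C hC E hE => ?_⟩
  -- Limits are unique, so the two fractions agree at positive energies and the cross-multiplied
  -- polynomials are equal.
  have hcross : P * Q₁ = P₁ * Q := by
    refine eq_of_evalAt_eq_of_pos fun E hE => ?_
    have h := tendsto_nhds_unique (hPQ E hE).2 (hval E hE)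
    rwa [ratFun, ratFun, div_eq_div_iff (hPQ E hE).1 (hQ₁ E hE), ← evalAt_mul, ← evalAt_mul] at h
  have heq : ∀ E, evalAt Q E ≠ 0 → evalAt Q₁ E ≠ 0 → ratFun P Q E = G.orderSum γ Γ ω T E := by
    intro E hQE hQ₁E
    rw [h₁ E hQ₁E, ratFun, ratFun, div_eq_div_iff hQE hQ₁E, ← evalAt_mul, ← evalAt_mul, hcross]
  have : Nonempty V := hG.nonempty
  obtain ⟨S, hSne, hSu, hS⟩ := hC.exists_separation
  rw [annihilationOp_apply]
  -- Off the zeros of this `Z`, the order sum equals `P₁ / Q₁` at all reflected points, and no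
  -- signed denominator of a nonempty proper vertex set vanishes.
  refine sum_ratFun_reflectOn_eq_zero
    (Z := (∏ B ∈ C.powerset, reflectPoly B Q₁) * ∏ t : ι → Bool,
      ∏ U ∈ Finset.univ.filter (fun U : Finset V => U.Nonempty ∧ U ≠ Finset.univ),
        G.flowPoly t ω U) ?_ C.powerset ?_ fun B hB => hE B (Finset.mem_powerset.1 hB)
  · refine mul_ne_zero (Finset.prod_ne_zero_iff.2 fun B _ => ?_)
      (Finset.prod_ne_zero_iff.2 fun t _ => Finset.prod_ne_zero_iff.2 fun U hU => ?_)
    -- The second reflection returns to the positive point with all energies 1, where `Q₁` has no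
    -- zero.
    · refine ne_zero_of_evalAt_ne_zero (E := reflectOn B fun _ => 1) ?_
      rw [evalAt_reflectPoly, reflectOn_reflectOn]
      exact hQ₁ _ fun _ => one_pos
    · obtain ⟨-, hne, hU⟩ := Finset.mem_filter.1 hU
      exact FeynmanGraph.flowPoly_ne_zero hG t ω hne hU
  · intro E' hZ hQE'
    rw [evalAt_mul, evalAt_prod, evalAt_prod] at hZ
    have hZ₁ := Finset.prod_ne_zero_iff.1 (left_ne_zero_of_mul hZ)
    have hZ₂ := Finset.prod_ne_zero_iff.1 (right_ne_zero_of_mul hZ)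
    rw [← G.sum_orderSum_reflectOn_eq_zero γ Γ hω T hSne hSu hS E' fun t U hne hU => ?_]
    · refine Finset.sum_congr rfl fun B hB => heq _ (hQE' B hB) ?_
      rw [← evalAt_reflectPoly]
      exact hZ₁ B hB
    · have h := hZ₂ t (Finset.mem_univ t)
      rw [evalAt_prod, Finset.prod_ne_zero_iff] at h
      rw [← G.evalAt_flowPoly]
      exact h U (Finset.mem_filter.2 ⟨Finset.mem_univ _, hne, hU⟩)
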